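/- Let $G$ be a compact Lie group. All $G$-spaces are compactly generated; a based $G$-space has a $G$-fixed base point $*$. Let $\mathscr{W}_G$ be the category of based $G$-spaces homeomorphic to finite based $G$-CW-complexes (built from the base vertex by attaching finitely many cells $G/H\times D^n$ with $H\le G$ closed), with all based continuous maps, equivariant or not, as morphisms. A $\mathscr{W}_G$-space is a functor $Z$ from $\mathscr{W}_G$ to the category of based $G$-spaces and all based continuous maps such that $Z(*)=*$ and such that the maps $\mathrm{Map}_0(A,B)\to \mathrm{Map}_0(Z(A),Z(B))$ are continuous and $G$-equivariant for the conjugation actions. A $G$-equivalence is a $G$-map that induces weak homotopy equivalences $X^H\to Y^H$ on fixed points for all closed subgroups $H\le G$. Write $S^n$ for the one-point compactification of $\mathbb{R}^n$ with trivial $G$-action, $\Sigma A=S^1\wedge A$ and $\Omega X=\mathrm{Map}_0(S^1,X)$. The structure map $S^1\wedge Z(A)\to Z(\Sigma A)$ is $t\wedge z\mapsto Z(\alpha_t)(z)$, where $\alpha_t(a)=t\wedge a$. A naive $G$-prespectrum is a sequence of based $G$-spaces $X_n$ ($n\ge 0$) with based $G$-maps $S^1\wedge X_n\to X_{n+1}$;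 it is a naive $\Omega$-$G$-prespectrum if all adjoint maps $X_n\to\Omega X_{n+1}$ are $G$-equivalences. For $A\in\mathscr{W}_G$, $Z[A]$ denotes the naive $G$-prespectrum $\{Z(S^n\wedge A)\}_{n\ge 0}$ with structure maps $S^1\wedge Z(S^n\wedge A)\to Z(S^1\wedge S^n\wedge A)\cong Z(S^{n+1}\wedge A)$. A square consists of based $G$-maps $f:A\to B$, $g:A\to C$, $h:B\to D$, $k:C\to D$ and a based $G$-homotopy $\eta$ from $hf$ to $kg$ (constant if the square commutes strictly). A square in $\mathscr{W}_G$ is a $G$-homotopy pushout if the induced map from the reduced double mapping cylinder of $B\leftarrow A\to C$ to $D$ is a based $G$-homotopy equivalence. A square of based $G$-spaces is a $G$-homotopy pullback if the induced map from $A$ to the space of triples $(b,\gamma,c)$, with $b\in B$, $c\in C$ and $\gamma$ a path in $D$ from $h(b)$ to $k(c)$, is a $G$-equivalence. Applying $Z$ to a square means applying it to $f,g,h,k$ and to each map $\eta_t$. **Proposition.** For a $\mathscr{W}_G$-space $Z$ the following are equivalent: 1. $Z$ takes $G$-homotopy pushout squares in $\mathscr{W}_G$ to $G$-homotopy pullback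 squares. 2. For every $A\in\mathscr{W}_G$, the prespectrum $Z[A]$ is a naive $\Omega$-$G$-prespectrum. 3. For every $A\in\mathscr{W}_G$, the adjoint structure map $Z(A)\to\Omega Z(\Sigma A)$ is a $G$-equivalence. -/

import Mathlib

open Set Topology unitInterval
open scoped Manifold OnePoint

universe u

/-! ## Weak homotopy equivalences -/

/-- The map induced by `f` on the `n`-th homotopy group (set, for `n = 0`). -/
def homotopyGroupMap {X Y : Type*} [TopologicalSpace X] [TopologicalSpace Y] (f : C(X, Y))
    (n : ℕ) (x : X) : HomotopyGroup (Fin n) X x → HomotopyGroup (Fin n) Y (f x) :=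
  Quotient.map' (s₁ := GenLoop.Homotopic.setoid (Fin n) x)
    (s₂ := GenLoop.Homotopic.setoid (Fin n) (f x))
    (fun p => ⟨f.comp p.1, fun y hy => congrArg f (p.2 y hy)⟩)
    (fun _ _ h => h.map fun F => F.compContinuousMap f)

/-- The map induced by `f` on path components. -/
def pathComponentMap {X Y : Type*} [TopologicalSpace X] [TopologicalSpace Y] (f : C(X, Y)) :
    ZerothHomotopy X → ZerothHomotopy Y :=
  Quotient.map f fun _ _ h => h.map f.continuous

/-- `f` is a weak homotopy equivalence: a bijection on path components, and on all higher homotopy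
groups at all base points. -/
def IsWeakHomotopyEquiv {X Y : Type*} [TopologicalSpace X] [TopologicalSpace Y]
    (f : C(X, Y)) : Prop :=
  Function.Bijective (pathComponentMap f) ∧
    ∀ n : ℕ, 1 ≤ n → ∀ x : X, Function.Bijective (homotopyGroupMap f n x)

/-! ## `G`-maps and `G`-equivalences -/

/-- Equivariance of a function. -/
def IsEquivariant (G : Type*) {X Y : Type*} [SMul G X] [SMul G Y] (f : X → Y) : Prop :=
  ∀ (g : G) (x : X), f (g • x) = g • f x

/-- The map of `H`-fixed points `X^H → Y^H` induced by a `G`-map. -/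
def fixedPointMap {G X Y : Type*} [Group G] [TopologicalSpace X] [TopologicalSpace Y]
    [MulAction G X] [MulAction G Y] (f : C(X, Y)) (hf : IsEquivariant G f) (H : Subgroup G) :
    C(MulAction.fixedPoints H X, MulAction.fixedPoints H Y) where
  toFun x := ⟨f x.1, fun h => by
    have h1 : (h : G) • (x : X) = x := x.2 h
    have h2 := hf (h : G) x.1
    rw [h1] at h2
    exact h2.symm⟩
  continuous_toFun := (f.continuous.comp continuous_subtype_val).subtype_mk _

/-- A `G`-equivalence: a `G`-map that is a weak homotopy equivalence on the `H`-fixed points for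
all closed subgroups `H` of `G`. -/
def IsGEquivalence (G : Type*) {X Y : Type*} [Group G] [TopologicalSpace G]
    [TopologicalSpace X] [TopologicalSpace Y] [MulAction G X] [MulAction G Y]
    (f : C(X, Y)) : Prop :=
  ∃ hf : IsEquivariant G f, ∀ H : Subgroup G, IsClosed (H : Set G) →
    IsWeakHomotopyEquiv (fixedPointMap f hf H)

/-- Two maps are homotopic through based `G`-maps. -/
def BasedGHomotopic (G : Type*) {X Y : Type*} [TopologicalSpace X] [TopologicalSpace Y]
    [SMul G X] [SMul G Y] (x₀ : X) (y₀ : Y) (f₀ f₁ : X → Y) : Prop :=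
  ∃ F : C(I × X, Y), (∀ x, F (0, x) = f₀ x) ∧ (∀ x, F (1, x) = f₁ x) ∧
    (∀ t, IsEquivariant G fun x => F (t, x)) ∧ ∀ t, F (t, x₀) = y₀

/-- A based `G`-homotopy equivalence. -/
def IsBasedGHomotopyEquiv (G : Type*) {X Y : Type*} [TopologicalSpace X] [TopologicalSpace Y]
    [SMul G X] [SMul G Y] (x₀ : X) (y₀ : Y) (f : C(X, Y)) : Prop :=
  IsEquivariant G f ∧ f x₀ = y₀ ∧ ∃ e : C(Y, X), IsEquivariant G e ∧ e y₀ = x₀ ∧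
    BasedGHomotopic G x₀ x₀ (e ∘ f) id ∧ BasedGHomotopic G y₀ y₀ (f ∘ e) id

/-! ## Based `G`-spaces -/

/-- A compactly generated based `G`-space; the base point is fixed by `G`. -/
structure BasedGSpace (G : Type u) [Group G] [TopologicalSpace G] where
  carrier : Type u
  [topology : TopologicalSpace carrier]
  [action : MulAction G carrier]
  [continuousSMul : ContinuousSMul G carrier]
  [compactlyGenerated : CompactlyGeneratedSpace carrier]
  pt : carrier
  smul_pt : ∀ g : G, g • pt = pt

namespace BasedGSpace

variable {G : Type u} [Group G] [TopologicalSpace G]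

instance : CoeSort (BasedGSpace G) (Type u) := ⟨carrier⟩

attribute [instance] topology action continuousSMul compactlyGenerated

/-- The space of all based maps (not necessarily equivariant), with the compact-open topology. -/
abbrev Hom (X Y : BasedGSpace G) : Type u := {f : C(X, Y) // f X.pt = Y.pt}

/-- The identity map. -/
def Hom.id (X : BasedGSpace G) : Hom X X := ⟨ContinuousMap.id X, rfl⟩

/-- Composition of based maps. -/
def Hom.comp {X Y W : BasedGSpace G} (f : Hom Y W) (e : Hom X Y) : Hom X W :=
  ⟨f.1.comp e.1, by rw [ContinuousMap.comp_apply, e.2, f.2]⟩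

/-- The constant map at the base point. -/
def Hom.zero (X Y : BasedGSpace G) : Hom X Y := ⟨ContinuousMap.const X Y.pt, rfl⟩

/-- The conjugation action of `G` on the space of based maps. -/
def Hom.conj {X Y : BasedGSpace G} (g : G) (f : Hom X Y) : Hom X Y :=
  ⟨⟨fun x => g • f.1 (g⁻¹ • x), by fun_prop⟩, by
    change g • f.1 (g⁻¹ • X.pt) = Y.pt
    rw [X.smul_pt, f.2, Y.smul_pt]⟩

/-- The one-point `G`-space. -/
def point (G : Type u) [Group G] [TopologicalSpace G] : BasedGSpace G :=
  letI : MulAction G PUnit.{u + 1} :=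
    { smul := fun _ x => x, one_smul := fun _ => rfl, mul_smul := fun _ _ _ => rfl }
  haveI : ContinuousSMul G PUnit.{u + 1} := ⟨continuous_const⟩
  { carrier := PUnit.{u + 1}
    pt := PUnit.unit
    smul_pt := fun _ => rfl }

end BasedGSpace

/-! ## Finite `G`-CW-complexes -/

/-- The closed `n`-disc, as the unit ball of `ℝⁿ` in the maximum norm. -/
abbrev Disc (n : ℕ) : Type := Metric.closedBall (0 : Fin n → ℝ) 1

/-- The structure of a finite based `G`-CW-complex on a based `G`-space: the base point is a
vertex, and the rest of the space is the disjoint union of finitely many open cells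
`G/H × int Dⁿ` with `H` closed; the boundary of an `n`-cell lies in the union of the base point and
the open cells of dimension less than `n`. -/
structure FiniteGCWStructure {G : Type u} [Group G] [TopologicalSpace G] (X : BasedGSpace G) where
  numCells : ℕ
  dim : Fin numCells → ℕ
  isotropy : Fin numCells → Subgroup G
  isClosed_isotropy : ∀ i, IsClosed (isotropy i : Set G)
  /-- The characteristic map of a cell. -/
  char : ∀ i, C((G ⧸ isotropy i) × Disc (dim i), X)
  char_smul : ∀ i (g : G) c x, char i (g • c, x) = g • char i (c, x)
  injOn : ∀ i, InjOn (char i) {p | ‖(p.2 : Fin (dim i) → ℝ)‖ < 1}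
  disjoint : ∀ i j, i ≠ j → Disjoint (char i '' {p | ‖(p.2 : Fin (dim i) → ℝ)‖ < 1})
    (char j '' {p | ‖(p.2 : Fin (dim j) → ℝ)‖ < 1})
  pt_notMem : ∀ i, X.pt ∉ char i '' {p | ‖(p.2 : Fin (dim i) → ℝ)‖ < 1}
  cover : ∀ x : X, x = X.pt ∨ ∃ i, x ∈ char i '' {p | ‖(p.2 : Fin (dim i) → ℝ)‖ < 1}
  boundary : ∀ i p, ‖(p.2 : Fin (dim i) → ℝ)‖ = 1 → char i p = X.pt ∨
    ∃ j, dim j < dim i ∧ char i p ∈ char j '' {p | ‖(p.2 : Fin (dim j) → ℝ)‖ < 1}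

/-- A based `G`-space that is homeomorphic to a finite based `G`-CW-complex. For compact `G` and a
Hausdorff space, having finitely many cells makes the topology the one of the `G`-CW-complex. -/
def IsFiniteGCW {G : Type u} [Group G] [TopologicalSpace G] (X : BasedGSpace G) : Prop :=
  T2Space X ∧ Nonempty (FiniteGCWStructure X)

/-- The objects of the category `𝒲_G`. Its morphisms are all based maps. -/
structure WG (G : Type u) [Group G] [TopologicalSpace G] where
  toBased : BasedGSpace G
  isFiniteGCW : IsFiniteGCW toBased

/-- The one-point space as an object of `𝒲_G`. -/
def WG.point (G : Type u) [Group G] [TopologicalSpace G] : WG G where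
  toBased := BasedGSpace.point G
  isFiniteGCW := ⟨inferInstanceAs (T2Space PUnit), ⟨{
    numCells := 0
    dim := fun i => i.elim0
    isotropy := fun i => i.elim0
    isClosed_isotropy := fun i => i.elim0
    char := fun i => i.elim0
    char_smul := fun i => i.elim0
    injOn := fun i => i.elim0
    disjoint := fun i => i.elim0
    pt_notMem := fun i => i.elim0
    cover := fun _ => Or.inl rfl
    boundary := fun i => i.elim0 }⟩⟩

/-! ## Spheres and smash products with spheres -/

/-- The sphere `Sⁿ`, the one-point compactification of `ℝⁿ`, with base point `∞`. -/
abbrev Sphere (n : ℕ) : Type := OnePoint (Fin n → ℝ)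

/-- Collapsing the complement of an open subspace of a Hausdorff space is continuous. -/
theorem continuous_collapse {K X : Type*} [TopologicalSpace K] [TopologicalSpace X] [T2Space K]
    {e : X → K} (he : IsOpenEmbedding e) {c : K → OnePoint X} (h1 : ∀ x, c (e x) = x)
    (h2 : ∀ k, k ∉ range e → c k = ∞) : Continuous c := by
  have key : ∀ U : Set (OnePoint X), ∞ ∉ U → c ⁻¹' U = e '' ((↑) ⁻¹' U) := by
    intro U hU
    ext k
    constructor
    · intro hk
      by_cases hr : k ∈ range e
      · obtain ⟨x, rfl⟩ := hr
        exact ⟨x, by simpa [h1] using hk, rfl⟩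
      · rw [mem_preimage, h2 k hr] at hk
        exact absurd hk hU
    · rintro ⟨x, hx, rfl⟩
      simpa [h1] using hx
  refine continuous_def.2 fun U hU => ?_
  by_cases hi : ∞ ∈ U
  · rw [← isClosed_compl_iff, ← preimage_compl, key _ (by simpa using hi)]
    have := ((OnePoint.isOpen_iff_of_mem' hi).1 hU).1
    rw [← preimage_compl] at this
    exact (this.image he.continuous).isClosed
  · rw [key U hi]
    exact he.isOpenMap _ ((OnePoint.isOpen_iff_of_notMem hi).1 hU)

section Smash

variable {G : Type u} [Group G] [TopologicalSpace G]

/-- The wedge `Sⁿ ∨ Y` as a subspace of `Sⁿ × Y`. -/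
def wedge (n : ℕ) (Y : BasedGSpace G) : Set (Sphere n × Y) := {p | p.1 = ∞ ∨ p.2 = Y.pt}

/-- The equivalence relation on `Sⁿ × Y` that collapses the wedge to a point. -/
def smashSetoid (n : ℕ) (Y : BasedGSpace G) : Setoid (Sphere n × Y) where
  r p q := p = q ∨ (p ∈ wedge n Y ∧ q ∈ wedge n Y)
  iseqv :=
    { refl := fun _ => Or.inl rfl
      symm := by
        rintro p q (h | ⟨h, h'⟩)
        · exact Or.inl h.symm
        · exact Or.inr ⟨h', h⟩
      trans := by
        rintro p q r (rfl | ⟨h, h'⟩) (rfl | ⟨k, k'⟩)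
        · exact Or.inl rfl
        · exact Or.inr ⟨k, k'⟩
        · exact Or.inr ⟨h, h'⟩
        · exact Or.inr ⟨h, k'⟩ }

/-- The smash product `Sⁿ ∧ Y = (Sⁿ × Y) / (Sⁿ ∨ Y)`. -/
def Smash (n : ℕ) (Y : BasedGSpace G) : Type u := Quotient (smashSetoid n Y)

instance (n : ℕ) (Y : BasedGSpace G) : TopologicalSpace (Smash n Y) :=
  inferInstanceAs (TopologicalSpace (Quotient (smashSetoid n Y)))

namespace Smash

variable {n : ℕ} {Y : BasedGSpace G}

/-- The point `s ∧ y`. -/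
def mk (s : Sphere n) (y : Y) : Smash n Y := Quotient.mk (smashSetoid n Y) (s, y)

/-- The base point. -/
def pt (n : ℕ) (Y : BasedGSpace G) : Smash n Y := mk ∞ Y.pt

theorem isQuotientMap_mk : IsQuotientMap (fun p : Sphere n × Y => mk p.1 p.2) :=
  isQuotientMap_quotient_mk'

theorem continuous_mk : Continuous (fun p : Sphere n × Y => mk p.1 p.2) :=
  isQuotientMap_mk.continuous

theorem mk_eq_mk {s s' : Sphere n} {y y' : Y} : mk s y = mk s' y' ↔
    (s, y) = (s', y') ∨ ((s, y) ∈ wedge n Y ∧ (s', y') ∈ wedge n Y) :=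
  Quotient.eq (r := smashSetoid n Y)

theorem mk_infty (y : Y) : mk (∞ : Sphere n) y = pt n Y :=
  mk_eq_mk.2 (Or.inr ⟨Or.inl rfl, Or.inl rfl⟩)

theorem mk_pt (s : Sphere n) : mk s Y.pt = pt n Y :=
  mk_eq_mk.2 (Or.inr ⟨Or.inr rfl, Or.inl rfl⟩)

theorem mk_eq_pt {s : Sphere n} {y : Y} : mk s y = pt n Y ↔ s = ∞ ∨ y = Y.pt := by
  constructor
  · intro h
    rcases mk_eq_mk.1 h with h | h
    · exact Or.inl (congrArg Prod.fst h)
    · exact h.1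
  · rintro (rfl | rfl)
    · exact mk_infty y
    · exact mk_pt s

theorem ind {p : Smash n Y → Prop} (h : ∀ s y, p (mk s y)) (x : Smash n Y) : p x :=
  Quotient.ind (fun q => h q.1 q.2) x

/-- A function of two variables that takes the wedge to one point factors through the smash
product. -/
def lift {W : Type*} (φ : Sphere n → Y → W) (w : W) (h1 : ∀ y, φ ∞ y = w)
    (h2 : ∀ s, φ s Y.pt = w) : Smash n Y → W :=
  Quotient.lift (fun p : Sphere n × Y => φ p.1 p.2) (by
    have : ∀ p ∈ wedge n Y, φ p.1 p.2 = w := by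
      rintro ⟨s, y⟩ (h | h)
      · change s = ∞ at h
        rw [h]; exact h1 y
      · change y = Y.pt at h
        rw [h]; exact h2 s
    rintro p q (rfl | ⟨h, h'⟩)
    · rfl
    · exact (this p h).trans (this q h').symm)

/-- `G` acts on `Sⁿ ∧ Y` through `Y`. -/
instance : MulAction G (Smash n Y) where
  smul g := lift (fun s y => mk s (g • y)) (pt n Y) (fun _ => mk_infty _)
    (fun s => by rw [Y.smul_pt]; exact mk_pt s)
  one_smul := ind fun s y => by
    change mk s ((1 : G) • y) = mk s y
    rw [one_smul]
  mul_smul a b := ind fun s y => by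
    change mk s ((a * b) • y) = mk s (a • b • y)
    rw [mul_smul]

theorem smul_mk (g : G) (s : Sphere n) (y : Y) : g • mk s y = mk s (g • y) := rfl

theorem smul_pt (g : G) : g • pt n Y = pt n Y := by
  change mk ∞ (g • Y.pt) = _
  exact mk_infty _

/-- A map out of `K × (Sⁿ ∧ Y)`, with `K` locally compact, is continuous if its pullback to
`K × Sⁿ × Y` is. -/
theorem continuous_of_prod {K W : Type*} [TopologicalSpace K] [LocallyCompactSpace K]
    [TopologicalSpace W] (φ : K × Smash n Y → W)
    (h : Continuous fun p : K × (Sphere n × Y) => φ (p.1, mk p.2.1 p.2.2)) : Continuous φ := by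
  have h' : Continuous fun p : (Sphere n × Y) × K => φ (p.2, mk p.1.1 p.1.2) :=
    h.comp continuous_swap
  have hc : ∀ x : Smash n Y, Continuous fun k : K => φ (k, x) :=
    ind fun s y => h.comp (by fun_prop : Continuous fun k : K => (k, (s, y)))
  have hF : Continuous fun x : Smash n Y => (⟨fun k => φ (k, x), hc x⟩ : C(K, W)) := by
    rw [isQuotientMap_mk.continuous_iff]
    exact ((⟨_, h'⟩ : C((Sphere n × Y) × K, W)).curry).continuous
  exact (ContinuousMap.continuous_uncurry_of_continuous ⟨_, hF⟩).comp continuous_swap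

end Smash

/-! ### `Sⁿ ∧ A` is a finite `G`-CW-complex if `A` is one -/

theorem compactSpace_of_isFiniteGCW [CompactSpace G] {X : BasedGSpace G} (h : IsFiniteGCW X) :
    CompactSpace X := by
  obtain ⟨-, ⟨S⟩⟩ := h
  refine ⟨?_⟩
  have : (univ : Set X) = {X.pt} ∪ ⋃ i, range (S.char i) := by
    refine (eq_univ_of_forall fun x => ?_).symm
    rcases S.cover x with h | ⟨i, p, -, hp⟩
    · exact Or.inl h
    · exact Or.inr (mem_iUnion.2 ⟨i, p, hp⟩)
  rw [this]
  exact isCompact_singleton.union (isCompact_iUnion fun i => isCompact_range (S.char i).continuous)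

theorem t2Space_of_isClosedMap {X Y : Type*} [TopologicalSpace X] [TopologicalSpace Y]
    [NormalSpace X] {f : X → Y} (hf : IsQuotientMap f) (hc : IsClosedMap f)
    (h1 : ∀ y, IsClosed (f ⁻¹' {y})) : T2Space Y := by
  refine ⟨fun y z hyz => ?_⟩
  obtain ⟨U, V, hU, hV, hyU, hzV, hUV⟩ := normal_separation (h1 y) (h1 z)
    (Disjoint.preimage f (by simpa using hyz))
  refine ⟨(f '' Uᶜ)ᶜ, (f '' Vᶜ)ᶜ, (hc _ hU.isClosed_compl).isOpen_compl,
    (hc _ hV.isClosed_compl).isOpen_compl, ?_, ?_, ?_⟩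
  · rintro ⟨x, hx, rfl⟩
    exact hx (hyU rfl)
  · rintro ⟨x, hx, rfl⟩
    exact hx (hzV rfl)
  · refine Set.disjoint_left.2 fun w hw hw' => ?_
    obtain ⟨x, rfl⟩ := hf.surjective w
    have hxU : x ∈ U := by_contra fun h => hw ⟨x, h, rfl⟩
    have hxV : x ∈ V := by_contra fun h => hw' ⟨x, h, rfl⟩
    exact Set.disjoint_left.1 hUV hxU hxV

theorem isClosed_wedge (n : ℕ) (Y : BasedGSpace G) [T2Space Y] : IsClosed (wedge n Y) :=
  (isClosed_singleton.preimage continuous_fst).union (isClosed_singleton.preimage continuous_snd)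

theorem smash_t2Space (n : ℕ) (Y : BasedGSpace G) [T2Space Y] [CompactSpace Y] :
    T2Space (Smash n Y) := by
  refine t2Space_of_isClosedMap (Smash.isQuotientMap_mk (n := n) (Y := Y)) ?_ ?_
  · intro C hC
    rw [← Smash.isQuotientMap_mk.isClosed_preimage]
    by_cases h : (C ∩ wedge n Y).Nonempty
    · obtain ⟨c, hc, hc'⟩ := h
      convert! hC.union (isClosed_wedge n Y) using 1
      ext ⟨s, y⟩
      constructor
      · rintro ⟨⟨s', y'⟩, h, h'⟩
        rcases Smash.mk_eq_mk.1 h' with h' | h'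
        · exact Or.inl (h' ▸ h)
        · exact Or.inr h'.2
      · rintro (h | h)
        · exact ⟨_, h, rfl⟩
        · exact ⟨c, hc, Smash.mk_eq_mk.2 (Or.inr ⟨hc', h⟩)⟩
    · convert! hC using 1
      ext ⟨s, y⟩
      constructor
      · rintro ⟨⟨s', y'⟩, hm, h'⟩
        rcases Smash.mk_eq_mk.1 h' with h' | h'
        · exact h' ▸ hm
        · exact absurd ⟨_, hm, h'.1⟩ h
      · intro h
        exact ⟨_, h, rfl⟩
  · refine Smash.ind fun s y => ?_
    by_cases h : (s, y) ∈ wedge n Y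
    · convert! isClosed_wedge n Y using 1
      ext ⟨s', y'⟩
      constructor
      · intro h'
        rcases Smash.mk_eq_mk.1 h' with h' | h'
        · exact h' ▸ h
        · exact h'.1
      · intro h'
        exact Smash.mk_eq_mk.2 (Or.inr ⟨h', h⟩)
    · convert! isClosed_singleton (x := (s, y)) using 1
      ext ⟨s', y'⟩
      constructor
      · intro h'
        rcases Smash.mk_eq_mk.1 h' with h' | h'
        · exact h'
        · exact absurd h'.2 h
      · rintro h'
        exact Smash.mk_eq_mk.2 (Or.inl h')

theorem smash_continuousSMul [CompactSpace G] [T2Space G] (n : ℕ) (Y : BasedGSpace G) :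
    ContinuousSMul G (Smash n Y) := by
  refine ⟨Smash.continuous_of_prod (K := G) _ ?_⟩
  exact Smash.continuous_mk.comp
    (by fun_prop : Continuous fun p : G × (Sphere n × Y) => (p.2.1, p.1 • p.2.2))

/-- The relative homeomorphism `(Dⁿ, ∂Dⁿ) → (Sⁿ, ∞)`. -/
theorem exists_discCollapse (n : ℕ) : ∃ c : C(Disc n, Sphere n),
    (∀ x : Disc n, c x = ∞ ↔ ¬ ‖(x : Fin n → ℝ)‖ < 1) ∧
    (∀ x y : Disc n, ‖(x : Fin n → ℝ)‖ < 1 → ‖(y : Fin n → ℝ)‖ < 1 → c x = c y → x = y) ∧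
    ∀ v : Fin n → ℝ, ∃ x : Disc n, ‖(x : Fin n → ℝ)‖ < 1 ∧ c x = v := by
  classical
  let b : (Fin n → ℝ) ≃ₜ Metric.ball (0 : Fin n → ℝ) 1 := Homeomorph.unitBall
  let e : (Fin n → ℝ) → Disc n := fun v => ⟨b v, Metric.ball_subset_closedBall (b v).2⟩
  have hin : ∀ v, ‖(e v : Fin n → ℝ)‖ < 1 := fun v => by
    have := (b v).2
    rwa [mem_ball_zero_iff] at this
  have hrange : ∀ x : Disc n, x ∈ range e ↔ ‖(x : Fin n → ℝ)‖ < 1 := by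
    intro x
    constructor
    · rintro ⟨v, rfl⟩
      exact hin v
    · intro hx
      refine ⟨b.symm ⟨x, mem_ball_zero_iff.2 hx⟩, Subtype.ext ?_⟩
      simp [e]
  have hinj : Function.Injective e := fun v w h => by
    have : (b v : Fin n → ℝ) = b w := congrArg (fun x : Disc n => (x : Fin n → ℝ)) h
    exact b.injective (Subtype.ext this)
  have he : IsOpenEmbedding e := by
    refine IsOpenEmbedding.of_isEmbedding_isOpenMap ?_ ?_
    · have h1 : IsEmbedding fun v => (b v : Fin n → ℝ) :=
        IsEmbedding.subtypeVal.comp b.isEmbedding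
      exact IsEmbedding.of_comp (by fun_prop) continuous_subtype_val h1
    · intro U hU
      have h1 : IsOpen (Subtype.val '' (b '' U)) :=
        Metric.isOpen_ball.isOpenMap_subtype_val _ (b.isOpenMap U hU)
      convert! h1.preimage (continuous_subtype_val : Continuous (Subtype.val : Disc n → _)) using 1
      ext x
      constructor
      · rintro ⟨v, hv, rfl⟩
        exact ⟨b v, ⟨v, hv, rfl⟩, rfl⟩
      · rintro ⟨_, ⟨v, hv, rfl⟩, h⟩
        exact ⟨v, hv, Subtype.ext h⟩
  let c : Disc n → Sphere n := fun x =>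
    if h : x ∈ range e then ((Classical.choose h : Fin n → ℝ) : Sphere n) else ∞
  have hc1 : ∀ v, c (e v) = v := fun v => by
    have h : e v ∈ range e := ⟨v, rfl⟩
    change (if h : e v ∈ range e then ((Classical.choose h : Fin n → ℝ) : Sphere n) else ∞) = v
    rw [dif_pos h, hinj (Classical.choose_spec h)]
  have hc2 : ∀ x, x ∉ range e → c x = ∞ := fun x hx => dif_neg hx
  refine ⟨⟨c, continuous_collapse he hc1 hc2⟩, fun x => ?_, fun x y hx hy h => ?_, fun v => ?_⟩
  · rw [← hrange]
    constructor
    · rintro h ⟨v, rfl⟩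
      exact OnePoint.coe_ne_infty v ((hc1 v).symm.trans h)
    · exact hc2 x
  · obtain ⟨v, rfl⟩ := (hrange x).2 hx
    obtain ⟨w, rfl⟩ := (hrange y).2 hy
    have h' : (v : Sphere n) = w := (hc1 v).symm.trans (h.trans (hc1 w))
    rw [OnePoint.coe_injective h']
  · exact ⟨e v, hin v, hc1 v⟩

/-- The first factor of a point of `Dᵐ⁺ⁿ = Dᵐ × Dⁿ`. -/
def discFst (m n : ℕ) : C(Disc (m + n), Disc m) where
  toFun z := ⟨fun i => z.1 (Fin.castAdd n i), by
    have h := z.2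
    rw [mem_closedBall_zero_iff, pi_norm_le_iff_of_nonneg zero_le_one] at h ⊢
    exact fun i => h _⟩
  continuous_toFun := by
    refine Continuous.subtype_mk ?_ _
    exact continuous_pi fun i => (continuous_apply _).comp continuous_subtype_val

/-- The second factor of a point of `Dᵐ⁺ⁿ = Dᵐ × Dⁿ`. -/
def discSnd (m n : ℕ) : C(Disc (m + n), Disc n) where
  toFun z := ⟨fun i => z.1 (Fin.natAdd m i), by
    have h := z.2
    rw [mem_closedBall_zero_iff, pi_norm_le_iff_of_nonneg zero_le_one] at h ⊢
    exact fun i => h _⟩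
  continuous_toFun := by
    refine Continuous.subtype_mk ?_ _
    exact continuous_pi fun i => (continuous_apply _).comp continuous_subtype_val

theorem disc_norm_lt_one {m n : ℕ} (z : Disc (m + n)) : ‖(z : Fin (m + n) → ℝ)‖ < 1 ↔
    ‖(discFst m n z : Fin m → ℝ)‖ < 1 ∧ ‖(discSnd m n z : Fin n → ℝ)‖ < 1 := by
  rw [pi_norm_lt_iff zero_lt_one, pi_norm_lt_iff zero_lt_one, pi_norm_lt_iff zero_lt_one]
  constructor
  · exact fun h => ⟨fun i => h _, fun i => h _⟩
  · rintro ⟨h, h'⟩ i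
    refine Fin.addCases (fun i => h i) (fun i => h' i) i

theorem disc_ext {m n : ℕ} {z w : Disc (m + n)} (h : discFst m n z = discFst m n w)
    (h' : discSnd m n z = discSnd m n w) : z = w := by
  refine Subtype.ext (funext fun i => ?_)
  refine Fin.addCases (fun i => ?_) (fun i => ?_) i
  · exact congrFun (congrArg Subtype.val h) i
  · exact congrFun (congrArg Subtype.val h') i

theorem exists_disc {m n : ℕ} (x : Disc m) (y : Disc n) :
    ∃ z : Disc (m + n), discFst m n z = x ∧ discSnd m n z = y := by
  refine ⟨⟨Fin.append x.1 y.1, ?_⟩, ?_, ?_⟩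
  · have h := x.2
    have h' := y.2
    rw [mem_closedBall_zero_iff, pi_norm_le_iff_of_nonneg zero_le_one] at h h' ⊢
    intro i
    refine Fin.addCases (fun i => ?_) (fun i => ?_) i
    · rw [Fin.append_left]; exact h i
    · rw [Fin.append_right]; exact h' i
  · exact Subtype.ext (funext fun i => Fin.append_left _ _ i)
  · exact Subtype.ext (funext fun i => Fin.append_right _ _ i)

/-- The based `G`-space `Sⁿ ∧ A`, for `A` in `𝒲_G`. -/
def WG.smashBased [CompactSpace G] [T2Space G] (n : ℕ) (A : WG G) : BasedGSpace G :=
  have := A.isFiniteGCW.1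
  have := compactSpace_of_isFiniteGCW A.isFiniteGCW
  haveI : ContinuousSMul G (Smash n A.toBased) := smash_continuousSMul n A.toBased
  haveI : T2Space (Smash n A.toBased) := smash_t2Space n A.toBased
  haveI : CompactSpace (Smash n A.toBased) :=
    inferInstanceAs (CompactSpace (Quotient (smashSetoid n A.toBased)))
  { carrier := Smash n A.toBased
    pt := Smash.pt n A.toBased
    smul_pt := Smash.smul_pt }

theorem WG.isFiniteGCW_smash [CompactSpace G] [T2Space G] (n : ℕ) (A : WG G) :
    IsFiniteGCW (A.smashBased n) := by
  have := A.isFiniteGCW.1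
  have := compactSpace_of_isFiniteGCW A.isFiniteGCW
  refine ⟨smash_t2Space n A.toBased, ?_⟩
  obtain ⟨-, ⟨S⟩⟩ := A.isFiniteGCW
  obtain ⟨c, hc, hcinj, hcsurj⟩ := exists_discCollapse n
  have hne : ∀ x : Disc n, ‖(x : Fin n → ℝ)‖ < 1 → c x ≠ ∞ := fun x hx h => (hc x).1 h hx
  -- equality of interior points
  have main : ∀ (i j : Fin S.numCells) (a : G ⧸ S.isotropy i) (b : G ⧸ S.isotropy j)
      (z : Disc (n + S.dim i)) (w : Disc (n + S.dim j)), ‖(z : Fin (n + S.dim i) → ℝ)‖ < 1 →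
      Smash.mk (c (discFst n _ z)) (S.char i (a, discSnd n _ z)) =
        Smash.mk (c (discFst n _ w)) (S.char j (b, discSnd n _ w)) →
      c (discFst n _ z) = c (discFst n _ w) ∧
        S.char i (a, discSnd n _ z) = S.char j (b, discSnd n _ w) := by
    intro i j a b z w hz h
    rw [disc_norm_lt_one] at hz
    rcases Smash.mk_eq_mk.1 h with h | ⟨h | h, -⟩
    · exact ⟨congrArg Prod.fst h, congrArg Prod.snd h⟩
    · exact absurd h (hne _ hz.1)
    · exact absurd ⟨_, hz.2, h⟩ (S.pt_notMem i)
  refine ⟨{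
    numCells := S.numCells
    dim := fun i => n + S.dim i
    isotropy := S.isotropy
    isClosed_isotropy := S.isClosed_isotropy
    char := fun i => ⟨fun p => Smash.mk (c (discFst n _ p.2)) (S.char i (p.1, discSnd n _ p.2)),
      Smash.continuous_mk.comp (by fun_prop : Continuous fun p : (G ⧸ S.isotropy i) ×
        Disc (n + S.dim i) => (c (discFst n _ p.2), S.char i (p.1, discSnd n _ p.2)))⟩
    char_smul := fun i g a x => ?_
    injOn := ?_
    disjoint := ?_
    pt_notMem := ?_
    cover := ?_
    boundary := ?_ }⟩
  · change Smash.mk _ (S.char i (g • a, discSnd n _ x)) = Smash.mk _ (g • S.char i (a, _))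
    rw [S.char_smul]
  · rintro i ⟨a, z⟩ hz ⟨b, w⟩ hw h
    change ‖(z : Fin (n + S.dim i) → ℝ)‖ < 1 at hz
    change ‖(w : Fin (n + S.dim i) → ℝ)‖ < 1 at hw
    obtain ⟨h1, h2⟩ := main i i a b z w hz h
    rw [disc_norm_lt_one] at hz hw
    have h3 := S.injOn i (show (a, discSnd n _ z) ∈ _ from hz.2)
      (show (b, discSnd n _ w) ∈ _ from hw.2) h2
    have h4 := hcinj _ _ hz.1 hw.1 h1
    have h5 : a = b := congrArg Prod.fst h3
    have h6 : discSnd n _ z = discSnd n _ w := congrArg Prod.snd h3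
    rw [h5, disc_ext h4 h6]
  · intro i j hij
    rw [Set.disjoint_left]
    rintro _ ⟨⟨a, z⟩, hz, rfl⟩ ⟨⟨b, w⟩, hw, h⟩
    change ‖(z : Fin (n + S.dim i) → ℝ)‖ < 1 at hz
    change ‖(w : Fin (n + S.dim j) → ℝ)‖ < 1 at hw
    obtain ⟨-, h2⟩ := main i j a b z w hz h.symm
    rw [disc_norm_lt_one] at hz hw
    exact Set.disjoint_left.1 (S.disjoint i j hij) ⟨_, hz.2, rfl⟩ ⟨_, hw.2, h2.symm⟩
  · rintro i ⟨⟨a, z⟩, hz, h⟩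
    change ‖(z : Fin (n + S.dim i) → ℝ)‖ < 1 at hz
    rw [disc_norm_lt_one] at hz
    rcases Smash.mk_eq_pt.1 h with h | h
    · exact hne _ hz.1 h
    · exact S.pt_notMem i ⟨_, hz.2, h⟩
  · refine Smash.ind fun s y => ?_
    induction s using OnePoint.rec with
    | infty => exact Or.inl (Smash.mk_infty y)
    | coe v =>
      rcases S.cover y with rfl | ⟨i, ⟨a, x⟩, hx, rfl⟩
      · exact Or.inl (Smash.mk_pt _)
      · obtain ⟨x', hx', hv⟩ := hcsurj v
        obtain ⟨z, h1, h2⟩ := exists_disc x' x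
        refine Or.inr ⟨i, (a, z), ?_, ?_⟩
        · change ‖(z : Fin (n + S.dim i) → ℝ)‖ < 1
          rw [disc_norm_lt_one, h1, h2]
          exact ⟨hx', hx⟩
        · change Smash.mk (c (discFst n _ z)) (S.char i (a, discSnd n _ z)) = _
          rw [h1, h2, hv]
  · rintro i ⟨a, z⟩ hz
    change ‖(z : Fin (n + S.dim i) → ℝ)‖ = 1 at hz
    by_cases h1 : ‖(discFst n _ z : Fin n → ℝ)‖ < 1
    · have h2 : ¬ ‖(discSnd n _ z : Fin (S.dim i) → ℝ)‖ < 1 := fun h2 =>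
        absurd ((disc_norm_lt_one z).2 ⟨h1, h2⟩) (by rw [hz]; exact lt_irrefl _)
      have h3 : ‖(discSnd n _ z : Fin (S.dim i) → ℝ)‖ = 1 :=
        le_antisymm (mem_closedBall_zero_iff.1 (discSnd n _ z).2) (not_lt.1 h2)
      rcases S.boundary i (a, discSnd n _ z) h3 with h | ⟨j, hj, ⟨b, x⟩, hx, h⟩
      · exact Or.inl (Smash.mk_eq_pt.2 (Or.inr h))
      · obtain ⟨w, hw1, hw2⟩ := exists_disc (discFst n _ z) x
        refine Or.inr ⟨j, Nat.add_lt_add_left hj n, (b, w), ?_, ?_⟩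
        · change ‖(w : Fin (n + S.dim j) → ℝ)‖ < 1
          rw [disc_norm_lt_one, hw1, hw2]
          exact ⟨h1, hx⟩
        · change Smash.mk (c (discFst n _ w)) (S.char j (b, discSnd n _ w)) =
            Smash.mk (c (discFst n _ z)) (S.char i (a, discSnd n _ z))
          rw [hw1, hw2, h]
    · exact Or.inl (Smash.mk_eq_pt.2 (Or.inl ((hc _).2 h1)))

/-- `Sⁿ ∧ A` as an object of `𝒲_G`. -/
def WG.smash [CompactSpace G] [T2Space G] (n : ℕ) (A : WG G) : WG G :=
  ⟨A.smashBased n, A.isFiniteGCW_smash n⟩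

/-- The suspension `ΣA = S¹ ∧ A`. -/
abbrev WG.susp [CompactSpace G] [T2Space G] (A : WG G) : WG G := A.smash 1

/-- The product `S¹ × Sⁿ → S¹ ∧ Sⁿ ≅ Sⁿ⁺¹`, given by `ℝ × ℝⁿ ≅ ℝⁿ⁺¹`. -/
def sphereMul {n : ℕ} (t : Sphere 1) (s : Sphere n) : Sphere (n + 1) :=
  t.elim ∞ fun t => s.elim ∞ fun s => ((Fin.cons (t 0) s : Fin (n + 1) → ℝ) : Sphere (n + 1))

theorem sphereMul_infty {n : ℕ} (t : Sphere 1) : sphereMul t (∞ : Sphere n) = ∞ := by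
  induction t using OnePoint.rec <;> rfl

theorem continuous_sphereMul (n : ℕ) :
    Continuous fun p : Sphere 1 × Sphere n => sphereMul p.1 p.2 := by
  let b : (Fin (n + 1) → ℝ) ≃ₜ (Fin 1 → ℝ) × (Fin n → ℝ) :=
    { toFun := fun v => (fun _ => v 0, fun i => v i.succ)
      invFun := fun p => Fin.cons (p.1 0) p.2
      left_inv := fun v => Fin.cons_self_tail v
      right_inv := fun p => by
        refine Prod.ext (funext fun i => ?_) ?_
        · rw [Subsingleton.elim i 0]; rfl
        · rfl
      continuous_toFun := by
        refine (continuous_pi fun _ => continuous_apply 0).prodMk ?_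
        exact continuous_pi fun i => continuous_apply (Fin.succ i)
      continuous_invFun := by
        refine continuous_pi fun i => ?_
        refine Fin.cases ?_ (fun i => ?_) i
        · exact (continuous_apply (0 : Fin 1)).comp continuous_fst
        · exact (continuous_apply i).comp continuous_snd }
  have he : IsOpenEmbedding fun v : Fin (n + 1) → ℝ =>
      (((b v).1 : Sphere 1), ((b v).2 : Sphere n)) :=
    (OnePoint.isOpenEmbedding_coe.prodMap OnePoint.isOpenEmbedding_coe).comp b.isOpenEmbedding
  refine continuous_collapse he (fun v => ?_) ?_
  · exact congrArg _ (b.symm_apply_apply v)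
  · rintro ⟨t, s⟩ h
    induction t using OnePoint.rec with
    | infty => rfl
    | coe t =>
      induction s using OnePoint.rec with
      | infty => rfl
      | coe s =>
        refine absurd ⟨b.symm (t, s), ?_⟩ h
        simp only [Homeomorph.apply_symm_apply]

/-- The canonical map `S¹ ∧ (Sⁿ ∧ A) ≅ Sⁿ⁺¹ ∧ A`. -/
def WG.smashAssoc [CompactSpace G] [T2Space G] (n : ℕ) (A : WG G) :
    BasedGSpace.Hom (A.smash n).susp.toBased (A.smash (n + 1)).toBased :=
  ⟨{ toFun := Smash.lift (Y := (A.smash n).toBased)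
      (fun t => Smash.lift (fun s a => Smash.mk (sphereMul t s) a) (Smash.pt (n + 1) A.toBased)
        (fun a => by rw [sphereMul_infty]; exact Smash.mk_infty a) (fun _ => Smash.mk_pt _))
      (Smash.pt (n + 1) A.toBased)
      (Smash.ind fun _ a => Smash.mk_infty a)
      (fun t => (congrArg (fun s => Smash.mk s A.toBased.pt) (sphereMul_infty t)).trans
        (Smash.mk_pt _))
     continuous_toFun := by
      refine (Smash.isQuotientMap_mk (Y := (A.smash n).toBased)).continuous_iff.2 ?_
      refine Smash.continuous_of_prod (Y := A.toBased) (K := Sphere 1) _ ?_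
      exact Smash.continuous_mk.comp (((continuous_sphereMul n).comp
        (by fun_prop : Continuous fun p : Sphere 1 × (Sphere n × A.toBased) =>
          (p.1, p.2.1))).prodMk (continuous_snd.comp continuous_snd)) },
    Smash.mk_infty _⟩

end Smash

/-! ## Loop spaces and naive prespectra -/

section Loops

variable {G : Type u} [Group G] [TopologicalSpace G]

/-- The loop space `ΩX` of based maps `S¹ → X`, with `G` acting through `X`. -/
def Loops (X : BasedGSpace G) : Type u := {γ : C(Sphere 1, X) // γ ∞ = X.pt}

instance (X : BasedGSpace G) : TopologicalSpace (Loops X) :=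
  inferInstanceAs (TopologicalSpace {γ : C(Sphere 1, X) // γ ∞ = X.pt})

instance (X : BasedGSpace G) : MulAction G (Loops X) where
  smul g γ := ⟨g • γ.1, by
    change g • γ.1 ∞ = X.pt
    rw [γ.2, X.smul_pt]⟩
  one_smul γ := Subtype.ext (one_smul G γ.1)
  mul_smul a b γ := Subtype.ext (mul_smul a b γ.1)

/-- The adjoint `X → ΩY`, `x ↦ (t ↦ m (t ∧ x))`, of a based map `m : S¹ ∧ X → Y`. -/
def adjointMap {X Y : BasedGSpace G} (m : C(Smash 1 X, Y)) (hm : m (Smash.pt 1 X) = Y.pt) :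
    C(X, Loops Y) where
  toFun x := ⟨⟨fun t => m (Smash.mk t x), m.continuous.comp
      (Smash.continuous_mk.comp (by fun_prop : Continuous fun t : Sphere 1 => (t, x)))⟩,
    (congrArg m (Smash.mk_infty x)).trans hm⟩
  continuous_toFun := by
    refine Continuous.subtype_mk ?_ _
    exact (ContinuousMap.curry ⟨fun p : X × Sphere 1 => m (Smash.mk p.2 p.1),
      m.continuous.comp (Smash.continuous_mk.comp continuous_swap)⟩).continuous

/-- A naive `G`-prespectrum: based `G`-spaces `Xₙ` and based `G`-maps `S¹ ∧ Xₙ → Xₙ₊₁`. -/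
structure NaiveGPrespectrum (G : Type u) [Group G] [TopologicalSpace G] where
  space : ℕ → BasedGSpace G
  structureMap : ∀ n, C(Smash 1 (space n), space (n + 1))
  structureMap_pt : ∀ n, structureMap n (Smash.pt 1 (space n)) = (space (n + 1)).pt
  structureMap_smul : ∀ n, IsEquivariant G (structureMap n)

/-- A naive `Ω`-`G`-prespectrum: the adjoints `Xₙ → ΩXₙ₊₁` of the structure maps are
`G`-equivalences. -/
def NaiveGPrespectrum.IsOmega (X : NaiveGPrespectrum G) : Prop :=
  ∀ n, IsGEquivalence G (adjointMap (X.structureMap n) (X.structureMap_pt n))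

end Loops

/-! ## Homotopy pushouts and homotopy pullbacks -/

section Squares

variable {G : Type u} [Group G] [TopologicalSpace G]

/-- A square of based `G`-maps `f : A → B`, `g : A → C`, `h : B → D`, `k : C → D`, together with a
based `G`-homotopy `η` from `h ∘ f` to `k ∘ g`. A strictly commutative square is the case of a
constant homotopy. -/
structure GSquare (A B C D : BasedGSpace G) where
  f : BasedGSpace.Hom A B
  g : BasedGSpace.Hom A C
  h : BasedGSpace.Hom B D
  k : BasedGSpace.Hom C D
  η : C(I × A, D)
  f_smul : IsEquivariant G f.1
  g_smul : IsEquivariant G g.1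
  h_smul : IsEquivariant G h.1
  k_smul : IsEquivariant G k.1
  η_smul : ∀ t, IsEquivariant G fun a => η (t, a)
  η_pt : ∀ t, η (t, A.pt) = D.pt
  η_zero : ∀ a, η (0, a) = h.1 (f.1 a)
  η_one : ∀ a, η (1, a) = k.1 (g.1 a)

namespace GSquare

variable {A B C D : BasedGSpace G} (s : GSquare A B C D)

/-- The identifications in `B ⊔ (I × A) ⊔ C` that define the reduced double mapping cylinder. -/
inductive CylinderRel : B ⊕ (I × A) ⊕ C → B ⊕ (I × A) ⊕ C → Prop
  | left (a : A) : CylinderRel (.inr (.inl (0, a))) (.inl (s.f.1 a))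
  | right (a : A) : CylinderRel (.inr (.inl (1, a))) (.inr (.inr (s.g.1 a)))
  | base (t : I) : CylinderRel (.inr (.inl (t, A.pt))) (.inl B.pt)

/-- The reduced double mapping cylinder of `B ← A → C`. -/
def Cylinder : Type u := Quot s.CylinderRel

instance : TopologicalSpace s.Cylinder :=
  inferInstanceAs (TopologicalSpace (Quot s.CylinderRel))

/-- The base point of the double mapping cylinder. -/
def cylinderPt : s.Cylinder := Quot.mk _ (.inl B.pt)

instance : SMul G s.Cylinder where
  smul a := Quot.map (Sum.map (a • ·) (Sum.map (Prod.map id (a • ·)) (a • ·))) (by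
    rintro _ _ (x | x | t)
    · change s.CylinderRel (.inr (.inl (0, a • x))) (.inl (a • s.f.1 x))
      rw [← s.f_smul]
      exact .left _
    · change s.CylinderRel (.inr (.inl (1, a • x))) (.inr (.inr (a • s.g.1 x)))
      rw [← s.g_smul]
      exact .right _
    · change s.CylinderRel (.inr (.inl (t, a • A.pt))) (.inl (a • B.pt))
      rw [A.smul_pt, B.smul_pt]
      exact .base t)

/-- The canonical map from the double mapping cylinder to the terminal corner of the square. -/
def cylinderMap : C(s.Cylinder, D) where
  toFun := Quot.lift (Sum.elim s.h.1 (Sum.elim s.η s.k.1)) (by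
    rintro _ _ (x | x | t)
    · exact s.η_zero x
    · exact s.η_one x
    · exact (s.η_pt t).trans s.h.2.symm)
  continuous_toFun := continuous_quot_lift _ (by fun_prop)

/-- A `G`-homotopy pushout square: the double mapping cylinder of `B ← A → C` is mapped to `D` by a
based `G`-homotopy equivalence. -/
def IsHomotopyPushout : Prop :=
  IsBasedGHomotopyEquiv G s.cylinderPt D.pt s.cylinderMap

/-- The homotopy pullback of `B → D ← C`: triples of a point of `B`, a path in `D` and a point of
`C`. -/
def HomotopyPullback : Type u :=
  {p : B × C(I, D) × C // p.2.1 0 = s.h.1 p.1 ∧ p.2.1 1 = s.k.1 p.2.2}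

instance : TopologicalSpace s.HomotopyPullback :=
  inferInstanceAs (TopologicalSpace
    {p : B × C(I, D) × C // p.2.1 0 = s.h.1 p.1 ∧ p.2.1 1 = s.k.1 p.2.2})

instance : MulAction G s.HomotopyPullback where
  smul a p := ⟨a • p.1, by
    constructor
    · change a • p.1.2.1 0 = s.h.1 (a • p.1.1)
      rw [p.2.1, s.h_smul]
    · change a • p.1.2.1 1 = s.k.1 (a • p.1.2.2)
      rw [p.2.2, s.k_smul]⟩
  one_smul p := Subtype.ext (one_smul G p.1)
  mul_smul a b p := Subtype.ext (mul_smul a b p.1)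

/-- The canonical map from the initial corner of the square to the homotopy pullback. -/
def pullbackMap : C(A, s.HomotopyPullback) where
  toFun a := ⟨(s.f.1 a, ⟨fun t => s.η (t, a), by fun_prop⟩, s.g.1 a), s.η_zero a, s.η_one a⟩
  continuous_toFun := by
    refine Continuous.subtype_mk (s.f.1.continuous.prodMk (Continuous.prodMk ?_
      s.g.1.continuous)) _
    exact (ContinuousMap.curry ⟨fun p : A × I => s.η (p.2, p.1), by fun_prop⟩).continuous

/-- A `G`-homotopy pullback square: `A` is mapped to the homotopy pullback of `B → D ← C` by a
`G`-equivalence. -/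
def IsHomotopyPullback : Prop := IsGEquivalence G s.pullbackMap

end GSquare

end Squares

/-! ## `𝒲_G`-spaces -/

/-- A `𝒲_G`-space: a based continuous functor from `𝒲_G` to based `G`-spaces. It is defined on all
based maps, and the maps of spaces of based maps are continuous and equivariant for the conjugation
actions. (Continuity for the compact-open topologies is the same as continuity for their
compactly generated refinements, as all spaces are compactly generated.) -/
structure WGSpace (G : Type u) [Group G] [TopologicalSpace G] where
  obj : WG G → BasedGSpace G
  map : ∀ {A B : WG G}, BasedGSpace.Hom A.toBased B.toBased → BasedGSpace.Hom (obj A) (obj B)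
  map_id : ∀ A : WG G, map (BasedGSpace.Hom.id A.toBased) = BasedGSpace.Hom.id (obj A)
  map_comp : ∀ {A B C : WG G} (f : BasedGSpace.Hom B.toBased C.toBased)
    (e : BasedGSpace.Hom A.toBased B.toBased), map (f.comp e) = (map f).comp (map e)
  map_conj : ∀ {A B : WG G} (g : G) (f : BasedGSpace.Hom A.toBased B.toBased),
    map (f.conj g) = (map f).conj g
  continuous_map : ∀ A B : WG G, Continuous (map (A := A) (B := B))
  subsingleton_point : Subsingleton (obj (WG.point G))

namespace WGSpace

variable {G : Type u} [Group G] [TopologicalSpace G] (Z : WGSpace G)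

theorem map_equivariant {A B : WG G} (f : BasedGSpace.Hom A.toBased B.toBased)
    (hf : IsEquivariant G f.1) : IsEquivariant G (Z.map f).1 := by
  intro g x
  have h : f.conj g = f := by
    refine Subtype.ext (ContinuousMap.ext fun a => ?_)
    change g • f.1 (g⁻¹ • a) = f.1 a
    rw [hf, smul_inv_smul]
  have h2 : (Z.map f).1 (g • x) = g • (Z.map f).1 (g⁻¹ • g • x) := by
    conv_lhs => rw [← h, Z.map_conj]
    rfl
  rw [h2, inv_smul_smul]

theorem map_zero (A B : WG G) (z : Z.obj A) :
    (Z.map (BasedGSpace.Hom.zero A.toBased B.toBased)).1 z = (Z.obj B).pt := by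
  have h : BasedGSpace.Hom.zero A.toBased B.toBased =
      (BasedGSpace.Hom.zero (WG.point G).toBased B.toBased).comp
        (BasedGSpace.Hom.zero A.toBased (WG.point G).toBased) := rfl
  rw [h, Z.map_comp]
  change (Z.map _).1 ((Z.map _).1 z) = _
  have := Z.subsingleton_point
  rw [Subsingleton.elim ((Z.map (BasedGSpace.Hom.zero A.toBased (WG.point G).toBased)).1 z)
    (Z.obj (WG.point G)).pt]
  exact (Z.map _).2

/-- A family of based maps parametrized by a compact Hausdorff space is taken to a continuous
family. -/
theorem continuous_family {K : Type*} [TopologicalSpace K] [CompactSpace K] [T2Space K]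
    {A B : WG G} (β : K → BasedGSpace.Hom A.toBased B.toBased) (hβ : Continuous β) :
    Continuous fun p : K × Z.obj A => (Z.map (β p.1)).1 p.2 := by
  have h1 : Continuous fun k => (Z.map (β k)).1 :=
    continuous_subtype_val.comp ((Z.continuous_map A B).comp hβ)
  have h2 : ∀ z : Z.obj A, Continuous fun k => (Z.map (β k)).1 z := fun z =>
    (continuous_eval_const z).comp h1
  have h3 : Continuous fun z : Z.obj A => (⟨fun k => (Z.map (β k)).1 z, h2 z⟩ : C(K, Z.obj B)) := by
    refine continuous_from_compactlyGeneratedSpace _ fun T _ _ _ e he => ?_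
    have h4 : Continuous fun k => (Z.map (β k)).1.comp ⟨e, he⟩ :=
      (ContinuousMap.continuous_precomp ⟨e, he⟩).comp h1
    have h5 := ContinuousMap.continuous_uncurry_of_continuous ⟨_, h4⟩
    exact (ContinuousMap.curry ⟨_, h5.comp continuous_swap⟩).continuous
  exact (ContinuousMap.continuous_uncurry_of_continuous ⟨_, h3⟩).comp continuous_swap

/-- The square obtained by applying `Z` to the maps and to the homotopy of a square in `𝒲_G`. -/
def mapSquare {A B C D : WG G} (s : GSquare A.toBased B.toBased C.toBased D.toBased) :
    GSquare (Z.obj A) (Z.obj B) (Z.obj C) (Z.obj D) :=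
  let β : I → BasedGSpace.Hom A.toBased D.toBased := fun t =>
    ⟨⟨fun a => s.η (t, a), by fun_prop⟩, s.η_pt t⟩
  have hβ : Continuous β := s.η.curry.continuous.subtype_mk _
  { f := Z.map s.f
    g := Z.map s.g
    h := Z.map s.h
    k := Z.map s.k
    η := ⟨fun p => (Z.map (β p.1)).1 p.2, Z.continuous_family β hβ⟩
    f_smul := Z.map_equivariant _ s.f_smul
    g_smul := Z.map_equivariant _ s.g_smul
    h_smul := Z.map_equivariant _ s.h_smul
    k_smul := Z.map_equivariant _ s.k_smul
    η_smul := fun t => Z.map_equivariant (β t) (s.η_smul t)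
    η_pt := fun t => (Z.map (β t)).2
    η_zero := fun a => by
      have h : β 0 = s.h.comp s.f := Subtype.ext (ContinuousMap.ext s.η_zero)
      change (Z.map (β 0)).1 a = _
      rw [h, Z.map_comp]
      rfl
    η_one := fun a => by
      have h : β 1 = s.k.comp s.g := Subtype.ext (ContinuousMap.ext s.η_one)
      change (Z.map (β 1)).1 a = _
      rw [h, Z.map_comp]
      rfl }

/-- `Z` takes `G`-homotopy pushout squares to `G`-homotopy pullback squares. -/
def TakesPushoutsToPullbacks : Prop :=
  ∀ (A B C D : WG G) (s : GSquare A.toBased B.toBased C.toBased D.toBased),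
    s.IsHomotopyPushout → (Z.mapSquare s).IsHomotopyPullback

variable [CompactSpace G] [T2Space G]

/-- The based map `A → ΣA`, `a ↦ t ∧ a`. -/
def suspInclusion (A : WG G) (t : Sphere 1) : BasedGSpace.Hom A.toBased A.susp.toBased :=
  ⟨⟨fun a => Smash.mk t a, Smash.continuous_mk.comp
    (by fun_prop : Continuous fun a : A.toBased => (t, a))⟩, Smash.mk_pt t⟩

theorem continuous_suspInclusion (A : WG G) : Continuous (suspInclusion A) :=
  (ContinuousMap.curry ⟨_, Smash.continuous_mk (n := 1) (Y := A.toBased)⟩).continuous.subtype_mk _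

/-- The structure map `S¹ ∧ Z(A) → Z(ΣA)`, `t ∧ z ↦ Z(a ↦ t ∧ a)(z)`. -/
def structureMap (A : WG G) : C(Smash 1 (Z.obj A), Z.obj A.susp) where
  toFun := Smash.lift (fun t z => (Z.map (suspInclusion A t)).1 z) (Z.obj A.susp).pt
    (fun z => by
      have h : suspInclusion A ∞ = BasedGSpace.Hom.zero A.toBased A.susp.toBased :=
        Subtype.ext (ContinuousMap.ext fun a => Smash.mk_infty a)
      rw [h, Z.map_zero])
    (fun t => (Z.map (suspInclusion A t)).2)
  continuous_toFun := Smash.isQuotientMap_mk.continuous_iff.2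
    (Z.continuous_family (suspInclusion A) (continuous_suspInclusion A))

theorem structureMap_pt (A : WG G) :
    Z.structureMap A (Smash.pt 1 (Z.obj A)) = (Z.obj A.susp).pt :=
  (Z.map (suspInclusion A ∞)).2

theorem structureMap_smul (A : WG G) : IsEquivariant G (Z.structureMap A) := fun g =>
  Smash.ind fun t z => Z.map_equivariant (suspInclusion A t) (fun _ _ => rfl) g z

/-- The naive `G`-prespectrum `Z[A]`, with spaces `Z(Sⁿ ∧ A)` and structure maps
`S¹ ∧ Z(Sⁿ ∧ A) → Z(S¹ ∧ (Sⁿ ∧ A)) ≅ Z(Sⁿ⁺¹ ∧ A)`. -/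
def prespectrum (A : WG G) : NaiveGPrespectrum G where
  space n := Z.obj (A.smash n)
  structureMap n := (Z.map (A.smashAssoc n)).1.comp (Z.structureMap (A.smash n))
  structureMap_pt n := by
    rw [ContinuousMap.comp_apply, Z.structureMap_pt]
    exact (Z.map (A.smashAssoc n)).2
  structureMap_smul n g x := by
    rw [ContinuousMap.comp_apply, ContinuousMap.comp_apply, Z.structureMap_smul]
    refine Z.map_equivariant (A.smashAssoc n) (fun g => ?_) g _
    exact Smash.ind (Y := (A.smash n).toBased) fun t => Smash.ind (Y := A.toBased) fun s a => rfl

end WGSpace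

/-!
# Linearity of `𝒲_G`-spaces

A based `G`-map between finite `G`-CW-complexes acts on `H`-fixed points `Z(A)^H`, and all three
conditions are conditions on these spaces for the closed subgroups `H`. The second and third
conditions agree, since `S¹ ∧ (Sⁿ ∧ A) → Sⁿ⁺¹ ∧ A` and `A → S⁰ ∧ A` are isomorphisms
(`WGSpace.forall_isOmega_iff`). The first condition implies the third, since `ΣA` is the homotopy
pushout of `* ← A → *` and the homotopy pullback of `* → Z(ΣA) ← *` is the loop space
(`WGSpace.suspSquare`).

For the converse, consider a homotopy pushout square with corners `A`, `B`, `C`, `D`, and let `P` be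
the homotopy pullback of `Z(B)^H → Z(D)^H ← Z(C)^H`. Write `M` for the double mapping cylinder and
`e : D → M` for a homotopy inverse of `M → D`. A point `(b, γ, c)` of `P` gives a path from `b` along
the path `e ∘ γ` to `c`, formally in `Z(M)` (`WGSpace.cylinderPath`). Collapsing `B` and `C` in `M`
turns it into a loop of `Z(ΣA)^H`, which defines `P → ΩZ(ΣA)^H` (`WGSpace.toLoops`). The suspended
square defines a map from `ΩZ(ΣA)^H` to the homotopy pullback `P'` of the loop spaces of its other
corners (`WGSpace.fromLoops`). In

  `Z(A)^H → P → ΩZ(ΣA)^H → P'`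

the composite of the first two maps is homotopic to the adjoint structure map of `A`
(`WGSpace.homotopic_toLoops_comp`), and the composite of the last two is homotopic to the map
`P → P'` of adjoint structure maps of `B`, `D` and `C`, up to a weak self-equivalence of `P`
(`WGSpace.homotopic_fromLoops_comp`). The third condition makes both composites weak equivalences,
and then all three maps are weak equivalences because these satisfy the two-out-of-six property.

The second homotopy can be seen in the unit square. A segment in the square, from the left or lower
edge to the right or upper edge, defines a map `M → ΣD` (`WGSpace.sweep`): the coordinate along
the segment is the cylinder coordinate of `M`, and the two coordinates of a point of the square are
the suspension coordinate of `ΣD` and the time of the homotopy of the given square. Horizontal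
segments give the map through `ΣA`, and vertical ones the inclusions `D → ΣD`.

Neither `M` nor the homotopy pullbacks are required to be CW-complexes, so weak equivalences are
handled by lifting cubes relative to their boundary in mapping path spaces (`CubeLifting`). This
gives the two-out-of-six property and the homotopy invariance of homotopy pullbacks
(`HomotopyPullbackSpace.isWeakHomotopyEquiv_map`).
-/


/-! ### Extending homotopies from the boundary of a cube -/

theorem Cube.isClosed_boundary (n : ℕ) : IsClosed (Cube.boundary (Fin n)) := by
  have : Cube.boundary (Fin n) = ⋃ i, {y : Fin n → I | y i = 0 ∨ y i = 1} := by
    ext y; simp [Cube.boundary]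
  rw [this]
  refine isClosed_iUnion_of_finite fun i => ?_
  exact (isClosed_eq (continuous_apply i) continuous_const).union
    (isClosed_eq (continuous_apply i) continuous_const)

/-- `A ⊆ K` has the homotopy extension property in its universal form: `K × I` retracts onto
`K × {0} ∪ A × I`. -/
def HasCylinderRetraction {K : Type*} [TopologicalSpace K] (A : Set K) : Prop :=
  ∃ ρ : C(K × I, K × I), (∀ p, (ρ p).2 = 0 ∨ (ρ p).1 ∈ A) ∧ ∀ p, p.2 = 0 ∨ p.1 ∈ A → ρ p = p

/-- The retraction is the radial projection from the point of height `2` over the centre of the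
cube. -/
theorem Cube.hasCylinderRetraction_boundary (n : ℕ) :
    HasCylinderRetraction (Cube.boundary (Fin n)) := by
  let z : (Fin n → I) → Fin n → ℝ := fun y i => 2 * (y i : ℝ) - 1
  have hz : Continuous z := by fun_prop
  let d : (Fin n → I) × I → ℝ := fun p => max ‖z p.1‖ (1 / (1 + (p.2 : ℝ)))
  have hpos : ∀ p : (Fin n → I) × I, 0 < 1 + (p.2 : ℝ) := fun p => by
    have := p.2.2.1; linarith
  have hd0 : ∀ p, 0 < d p := fun p => lt_max_of_lt_right (one_div_pos.2 (hpos p))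
  have hd : Continuous d := by
    refine (hz.comp continuous_fst).norm.max (Continuous.div (by fun_prop) (by fun_prop) ?_)
    exact fun p => (hpos p).ne'
  have hz1 : ∀ y, ‖z y‖ ≤ 1 := fun y => by
    rw [pi_norm_le_iff_of_nonneg zero_le_one]
    intro i
    have h1 := (y i).2.1
    have h2 := (y i).2.2
    rw [Real.norm_eq_abs, abs_le]
    constructor <;> simp only [z] <;> linarith
  let ρ : (Fin n → I) × I → (Fin n → I) × I := fun p =>
    (fun i => projIcc (0 : ℝ) 1 zero_le_one ((z p.1 i / d p + 1) / 2),
      projIcc (0 : ℝ) 1 zero_le_one (‖z p.1‖ * (1 + (p.2 : ℝ)) - 1))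
  have hρ : Continuous ρ := by
    refine Continuous.prodMk (continuous_pi fun i => continuous_projIcc.comp ?_)
      (continuous_projIcc.comp (by fun_prop))
    have h1 : Continuous fun p : (Fin n → I) × I => z p.1 i := by fun_prop
    exact ((h1.div hd fun p => (hd0 p).ne').add continuous_const).div_const 2
  have hfix : ∀ p : (Fin n → I) × I, d p = 1 →
      projIcc (0 : ℝ) 1 zero_le_one (‖z p.1‖ * (1 + (p.2 : ℝ)) - 1) = p.2 → ρ p = p := by
    intro p h1 h2
    refine Prod.ext (funext fun i => ?_) h2
    change projIcc (0 : ℝ) 1 zero_le_one ((z p.1 i / d p + 1) / 2) = p.1 i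
    have : (z p.1 i / d p + 1) / 2 = (p.1 i : ℝ) := by rw [h1]; simp only [z]; ring
    rw [this, projIcc_val]
  refine ⟨⟨ρ, hρ⟩, fun p => ?_, fun p hp => ?_⟩
  · rcases le_or_gt (‖z p.1‖ * (1 + (p.2 : ℝ))) 1 with h | h
    · exact Or.inl (projIcc_of_le_left zero_le_one (by linarith))
    · refine Or.inr ?_
      have h1 : 1 / (1 + (p.2 : ℝ)) < ‖z p.1‖ := by rwa [div_lt_iff₀ (hpos p)]
      have h2 : d p = ‖z p.1‖ := max_eq_left h1.le
      have h0 : 0 < ‖z p.1‖ := (one_div_pos.2 (hpos p)).trans h1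
      obtain ⟨i, hi⟩ : ∃ i, ‖z p.1‖ ≤ ‖z p.1 i‖ := by
        by_contra! hc
        exact lt_irrefl _ ((pi_norm_lt_iff h0).2 hc)
      have hi' := le_antisymm hi (norm_le_pi_norm (z p.1) i)
      refine ⟨i, ?_⟩
      change projIcc (0 : ℝ) 1 zero_le_one ((z p.1 i / d p + 1) / 2) = 0 ∨
        projIcc (0 : ℝ) 1 zero_le_one ((z p.1 i / d p + 1) / 2) = 1
      rw [h2, hi']
      rcases abs_choice (z p.1 i) with h3 | h3 <;> rw [Real.norm_eq_abs] at hi' ⊢ <;> rw [h3]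
      · refine Or.inr (projIcc_of_right_le _ ?_)
        rw [div_self]; · norm_num
        intro h4; rw [h4] at hi'; simp at hi'; simp [hi'] at h0
      · refine Or.inl (projIcc_of_le_left _ ?_)
        rw [div_neg, div_self]; · norm_num
        intro h4; rw [h4] at hi'; simp at hi'; simp [hi'] at h0
  · rcases hp with h | ⟨i, hi⟩
    · refine hfix p ?_ ?_
      · simp only [d, h]; simpa using hz1 p.1
      · rw [h]; exact projIcc_of_le_left _ (by simpa using hz1 p.1)
    · have h1 : ‖z p.1‖ = 1 := by
        refine le_antisymm (hz1 _) ?_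
        refine le_trans ?_ (norm_le_pi_norm _ i)
        rcases hi with hi | hi <;> simp [z, hi]; norm_num
      refine hfix p ?_ ?_
      · simp only [d, h1]
        refine max_eq_left ((div_le_one (hpos p)).2 ?_)
        have := p.2.2.1; linarith
      · rw [h1, one_mul, add_sub_cancel_left, projIcc_val]

/-- The boundary of the prism `Iⁿ × I`. -/
def prismBoundary (n : ℕ) : Set ((Fin n → I) × I) :=
  {p | p.1 ∈ Cube.boundary (Fin n) ∨ p.2 = 0 ∨ p.2 = 1}

/-- The identification of `Iⁿ⁺¹` with the prism `Iⁿ × I`; the height is the first coordinate. -/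
def cubeHomeoPrism (n : ℕ) : (Fin (n + 1) → I) ≃ₜ (Fin n → I) × I where
  toFun y := (fun i => y i.succ, y 0)
  invFun p := Fin.cons p.2 p.1
  left_inv y := Fin.cons_self_tail y
  right_inv _ := rfl
  continuous_toFun := by fun_prop
  continuous_invFun := by
    refine continuous_pi fun i => ?_
    refine Fin.cases ?_ (fun i => ?_) i
    · exact continuous_snd
    · exact (continuous_apply i).comp continuous_fst

theorem cubeHomeoPrism_mem {n : ℕ} (y : Fin (n + 1) → I) :
    cubeHomeoPrism n y ∈ prismBoundary n ↔ y ∈ Cube.boundary (Fin (n + 1)) := by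
  constructor
  · rintro (⟨i, hi⟩ | h)
    · exact ⟨i.succ, hi⟩
    · exact ⟨0, h⟩
  · rintro ⟨i, hi⟩
    revert hi
    refine Fin.cases (fun h => ?_) (fun i h => ?_) i
    · exact Or.inr h
    · exact Or.inl ⟨i, h⟩

theorem cubeHomeoPrism_symm_mem {n : ℕ} (p : (Fin n → I) × I) :
    (cubeHomeoPrism n).symm p ∈ Cube.boundary (Fin (n + 1)) ↔ p ∈ prismBoundary n := by
  rw [← cubeHomeoPrism_mem, Homeomorph.apply_symm_apply]

theorem isClosed_prismBoundary (n : ℕ) : IsClosed (prismBoundary n) :=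
  ((Cube.isClosed_boundary n).preimage continuous_fst).union
    ((isClosed_eq continuous_snd continuous_const).union
      (isClosed_eq continuous_snd continuous_const))

theorem hasCylinderRetraction_prismBoundary (n : ℕ) :
    HasCylinderRetraction (prismBoundary n) := by
  obtain ⟨ρ, h1, h2⟩ := Cube.hasCylinderRetraction_boundary (n + 1)
  let h := cubeHomeoPrism n
  refine ⟨⟨fun p => (h (ρ (h.symm p.1, p.2)).1, (ρ (h.symm p.1, p.2)).2), by fun_prop⟩,
    fun p => ?_, fun p hp => ?_⟩
  · exact (h1 (h.symm p.1, p.2)).imp id (cubeHomeoPrism_mem _).2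
  · have := h2 (h.symm p.1, p.2) (hp.imp id (cubeHomeoPrism_symm_mem _).2)
    change (h (ρ (h.symm p.1, p.2)).1, (ρ (h.symm p.1, p.2)).2) = p
    rw [this]
    simp

/-- The homotopy extension property: a map on `K × {0}` and a homotopy on `A × I` extend to
`K × I`. -/
theorem HasCylinderRetraction.exists_extension {K X : Type*} [TopologicalSpace K]
    [TopologicalSpace X] {A : Set K} (hA : HasCylinderRetraction A) (hc : IsClosed A)
    (u : C(K, X)) (c : K × I → X) (h : ContinuousOn c (A ×ˢ univ))
    (hu : ∀ y ∈ A, c (y, 0) = u y) :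
    ∃ Φ : C(K × I, X), (∀ y, Φ (y, 0) = u y) ∧ ∀ y ∈ A, ∀ t, Φ (y, t) = c (y, t) := by
  classical
  obtain ⟨ρ, h1, h2⟩ := hA
  let φ : K × I → X := fun p => if p.2 = 0 then u p.1 else c p
  have e1 : ∀ p : K × I, p.2 = 0 → φ p = u p.1 := fun p hp => if_pos hp
  have e2 : ∀ p ∈ A ×ˢ (univ : Set I), φ p = c p := by
    rintro ⟨y, t⟩ ⟨hy, -⟩
    by_cases ht : t = 0
    · subst ht; exact (if_pos rfl).trans (hu y hy).symm
    · exact if_neg ht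
  have hφ : ContinuousOn φ ({p : K × I | p.2 = 0} ∪ A ×ˢ univ) := by
    refine ContinuousOn.union_of_isClosed ?_ (h.congr e2)
      (isClosed_eq continuous_snd continuous_const) (hc.prod isClosed_univ)
    exact (u.continuous.comp continuous_fst).continuousOn.congr e1
  refine ⟨⟨fun p => φ (ρ p), hφ.comp_continuous ρ.continuous fun p => ?_⟩, fun y => ?_,
    fun y hy t => ?_⟩
  · exact (h1 p).imp id fun hp => ⟨hp, mem_univ _⟩
  · change φ (ρ (y, 0)) = _
    rw [h2 _ (Or.inl rfl)]
    exact e1 _ rfl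
  · change φ (ρ (y, t)) = _
    rw [h2 _ (Or.inr hy)]
    exact e2 _ ⟨hy, mem_univ _⟩

/-- Whether a map on `A` extends to `K` depends only on its homotopy class. -/
theorem HasCylinderRetraction.exists_extension_of_homotopy {K X : Type*} [TopologicalSpace K]
    [TopologicalSpace X] {A : Set K} (hA : HasCylinderRetraction A) (hc : IsClosed A)
    (u : C(K, X)) (c : K × I → X) (h : ContinuousOn c (A ×ˢ univ))
    (hu : ∀ y ∈ A, c (y, 0) = u y) : ∃ v : C(K, X), ∀ y ∈ A, v y = c (y, 1) := by
  obtain ⟨Φ, -, h2⟩ := hA.exists_extension hc u c h hu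
  exact ⟨⟨fun y => Φ (y, 1), by fun_prop⟩, fun y hy => h2 y hy 1⟩

/-! ### The path fibration of a map -/

section MappingPathSpace

variable {X Y : Type*} [TopologicalSpace X] [TopologicalSpace Y]

/-- The mapping path space of `f : X → Y`: pairs of a point `x` and a path in `Y` from `f x`. -/
def MappingPathSpace (f : C(X, Y)) : Type _ := {p : X × C(I, Y) // p.2 0 = f p.1}

instance (f : C(X, Y)) : TopologicalSpace (MappingPathSpace f) :=
  inferInstanceAs (TopologicalSpace {p : X × C(I, Y) // p.2 0 = f p.1})

namespace MappingPathSpace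

variable (f : C(X, Y))

/-- The projection to the source of `f`. -/
def source : C(MappingPathSpace f, X) := ⟨fun p => p.1.1, by unfold MappingPathSpace; fun_prop⟩

/-- The path component of a point. -/
def path : C(MappingPathSpace f, C(I, Y)) :=
  ⟨fun p => p.1.2, by unfold MappingPathSpace; fun_prop⟩

/-- The endpoint projection to the target of `f`. -/
def target : C(MappingPathSpace f, Y) :=
  ⟨fun p => path f p 1, (continuous_eval_const 1).comp (path f).continuous⟩

/-- The inclusion of `X` by constant paths. -/
def ofSource : C(X, MappingPathSpace f) :=
  ⟨fun x => ⟨(x, ContinuousMap.const I (f x)), rfl⟩,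
    Continuous.subtype_mk (continuous_id.prodMk (ContinuousMap.continuous_const'.comp
      f.continuous)) _⟩

variable {f}

theorem path_zero (p : MappingPathSpace f) : path f p 0 = f (source f p) := p.2

theorem ext {p q : MappingPathSpace f} (h1 : source f p = source f q)
    (h2 : ∀ s, path f p s = path f q s) : p = q :=
  Subtype.ext (Prod.ext h1 (ContinuousMap.ext h2))

theorem continuous_path_apply : Continuous fun p : MappingPathSpace f × I => path f p.1 p.2 :=
  ((path f).continuous.comp continuous_fst).eval continuous_snd

theorem continuous_path_eval {K : Type*} [TopologicalSpace K] {z : K → MappingPathSpace f}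
    {s : K → I} (hz : Continuous z) (hs : Continuous s) :
    Continuous fun k => path f (z k) (s k) :=
  continuous_path_apply.comp (hz.prodMk hs)

/-- The homotopy lifting property of the endpoint projection: the paths are prolonged along the
homotopy. -/
theorem exists_lift {K : Type*} [TopologicalSpace K] (ℓ : C(K, MappingPathSpace f))
    (H : C(K × I, Y)) (h : ∀ k, H (k, 0) = target f (ℓ k)) :
    ∃ Λ : C(K × I, MappingPathSpace f), (∀ k, Λ (k, 0) = ℓ k) ∧ ∀ p, target f (Λ p) = H p := by
  let pr : ℝ → I := projIcc 0 1 zero_le_one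
  have hpr : Continuous pr := continuous_projIcc
  let w : (K × I) × I → Y := fun p =>
    if (p.2 : ℝ) * (1 + (p.1.2 : ℝ)) ≤ 1 then path f (ℓ p.1.1) (pr (p.2 * (1 + (p.1.2 : ℝ))))
    else H (p.1.1, pr (p.2 * (1 + (p.1.2 : ℝ)) - 1))
  have hw : Continuous w := by
    refine Continuous.if_le ?_ ?_ (by fun_prop) continuous_const ?_
    · exact continuous_path_apply.comp ((by fun_prop : Continuous fun p : (K × I) × I =>
        (ℓ p.1.1, pr (p.2 * (1 + (p.1.2 : ℝ))))))
    · fun_prop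
    · intro p hp
      rw [hp]
      have h1 : pr 1 = 1 := projIcc_right _
      have h2 : pr (1 - 1) = 0 := by rw [sub_self]; exact projIcc_left _
      rw [h1, h2, h]
      rfl
  have hw0 : ∀ p, w (p, 0) = f (source f (ℓ p.1)) := by
    intro p
    have : pr 0 = 0 := projIcc_left _
    simp [w, this, path_zero]
  refine ⟨⟨fun p => ⟨(source f (ℓ p.1), (ContinuousMap.curry ⟨w, hw⟩) p), hw0 p⟩, ?_⟩, ?_, ?_⟩
  · exact Continuous.subtype_mk (Continuous.prodMk (by fun_prop) (ContinuousMap.continuous _)) _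
  · intro k
    refine ext rfl fun s => ?_
    change w ((k, 0), s) = _
    have h1 : (s : ℝ) ≤ 1 := s.2.2
    have h2 : pr (s : ℝ) = s := projIcc_val _ s
    simp [w, h1, h2]
  · rintro ⟨k, t⟩
    change w ((k, t), 1) = H (k, t)
    have h0 : (0 : ℝ) ≤ t := t.2.1
    have h2 : pr (t : ℝ) = t := projIcc_val _ t
    by_cases h1 : (t : ℝ) ≤ 0
    · have h3 : t = 0 := Subtype.ext (le_antisymm h1 h0)
      have h4 : pr 1 = 1 := projIcc_right _
      subst h3
      rw [h]
      simp [w, h4]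
      rfl
    · simp [w, h1, h2]

/-- The point at time `t` of the path with unit speed from `a` to `b`. -/
noncomputable def slide (a b t : I) : I :=
  projIcc (0 : ℝ) 1 zero_le_one ((a : ℝ) + max (-(t : ℝ)) (min (t : ℝ) ((b : ℝ) - a)))

theorem continuous_slide {K : Type*} [TopologicalSpace K] {a b t : K → I} (ha : Continuous a)
    (hb : Continuous b) (ht : Continuous t) : Continuous fun k => slide (a k) (b k) (t k) :=
  continuous_projIcc.comp (by fun_prop)

theorem slide_zero (a b : I) : slide a b 0 = a := by
  have : (a : ℝ) + max (-((0 : I) : ℝ)) (min ((0 : I) : ℝ) ((b : ℝ) - a)) = a := by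
    simp
  rw [slide, this, projIcc_val]

theorem slide_of_le {a b t : I} (h : |(b : ℝ) - a| ≤ t) : slide a b t = b := by
  have : (a : ℝ) + max (-(t : ℝ)) (min (t : ℝ) ((b : ℝ) - a)) = b := by
    rw [min_eq_right (abs_le.1 h).2, max_eq_right (abs_le.1 h).1]
    ring
  rw [slide, this, projIcc_val]

/-- The homotopy lifting property relative to the boundary of a cube. A point is joined to its
image under the retraction of the prism to the part where the lift is given by a path that takes
as long as the two points are distant, so that on that part the lifted homotopy is not moved. -/
theorem exists_lift_rel {n : ℕ} (u : C(Fin n → I, MappingPathSpace f))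
    (c : (Fin n → I) × I → MappingPathSpace f)
    (hc : ContinuousOn c (Cube.boundary (Fin n) ×ˢ univ)) (ψ : C((Fin n → I) × I, Y))
    (hu : ∀ y ∈ Cube.boundary (Fin n), c (y, 0) = u y) (hψ0 : ∀ y, target f (u y) = ψ (y, 0))
    (hψ : ∀ y ∈ Cube.boundary (Fin n), ∀ t, target f (c (y, t)) = ψ (y, t)) :
    ∃ Φ : C((Fin n → I) × I, MappingPathSpace f), (∀ y, Φ (y, 0) = u y) ∧
      (∀ y ∈ Cube.boundary (Fin n), ∀ t, Φ (y, t) = c (y, t)) ∧ ∀ p, target f (Φ p) = ψ p := by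
  have hA := Cube.hasCylinderRetraction_boundary n
  obtain ⟨Φ₀, h1, h2⟩ := hA.exists_extension (Cube.isClosed_boundary n) u c hc hu
  obtain ⟨ρ, r1, r2⟩ := hA
  have h3 : ∀ p : (Fin n → I) × I, p.2 = 0 ∨ p.1 ∈ Cube.boundary (Fin n) →
      target f (Φ₀ p) = ψ p := by
    rintro ⟨y, t⟩ (h | h)
    · change t = 0 at h; subst h; rw [h1, hψ0]
    · rw [h2 y h, hψ y h]
  let d : ((Fin n → I) × I) × I → (Fin n → I) × I := fun p =>
    (fun i => slide ((ρ p.1).1 i) (p.1.1 i) p.2, slide (ρ p.1).2 p.1.2 p.2)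
  have hd : Continuous d := by
    refine Continuous.prodMk (continuous_pi fun i => continuous_slide ?_ ?_ ?_)
      (continuous_slide ?_ ?_ ?_) <;> fun_prop
  have hd0 : ∀ p, d (p, 0) = ρ p := fun p =>
    Prod.ext (funext fun i => slide_zero _ _) (slide_zero _ _)
  let τ : (Fin n → I) × I → I := fun p => projIcc (0 : ℝ) 1 zero_le_one (dist p (ρ p))
  have hτ : Continuous τ := continuous_projIcc.comp (by fun_prop)
  have hle : ∀ (a b : I) (r : ℝ), dist b a ≤ r →
      |(b : ℝ) - a| ≤ (projIcc (0 : ℝ) 1 zero_le_one r : I) := by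
    intro a b r h
    rw [coe_projIcc]
    refine le_max_of_le_right (le_min ?_ (by rwa [Subtype.dist_eq, Real.dist_eq] at h))
    rw [abs_le]
    constructor <;> linarith [a.2.1, a.2.2, b.2.1, b.2.2]
  have hd1 : ∀ p, d (p, τ p) = p := fun p =>
    Prod.ext (funext fun i => slide_of_le (hle _ _ _ ((dist_le_pi_dist p.1 (ρ p).1 i).trans
      (le_max_left _ _)))) (slide_of_le (hle _ _ _ (le_max_right _ _)))
  obtain ⟨Λ, l1, l2⟩ := exists_lift (Φ₀.comp ρ) (ψ.comp ⟨d, hd⟩) (fun p => by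
    change ψ (d (p, 0)) = target f (Φ₀ (ρ p))
    rw [hd0, h3 _ (r1 p)])
  have h4 : ∀ p : (Fin n → I) × I, p.2 = 0 ∨ p.1 ∈ Cube.boundary (Fin n) →
      Λ (p, τ p) = Φ₀ p := by
    intro p hp
    have : τ p = 0 := by
      simp only [τ, r2 p hp, dist_self]
      exact projIcc_left _
    rw [this, l1]
    change Φ₀ (ρ p) = _
    rw [r2 p hp]
  refine ⟨⟨fun p => Λ (p, τ p), by fun_prop⟩, fun y => ?_, fun y hy t => ?_, fun p => ?_⟩
  · exact (h4 _ (Or.inl rfl)).trans (h1 y)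
  · exact (h4 _ (Or.inr hy)).trans (h2 y hy t)
  · change target f (Λ (p, τ p)) = ψ p
    rw [l2]
    change ψ (d (p, τ p)) = _
    rw [hd1]

end MappingPathSpace

end MappingPathSpace

namespace MappingPathSpace

/-- The map to the mapping path space given by a family of points and a family of paths. -/
def mkMap {X Y K : Type*} [TopologicalSpace X] [TopologicalSpace Y] [TopologicalSpace K]
    {f : C(X, Y)} (x : C(K, X)) (w : C(K × I, Y)) (h : ∀ k, w (k, 0) = f (x k)) :
    C(K, MappingPathSpace f) :=
  ⟨fun k => ⟨(x k, w.curry k), h k⟩, Continuous.subtype_mk (by fun_prop) _⟩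

end MappingPathSpace

/-! ### Maps with the right lifting property against the boundary inclusions of cubes -/

section Weak

variable {X Y Z W E : Type*} [TopologicalSpace X] [TopologicalSpace Y] [TopologicalSpace Z]
  [TopologicalSpace W] [TopologicalSpace E]

/-- The right lifting property against the inclusions `∂Iⁿ → Iⁿ`, `n ≥ 0`. A map on the boundary
is given by a function on the cube that is continuous on the boundary. No such function exists if
`E` is empty, so the lifting property against `∅ → I⁰`, surjectivity, is required separately. -/
def CubeLifting (p : C(E, Y)) : Prop :=
  Function.Surjective p ∧ ∀ (n : ℕ) (φ : (Fin n → I) → E) (ψ : C(Fin n → I, Y)),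
    ContinuousOn φ (Cube.boundary (Fin n)) → (∀ y ∈ Cube.boundary (Fin n), p (φ y) = ψ y) →
    ∃ Φ : C(Fin n → I, E), (∀ y ∈ Cube.boundary (Fin n), Φ y = φ y) ∧ ∀ y, p (Φ y) = ψ y

/-- Maps on the bottom, the top and the sides of a prism that agree on the edges form a map on the
boundary of the prism. -/
theorem exists_prismBoundary_glue {n : ℕ} (q₀ q₁ : C(Fin n → I, E)) (c : (Fin n → I) × I → E)
    (hc : ContinuousOn c (Cube.boundary (Fin n) ×ˢ univ))
    (h0 : ∀ y ∈ Cube.boundary (Fin n), c (y, 0) = q₀ y)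
    (h1 : ∀ y ∈ Cube.boundary (Fin n), c (y, 1) = q₁ y) :
    ∃ φ : (Fin n → I) × I → E, ContinuousOn φ (prismBoundary n) ∧ (∀ y, φ (y, 0) = q₀ y) ∧
      (∀ y, φ (y, 1) = q₁ y) ∧ ∀ y ∈ Cube.boundary (Fin n), ∀ t, φ (y, t) = c (y, t) := by
  classical
  let φ : (Fin n → I) × I → E := fun p =>
    if p.2 = 0 then q₀ p.1 else if p.2 = 1 then q₁ p.1 else c p
  have e0 : ∀ p : (Fin n → I) × I, p.2 = 0 → φ p = q₀ p.1 := fun p hp => if_pos hp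
  have e1 : ∀ p : (Fin n → I) × I, p.2 = 1 → φ p = q₁ p.1 := fun p hp => by
    simp only [φ, hp, if_true, one_ne_zero, if_false]
  have e2 : ∀ p ∈ Cube.boundary (Fin n) ×ˢ (univ : Set I), φ p = c p := by
    rintro ⟨y, t⟩ ⟨hy, -⟩
    by_cases ht : t = 0
    · subst ht; exact (e0 _ rfl).trans (h0 y hy).symm
    · by_cases ht1 : t = 1
      · subst ht1; exact (e1 _ rfl).trans (h1 y hy).symm
      · simp only [φ, ht, ht1, if_false]
  refine ⟨φ, ?_, fun y => e0 _ rfl, fun y => e1 _ rfl, fun y hy t => e2 _ ⟨hy, mem_univ _⟩⟩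
  have hs : prismBoundary n = Cube.boundary (Fin n) ×ˢ univ ∪ ({p | p.2 = 0} ∪ {p | p.2 = 1}) := by
    ext ⟨y, t⟩; simp [prismBoundary]
  have c0 : IsClosed {p : (Fin n → I) × I | p.2 = 0} := isClosed_eq continuous_snd continuous_const
  have c1 : IsClosed {p : (Fin n → I) × I | p.2 = 1} := isClosed_eq continuous_snd continuous_const
  rw [hs]
  refine ContinuousOn.union_of_isClosed (hc.congr e2) (ContinuousOn.union_of_isClosed ?_ ?_ c0 c1)
    ((Cube.isClosed_boundary n).prod isClosed_univ) (c0.union c1)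
  · exact (q₀.continuous.comp continuous_fst).continuousOn.congr e0
  · exact (q₁.continuous.comp continuous_fst).continuousOn.congr e1

theorem CubeLifting.exists_lift_prism {p : C(E, Y)} (hp : CubeLifting p) {n : ℕ}
    (q₀ q₁ : C(Fin n → I, E)) (c : (Fin n → I) × I → E)
    (hc : ContinuousOn c (Cube.boundary (Fin n) ×ˢ univ)) (ψ : C((Fin n → I) × I, Y))
    (h0 : ∀ y ∈ Cube.boundary (Fin n), c (y, 0) = q₀ y)
    (h1 : ∀ y ∈ Cube.boundary (Fin n), c (y, 1) = q₁ y)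
    (p0 : ∀ y, p (q₀ y) = ψ (y, 0)) (p1 : ∀ y, p (q₁ y) = ψ (y, 1))
    (pc : ∀ y ∈ Cube.boundary (Fin n), ∀ t, p (c (y, t)) = ψ (y, t)) :
    ∃ Φ : C((Fin n → I) × I, E), (∀ y, Φ (y, 0) = q₀ y) ∧ (∀ y, Φ (y, 1) = q₁ y) ∧
      (∀ y ∈ Cube.boundary (Fin n), ∀ t, Φ (y, t) = c (y, t)) ∧ ∀ z, p (Φ z) = ψ z := by
  obtain ⟨φ, hφ, f0, f1, fc⟩ := exists_prismBoundary_glue q₀ q₁ c hc h0 h1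
  let h := cubeHomeoPrism n
  have hpφ : ∀ z ∈ prismBoundary n, p (φ z) = ψ z := by
    rintro ⟨y, t⟩ (hy | ht | ht)
    · rw [fc y hy, pc y hy]
    · change t = 0 at ht; rw [ht, f0, p0]
    · change t = 1 at ht; rw [ht, f1, p1]
  obtain ⟨Φ, k1, k2⟩ := hp.2 (n + 1) (φ ∘ h) (ψ.comp h)
    (hφ.comp h.continuous.continuousOn fun y hy => (cubeHomeoPrism_mem y).2 hy)
    (fun y hy => hpφ _ ((cubeHomeoPrism_mem y).2 hy))
  have k3 : ∀ z ∈ prismBoundary n, Φ (h.symm z) = φ z := fun z hz => by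
    rw [k1 _ ((cubeHomeoPrism_symm_mem z).2 hz)]
    exact congrArg φ (h.apply_symm_apply z)
  refine ⟨Φ.comp h.symm, fun y => ?_, fun y => ?_, fun y hy t => ?_, fun z => ?_⟩
  · exact (k3 (y, 0) (Or.inr (Or.inl rfl))).trans (f0 y)
  · exact (k3 (y, 1) (Or.inr (Or.inr rfl))).trans (f1 y)
  · exact (k3 (y, t) (Or.inl hy)).trans (fc y hy t)
  · exact (k2 (h.symm z)).trans (congrArg ψ (h.apply_symm_apply z))

/-- Homotopy relative to the boundary of a cube, in terms of maps on a prism. -/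
theorem homotopicRel_boundary_iff {n : ℕ} {p q : C(Fin n → I, X)} :
    p.HomotopicRel q (Cube.boundary (Fin n)) ↔ ∃ F : C((Fin n → I) × I, X),
      (∀ y, F (y, 0) = p y) ∧ (∀ y, F (y, 1) = q y) ∧
        ∀ y ∈ Cube.boundary (Fin n), ∀ t, F (y, t) = p y := by
  constructor
  · rintro ⟨F⟩
    exact ⟨F.toContinuousMap.comp ⟨Prod.swap, continuous_swap⟩, fun y => F.apply_zero y,
      fun y => F.apply_one y, fun y hy t => F.eq_fst t hy⟩
  · rintro ⟨F, h0, h1, hb⟩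
    exact ⟨{ toContinuousMap := F.comp ⟨Prod.swap, continuous_swap⟩
             map_zero_left := h0
             map_one_left := h1
             prop' := fun t y hy => hb y hy t }⟩

theorem homotopyGroupMap_injective_iff {f : C(X, Y)} {n : ℕ} {x : X} :
    Function.Injective (homotopyGroupMap f n x) ↔ ∀ p q : GenLoop (Fin n) X x,
      (f.comp p.1).HomotopicRel (f.comp q.1) (Cube.boundary (Fin n)) →
        p.1.HomotopicRel q.1 (Cube.boundary (Fin n)) := by
  constructor
  · intro h p q hpq
    have := @h (Quotient.mk _ p) (Quotient.mk _ q) (Quotient.sound hpq)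
    exact Quotient.exact this
  · rintro h ⟨p⟩ ⟨q⟩ hpq
    exact Quotient.sound (h p q (Quotient.exact hpq))

theorem homotopyGroupMap_surjective_iff {f : C(X, Y)} {n : ℕ} {x : X} :
    Function.Surjective (homotopyGroupMap f n x) ↔ ∀ q : GenLoop (Fin n) Y (f x),
      ∃ p : GenLoop (Fin n) X x,
        (f.comp p.1).HomotopicRel q.1 (Cube.boundary (Fin n)) := by
  constructor
  · intro h q
    obtain ⟨⟨p⟩, hp⟩ := h (Quotient.mk _ q)
    exact ⟨p, Quotient.exact hp⟩
  · rintro h ⟨q⟩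
    obtain ⟨p, hp⟩ := h q
    exact ⟨Quotient.mk _ p, Quotient.sound hp⟩

theorem pathComponentMap_injective_iff {f : C(X, Y)} :
    Function.Injective (pathComponentMap f) ↔ ∀ x x', Joined (f x) (f x') → Joined x x' := by
  constructor
  · intro h x x' hx
    exact Quotient.exact (@h (Quotient.mk _ x) (Quotient.mk _ x') (Quotient.sound hx))
  · rintro h ⟨x⟩ ⟨x'⟩ hx
    exact Quotient.sound (h x x' (Quotient.exact hx))

theorem pathComponentMap_surjective_iff {f : C(X, Y)} :
    Function.Surjective (pathComponentMap f) ↔ ∀ y, ∃ x, Joined (f x) y := by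
  constructor
  · intro h y
    obtain ⟨⟨x⟩, hx⟩ := h (Quotient.mk _ y)
    exact ⟨x, Quotient.exact hx⟩
  · rintro h ⟨y⟩
    obtain ⟨x, hx⟩ := h y
    exact ⟨Quotient.mk _ x, Quotient.sound hx⟩

theorem Cube.boundary_fin_zero : Cube.boundary (Fin 0) = ∅ := by
  ext y; simp [Cube.boundary]

theorem CubeLifting.isWeakHomotopyEquiv {p : C(E, Y)} (hp : CubeLifting p) :
    IsWeakHomotopyEquiv p := by
  refine ⟨⟨pathComponentMap_injective_iff.2 fun e e' h => ?_,
    pathComponentMap_surjective_iff.2 fun y => ?_⟩, fun n _ e =>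
    ⟨homotopyGroupMap_injective_iff.2 fun q q' h => ?_,
      homotopyGroupMap_surjective_iff.2 fun q => ?_⟩⟩
  · obtain ⟨γ⟩ := h
    obtain ⟨Φ, h0, h1, -⟩ := hp.exists_lift_prism (n := 0) (ContinuousMap.const _ e)
      (ContinuousMap.const _ e') (fun _ => e) continuousOn_const
      (γ.toContinuousMap.comp ⟨Prod.snd, continuous_snd⟩)
      (by simp [Cube.boundary_fin_zero]) (by simp [Cube.boundary_fin_zero])
      (fun _ => γ.source.symm) (fun _ => γ.target.symm) (by simp [Cube.boundary_fin_zero])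
    exact ⟨{ toFun := fun t => Φ (Fin.elim0, t), source' := h0 _, target' := h1 _ }⟩
  · obtain ⟨e, rfl⟩ := hp.1 y
    exact ⟨e, Joined.refl _⟩
  · obtain ⟨F, h0, h1, hb⟩ := homotopicRel_boundary_iff.1 h
    obtain ⟨Φ, k0, k1, kb, -⟩ := hp.exists_lift_prism q.1 q'.1 (fun _ => e) continuousOn_const F
      (fun y hy => (q.2 y hy).symm) (fun y hy => (q'.2 y hy).symm) (fun y => (h0 y).symm)
      (fun y => (h1 y).symm) (fun y hy t => by
        rw [hb y hy]; exact congrArg p (q.2 y hy).symm)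
    exact homotopicRel_boundary_iff.2 ⟨Φ, k0, k1, fun y hy t =>
      (kb y hy t).trans (q.2 y hy).symm⟩
  · obtain ⟨Φ, h1, h2⟩ := hp.2 n (fun _ => e) q.1 continuousOn_const
      (fun y hy => (q.2 y hy).symm)
    have : p.comp Φ = q.1 := ContinuousMap.ext h2
    exact ⟨⟨Φ, h1⟩, by rw [this]; exact ContinuousMap.HomotopicRel.refl _⟩

/-! ### Weak homotopy equivalences -/

theorem homotopyGroupMap_comp (g : C(Y, Z)) (f : C(X, Y)) (n : ℕ) (x : X) :
    homotopyGroupMap (g.comp f) n x = homotopyGroupMap g n (f x) ∘ homotopyGroupMap f n x := by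
  funext a
  induction a using Quotient.ind
  rfl

theorem pathComponentMap_comp (g : C(Y, Z)) (f : C(X, Y)) :
    pathComponentMap (g.comp f) = pathComponentMap g ∘ pathComponentMap f := by
  funext a
  induction a using Quotient.ind
  rfl

theorem isWeakHomotopyEquiv_id : IsWeakHomotopyEquiv (ContinuousMap.id X) := by
  have h1 : pathComponentMap (ContinuousMap.id X) = id := by
    funext a; induction a using Quotient.ind; rfl
  have h2 : ∀ n x, homotopyGroupMap (ContinuousMap.id X) n x = id := by
    intro n x; funext a; induction a using Quotient.ind; rfl
  refine ⟨by rw [h1]; exact Function.bijective_id, fun n _ x => ?_⟩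
  rw [h2]; exact Function.bijective_id

theorem IsWeakHomotopyEquiv.comp {g : C(Y, Z)} {f : C(X, Y)} (hg : IsWeakHomotopyEquiv g)
    (hf : IsWeakHomotopyEquiv f) : IsWeakHomotopyEquiv (g.comp f) := by
  refine ⟨?_, fun n hn x => ?_⟩
  · rw [pathComponentMap_comp]; exact hg.1.comp hf.1
  · rw [homotopyGroupMap_comp]; exact (hg.2 n hn _).comp (hf.2 n hn x)

theorem IsWeakHomotopyEquiv.of_comp_left {g : C(Y, Z)} {f : C(X, Y)}
    (hg : IsWeakHomotopyEquiv g) (h : IsWeakHomotopyEquiv (g.comp f)) :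
    IsWeakHomotopyEquiv f := by
  refine ⟨?_, fun n hn x => ?_⟩
  · rw [IsWeakHomotopyEquiv, pathComponentMap_comp] at h
    exact (Function.Bijective.of_comp_iff' hg.1 _).1 h.1
  · have := h.2 n hn x
    rw [homotopyGroupMap_comp] at this
    exact (Function.Bijective.of_comp_iff' (hg.2 n hn _) _).1 this

/-- Evaluation of paths at time `0`. -/
def evalZero (Y : Type*) [TopologicalSpace Y] : C(C(I, Y), Y) :=
  ⟨fun w => w 0, continuous_eval_const 0⟩

/-- Evaluation of paths at time `1`. -/
def evalOne (Y : Type*) [TopologicalSpace Y] : C(C(I, Y), Y) :=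
  ⟨fun w => w 1, continuous_eval_const 1⟩

theorem cubeLifting_evalZero : CubeLifting (evalZero Y) := by
  refine ⟨fun y => ⟨ContinuousMap.const _ y, rfl⟩, fun n φ ψ hφ h => ?_⟩
  have hc : ContinuousOn (fun p : (Fin n → I) × I => φ p.1 p.2)
      (Cube.boundary (Fin n) ×ˢ univ) :=
    (hφ.comp continuousOn_fst fun p hp => hp.1).eval continuousOn_snd
  obtain ⟨Φ, h1, h2⟩ := (Cube.hasCylinderRetraction_boundary n).exists_extension
    (Cube.isClosed_boundary n) ψ _ hc h
  exact ⟨Φ.curry, fun y hy => ContinuousMap.ext fun t => h2 y hy t, h1⟩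

theorem isWeakHomotopyEquiv_evalZero : IsWeakHomotopyEquiv (evalZero Y) :=
  cubeLifting_evalZero.isWeakHomotopyEquiv

theorem isWeakHomotopyEquiv_evalOne : IsWeakHomotopyEquiv (evalOne Y) := by
  refine CubeLifting.isWeakHomotopyEquiv ⟨fun y => ⟨ContinuousMap.const _ y, rfl⟩,
    fun n φ ψ hφ h => ?_⟩
  let r : C(C(I, Y), C(I, Y)) :=
    ⟨fun w => w.comp ⟨σ, continuous_symm⟩, ContinuousMap.continuous_precomp _⟩
  obtain ⟨Φ, h1, h2⟩ := cubeLifting_evalZero.2 n (r ∘ φ) ψ (r.continuous.comp_continuousOn hφ)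
    fun y hy => (congrArg (φ y) symm_zero).trans (h y hy)
  refine ⟨r.comp Φ, fun y hy => ?_, fun y => (congrArg (Φ y) symm_one).trans (h2 y)⟩
  rw [ContinuousMap.comp_apply, h1 y hy]
  exact ContinuousMap.ext fun t => congrArg (φ y) (symm_symm t)

/-- Weak homotopy equivalences are closed under homotopy: a homotopy is a map to the path
space, both of whose evaluations are weak equivalences. -/
theorem IsWeakHomotopyEquiv.of_homotopic {f g : C(X, Y)} (hf : IsWeakHomotopyEquiv f)
    (h : f.Homotopic g) : IsWeakHomotopyEquiv g := by
  obtain ⟨F⟩ := h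
  let F' : C(X, C(I, Y)) := (F.toContinuousMap.comp ⟨Prod.swap, continuous_swap⟩).curry
  have h0 : (evalZero Y).comp F' = f := ContinuousMap.ext fun x => F.apply_zero x
  have h1 : (evalOne Y).comp F' = g := ContinuousMap.ext fun x => F.apply_one x
  rw [← h1]
  refine isWeakHomotopyEquiv_evalOne.comp (isWeakHomotopyEquiv_evalZero.of_comp_left ?_)
  rwa [h0]

/-- Bijectivity on a homotopy group only depends on the path component of the base point. -/
theorem homotopyGroupMap_bijective_of_joined {g : C(Y, Z)} {n : ℕ} (hn : 1 ≤ n) {y y' : Y}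
    (h : Joined y y') (hy : Function.Bijective (homotopyGroupMap g n y)) :
    Function.Bijective (homotopyGroupMap g n y') := by
  obtain ⟨γ⟩ := h
  let δ : C(I, Y) := γ.toContinuousMap
  let g' : C(C(I, Y), C(I, Z)) := ⟨fun w => g.comp w, ContinuousMap.continuous_postcomp g⟩
  have e0 : (evalZero Z).comp g' = g.comp (evalZero Y) := rfl
  have e1 : (evalOne Z).comp g' = g.comp (evalOne Y) := rfl
  have hδ0 : evalZero Y δ = y := γ.source
  have hδ1 : evalOne Y δ = y' := γ.target
  have h1 : Function.Bijective (homotopyGroupMap g' n δ) := by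
    have k : Function.Bijective (homotopyGroupMap ((evalZero Z).comp g') n δ) := by
      rw [e0, homotopyGroupMap_comp]
      have hy' : Function.Bijective (homotopyGroupMap g n (evalZero Y δ)) := by
        rw [hδ0]; exact hy
      exact Function.Bijective.comp hy' (isWeakHomotopyEquiv_evalZero.2 n hn δ)
    rw [homotopyGroupMap_comp] at k
    exact (Function.Bijective.of_comp_iff' (isWeakHomotopyEquiv_evalZero.2 n hn _) _).1 k
  have k : Function.Bijective (homotopyGroupMap (g.comp (evalOne Y)) n δ) := by
    rw [← e1, homotopyGroupMap_comp]
    exact (isWeakHomotopyEquiv_evalOne.2 n hn _).comp h1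
  rw [homotopyGroupMap_comp] at k
  have : Function.Bijective (homotopyGroupMap g n (evalOne Y δ)) :=
    (Function.Bijective.of_comp_iff _ (isWeakHomotopyEquiv_evalOne.2 n hn δ)).1 k
  rwa [hδ1] at this

theorem IsWeakHomotopyEquiv.of_comp_right {g : C(Y, Z)} {f : C(X, Y)}
    (hf : IsWeakHomotopyEquiv f) (h : IsWeakHomotopyEquiv (g.comp f)) :
    IsWeakHomotopyEquiv g := by
  refine ⟨?_, fun n hn y => ?_⟩
  · rw [IsWeakHomotopyEquiv, pathComponentMap_comp] at h
    exact (Function.Bijective.of_comp_iff _ hf.1).1 h.1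
  · obtain ⟨x, hx⟩ := pathComponentMap_surjective_iff.1 hf.1.2 y
    refine homotopyGroupMap_bijective_of_joined hn hx ?_
    have := h.2 n hn x
    rw [homotopyGroupMap_comp] at this
    exact (Function.Bijective.of_comp_iff _ (hf.2 n hn x)).1 this

/-- The two-out-of-six property of weak homotopy equivalences, for the first of the three maps. -/
theorem IsWeakHomotopyEquiv.of_two_out_of_six {f : C(X, Y)} {g : C(Y, Z)} {h : C(Z, W)}
    (h1 : IsWeakHomotopyEquiv (g.comp f)) (h2 : IsWeakHomotopyEquiv (h.comp g)) :
    IsWeakHomotopyEquiv f := by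
  suffices hg : IsWeakHomotopyEquiv g from hg.of_comp_left h1
  have p1 := h1.1
  have p2 := h2.1
  rw [pathComponentMap_comp] at p1 p2
  have p3 : Function.Bijective (pathComponentMap g) := ⟨p2.1.of_comp, p1.2.of_comp⟩
  have p4 : Function.Bijective (pathComponentMap f) :=
    (Function.Bijective.of_comp_iff' p3 _).1 p1
  refine ⟨p3, fun n hn y => ?_⟩
  obtain ⟨x, hx⟩ := pathComponentMap_surjective_iff.1 p4.2 y
  refine homotopyGroupMap_bijective_of_joined hn hx ?_
  have q1 := h1.2 n hn x
  have q2 := h2.2 n hn (f x)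
  rw [homotopyGroupMap_comp] at q1 q2
  exact ⟨q2.1.of_comp, q1.2.of_comp⟩

/-- A homotopy equivalence is a weak homotopy equivalence. -/
theorem isWeakHomotopyEquiv_of_homotopyInverse {f : C(X, Y)} {e : C(Y, X)}
    (h1 : (e.comp f).Homotopic (ContinuousMap.id X))
    (h2 : (f.comp e).Homotopic (ContinuousMap.id Y)) : IsWeakHomotopyEquiv f :=
  IsWeakHomotopyEquiv.of_two_out_of_six (isWeakHomotopyEquiv_id.of_homotopic h1.symm)
    (isWeakHomotopyEquiv_id.of_homotopic h2.symm)

theorem isWeakHomotopyEquiv_of_inverse {f : C(X, Y)} {e : C(Y, X)} (h1 : ∀ x, e (f x) = x)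
    (h2 : ∀ y, f (e y) = y) : IsWeakHomotopyEquiv f := by
  refine isWeakHomotopyEquiv_of_homotopyInverse (e := e) ?_ ?_
  · rw [show e.comp f = ContinuousMap.id X from ContinuousMap.ext h1]
  · rw [show f.comp e = ContinuousMap.id Y from ContinuousMap.ext h2]

theorem IsWeakHomotopyEquiv.comp_iff {g : C(Y, Z)} (hg : IsWeakHomotopyEquiv g) {f : C(X, Y)} :
    IsWeakHomotopyEquiv (g.comp f) ↔ IsWeakHomotopyEquiv f :=
  ⟨hg.of_comp_left, hg.comp⟩

end Weak

/-! ### Weak homotopy equivalences as maps whose path fibration has the lifting property -/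

section Weak

variable {X Y E : Type*} [TopologicalSpace X] [TopologicalSpace Y] [TopologicalSpace E]

theorem IsWeakHomotopyEquiv.exists_nullhomotopy {p : C(E, Y)} (hp : IsWeakHomotopyEquiv p)
    {m : ℕ} (e : E) (q : C(Fin m → I, E)) (hq : ∀ y ∈ Cube.boundary (Fin m), q y = e)
    (v : C((Fin m → I) × I, Y)) (h0 : ∀ y, v (y, 0) = p e) (h1 : ∀ y, v (y, 1) = p (q y))
    (hb : ∀ y ∈ Cube.boundary (Fin m), ∀ t, v (y, t) = p e) :
    ∃ F : C((Fin m → I) × I, E), (∀ y, F (y, 0) = e) ∧ (∀ y, F (y, 1) = q y) ∧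
      ∀ y ∈ Cube.boundary (Fin m), ∀ t, F (y, t) = e := by
  rcases m with _ | m
  · have hj : Joined (p e) (p (q Fin.elim0)) :=
      ⟨{ toFun := fun t => v (Fin.elim0, t), source' := h0 _, target' := h1 _ }⟩
    obtain ⟨γ⟩ := pathComponentMap_injective_iff.1 hp.1.1 _ _ hj
    refine ⟨γ.toContinuousMap.comp ⟨Prod.snd, continuous_snd⟩, fun _ => γ.source, fun y => ?_,
      by simp [Cube.boundary_fin_zero]⟩
    exact γ.target.trans (congrArg q (Subsingleton.elim _ _))
  · exact homotopicRel_boundary_iff.1 (homotopyGroupMap_injective_iff.1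
      (hp.2 (m + 1) (by omega) e).1 GenLoop.const ⟨q, hq⟩
      (homotopicRel_boundary_iff.2 ⟨v, h0, h1, hb⟩))

/-- Injectivity on homotopy groups: a map on the boundary of a cube extends to the cube if its
image under a weak equivalence does. The bottom and the sides of the prism are contracted, which
makes the map on the boundary a based map on the top. -/
theorem IsWeakHomotopyEquiv.exists_extension_prism {p : C(E, Y)} (hp : IsWeakHomotopyEquiv p)
    {m : ℕ} (φ : (Fin m → I) × I → E) (hφ : ContinuousOn φ (prismBoundary m))
    (ψ : C((Fin m → I) × I, Y)) (h : ∀ z ∈ prismBoundary m, p (φ z) = ψ z) :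
    ∃ Φ : C((Fin m → I) × I, E), ∀ z ∈ prismBoundary m, Φ z = φ z := by
  classical
  have hA := Cube.hasCylinderRetraction_boundary m
  have hA' := hasCylinderRetraction_prismBoundary m
  obtain ⟨ρ, r1, r2⟩ := id hA
  have r3 : ∀ z, ρ z ∈ prismBoundary m := fun z => (r1 z).elim (fun h => Or.inr (Or.inl h)) Or.inl
  -- the straight contraction of the prism, pushed to the bottom and the sides
  let j : ((Fin m → I) × I) × I → (Fin m → I) × I := fun z =>
    ρ (fun i => σ z.2 * z.1.1 i, σ z.2 * z.1.2)
  have hj : Continuous j := by fun_prop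
  let e : E := φ (fun _ => 0, 0)
  have j0 : ∀ z : (Fin m → I) × I, z.2 = 0 ∨ z.1 ∈ Cube.boundary (Fin m) → j (z, 0) = z := by
    intro z hz
    simp only [j, symm_zero, one_mul]
    exact r2 z hz
  have j1 : ∀ z : (Fin m → I) × I, φ (j (z, 1)) = e := by
    intro z
    simp only [j, symm_one, zero_mul]
    rw [r2 _ (Or.inl rfl)]
  have hφj : Continuous fun z => φ (j z) := hφ.comp_continuous hj fun z => r3 _
  have hu : Continuous fun y : Fin m → I => φ (y, 1) :=
    hφ.comp_continuous (by fun_prop) fun y => Or.inr (Or.inr rfl)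
  obtain ⟨Γ, g0, gb⟩ := hA.exists_extension (Cube.isClosed_boundary m) ⟨_, hu⟩
    (fun z => φ (j ((z.1, 1), z.2))) (hφj.comp (by fun_prop)).continuousOn (fun y hy => by
      change φ (j ((y, 1), 0)) = φ (y, 1)
      rw [j0 _ (Or.inr hy)])
  -- the resulting homotopy on the boundary of the prism
  let c : ((Fin m → I) × I) × I → E := fun z =>
    if z.1.2 = 1 then Γ (z.1.1, z.2) else φ (j z)
  have c1 : ∀ z : ((Fin m → I) × I) × I, z.1.2 = 1 → c z = Γ (z.1.1, z.2) := fun z hz => if_pos hz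
  have c2 : ∀ z : ((Fin m → I) × I) × I, z.1.2 = 0 ∨ z.1.1 ∈ Cube.boundary (Fin m) →
      c z = φ (j z) := by
    rintro ⟨⟨y, s⟩, t⟩ hz
    by_cases hs : s = 1
    · subst hs
      rcases hz with hz | hz
      · exact absurd hz one_ne_zero
      · exact (c1 _ rfl).trans (gb y hz t)
    · exact if_neg hs
  have hc : ContinuousOn c (prismBoundary m ×ˢ univ) := by
    have s1 : IsClosed {z : ((Fin m → I) × I) × I | z.1.2 = 1} :=
      isClosed_eq (by fun_prop) continuous_const
    have s2 : IsClosed {z : ((Fin m → I) × I) × I | z.1.2 = 0 ∨ z.1.1 ∈ Cube.boundary (Fin m)} :=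
      (isClosed_eq (by fun_prop) continuous_const).union
        ((Cube.isClosed_boundary m).preimage (by fun_prop))
    have k1 : ContinuousOn c {z : ((Fin m → I) × I) × I | z.1.2 = 1} := by
      refine ContinuousOn.congr (Continuous.continuousOn ?_) c1
      fun_prop
    refine (k1.union_of_isClosed (hφj.continuousOn.congr c2) s1 s2).mono ?_
    rintro ⟨⟨y, s⟩, t⟩ ⟨hz | hz | hz, -⟩
    · exact Or.inr (Or.inr hz)
    · exact Or.inr (Or.inl hz)
    · exact Or.inl hz
  have c0 : ∀ z ∈ prismBoundary m, c (z, 0) = φ z := by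
    rintro ⟨y, s⟩ (hz | hz | hz)
    · rw [c2 _ (Or.inr hz), j0 _ (Or.inr hz)]
    · rw [c2 _ (Or.inl hz), j0 _ (Or.inl hz)]
    · rw [c1 _ hz]
      change s = 1 at hz
      rw [hz]; exact g0 y
  have ce : ∀ z : (Fin m → I) × I, z.2 = 0 ∨ z.1 ∈ Cube.boundary (Fin m) → c (z, 1) = e :=
    fun z hz => (c2 (z, 1) hz).trans (j1 z)
  obtain ⟨v, hv⟩ := hA'.exists_extension_of_homotopy (isClosed_prismBoundary m) ψ
    (fun z => p (c z)) (p.continuous.comp_continuousOn hc) fun z hz => by rw [c0 z hz, h z hz]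
  obtain ⟨F, F0, F1, Fb⟩ := hp.exists_nullhomotopy e ⟨fun y => Γ (y, 1), by fun_prop⟩
    (fun y hy => (gb y hy 1).trans (j1 _)) v
    (fun y => by rw [hv _ (Or.inr (Or.inl rfl)), ce _ (Or.inl rfl)])
    (fun y => by rw [hv _ (Or.inr (Or.inr rfl)), c1 _ rfl]; rfl)
    (fun y hy t => by rw [hv _ (Or.inl hy), ce _ (Or.inr hy)])
  have hF : ∀ z ∈ prismBoundary m, c (z, 1) = F z := by
    rintro ⟨y, s⟩ (hz | hz | hz)
    · rw [ce _ (Or.inr hz), Fb y hz]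
    · change s = 0 at hz; rw [ce _ (Or.inl hz), hz, F0]
    · change s = 1 at hz; rw [c1 _ hz, hz, F1]; rfl
  obtain ⟨Φ, hΦ⟩ := hA'.exists_extension_of_homotopy (isClosed_prismBoundary m) F
    (fun z => c (z.1, σ z.2))
    (hc.comp (by fun_prop) fun z hz => ⟨hz.1, mem_univ _⟩)
    fun z hz => by simp only [symm_zero]; exact hF z hz
  refine ⟨Φ, fun z hz => ?_⟩
  rw [hΦ z hz]
  simp only [symm_one]
  exact c0 z hz

namespace MappingPathSpace

variable {f : C(X, Y)}

theorem cubeLifting_source : CubeLifting (source f) := by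
  refine ⟨fun x => ⟨ofSource f x, rfl⟩, fun n φ ψ hφ h => ?_⟩
  have hc : ContinuousOn (fun z : (Fin n → I) × I => path f (φ z.1) z.2)
      (Cube.boundary (Fin n) ×ˢ univ) :=
    ((path f).continuous.comp_continuousOn
      (hφ.comp continuousOn_fst fun p hp => hp.1)).eval continuousOn_snd
  obtain ⟨w, h0, hb⟩ := (Cube.hasCylinderRetraction_boundary n).exists_extension
    (Cube.isClosed_boundary n) (f.comp ψ) _ hc fun y hy => by
      rw [path_zero, h y hy]; rfl
  exact ⟨mkMap ψ w h0, fun y hy => ext (h y hy).symm fun s => hb y hy s, fun y => rfl⟩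

theorem isWeakHomotopyEquiv_source : IsWeakHomotopyEquiv (source f) :=
  cubeLifting_source.isWeakHomotopyEquiv

/-- Surjectivity on homotopy groups: contracting the cube reduces a lifting problem to one that is
constant on the boundary. -/
theorem cubeLifting_target (hp : IsWeakHomotopyEquiv (target f)) : CubeLifting (target f) := by
  have hs : Function.Surjective (target f) := by
    intro y
    obtain ⟨e, ⟨γ⟩⟩ := pathComponentMap_surjective_iff.1 hp.1.2 y
    obtain ⟨Λ, -, h⟩ := exists_lift (K := Unit) (ContinuousMap.const _ e)
      (γ.toContinuousMap.comp ⟨Prod.snd, continuous_snd⟩) fun _ => γ.source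
    exact ⟨Λ ((), 1), (h _).trans γ.target⟩
  refine ⟨hs, fun n φ ψ hφ h => ?_⟩
  rcases n with _ | m
  · obtain ⟨e, he⟩ := hs (ψ Fin.elim0)
    refine ⟨ContinuousMap.const _ e, by simp [Cube.boundary_fin_zero], fun y => ?_⟩
    exact he.trans (congrArg ψ (Subsingleton.elim _ _))
  · obtain ⟨Φ', hΦ'⟩ := hp.exists_extension_prism (φ ∘ (cubeHomeoPrism m).symm)
      (hφ.comp (Homeomorph.continuous _).continuousOn fun z hz => (cubeHomeoPrism_symm_mem z).2 hz)
      (ψ.comp ((cubeHomeoPrism m).symm : C((Fin m → I) × I, Fin (m + 1) → I)))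
      fun z hz => h _ ((cubeHomeoPrism_symm_mem z).2 hz)
    let Φ : C(Fin (m + 1) → I, MappingPathSpace f) := Φ'.comp (cubeHomeoPrism m)
    have hΦ : ∀ y ∈ Cube.boundary (Fin (m + 1)), Φ y = φ y := fun y hy =>
      (hΦ' _ ((cubeHomeoPrism_mem y).2 hy)).trans
        (congrArg φ ((cubeHomeoPrism m).symm_apply_apply y))
    let con : (Fin (m + 1) → I) × I → Fin (m + 1) → I := fun z i => σ z.2 * z.1 i
    have hcon : Continuous con := by fun_prop
    have con0 : ∀ y, con (y, 0) = y := fun y => funext fun i => by simp [con]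
    have con1 : ∀ y, con (y, 1) = fun _ => 0 := fun y => funext fun i => by simp [con]
    let e : MappingPathSpace f := Φ fun _ => 0
    obtain ⟨Ψ, Ψ0, Ψb⟩ := (Cube.hasCylinderRetraction_boundary (m + 1)).exists_extension
      (Cube.isClosed_boundary _) ψ (fun z => target f (Φ (con z)))
      (Continuous.continuousOn (by fun_prop)) fun y hy => by
        rw [con0, hΦ y hy, h y hy]
    obtain ⟨q, hq⟩ := homotopyGroupMap_surjective_iff.1 (hp.2 (m + 1) (by omega) e).2
      ⟨⟨fun y => Ψ (y, 1), by fun_prop⟩, fun y hy => by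
        change Ψ (y, 1) = _
        rw [Ψb y hy, con1]⟩
    obtain ⟨F, F0, F1, Fb⟩ := homotopicRel_boundary_iff.1 hq
    obtain ⟨Φ₁, p0, pb, p1⟩ := exists_lift_rel q.1 (fun _ => e) continuousOn_const F
      (fun y hy => (q.2 y hy).symm) (fun y => (F0 y).symm)
      (fun y hy t => (congrArg (target f) (q.2 y hy)).symm.trans (Fb y hy t).symm)
    obtain ⟨Φ₂, -, kb, k1⟩ := exists_lift_rel ⟨fun y => Φ₁ (y, 1), by fun_prop⟩
      (fun z => Φ (con (z.1, σ z.2))) (Continuous.continuousOn (by fun_prop))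
      ⟨fun z => Ψ (z.1, σ z.2), by fun_prop⟩
      (fun y hy => by
        change Φ (con (y, σ 0)) = Φ₁ (y, 1)
        rw [symm_zero, con1, pb y hy])
      (fun y => by
        change target f (Φ₁ (y, 1)) = Ψ (y, σ 0)
        rw [p1, symm_zero]; exact F1 y)
      (fun y hy t => (Ψb y hy _).symm)
    refine ⟨⟨fun y => Φ₂ (y, 1), by fun_prop⟩, fun y hy => ?_, fun y => ?_⟩
    · refine (kb y hy 1).trans ?_
      rw [symm_one, con0, hΦ y hy]
    · refine (k1 (y, 1)).trans ?_
      change Ψ (y, σ 1) = ψ y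
      rw [symm_one, Ψ0]

/-- A map is a weak homotopy equivalence if and only if its path fibration has the right lifting
property against the boundary inclusions of cubes. -/
theorem cubeLifting_target_iff : CubeLifting (target f) ↔ IsWeakHomotopyEquiv f := by
  constructor
  · intro h
    have h1 : IsWeakHomotopyEquiv (ofSource f) :=
      isWeakHomotopyEquiv_source.of_comp_left
        (show IsWeakHomotopyEquiv ((source f).comp (ofSource f)) from isWeakHomotopyEquiv_id)
    exact h.isWeakHomotopyEquiv.comp h1
  · intro h
    refine cubeLifting_target ((h.comp isWeakHomotopyEquiv_source).of_homotopic ⟨?_⟩)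
    exact
      { toFun := fun z => path f z.2 z.1
        continuous_toFun := continuous_path_apply.comp continuous_swap
        map_zero_left := fun p => path_zero p
        map_one_left := fun p => rfl }

end MappingPathSpace

end Weak

/-! ### Homotopy pullbacks of spaces -/

section HomotopyPullback

variable {B C D B' C' D' : Type*} [TopologicalSpace B] [TopologicalSpace C] [TopologicalSpace D]
  [TopologicalSpace B'] [TopologicalSpace C'] [TopologicalSpace D']

/-- The homotopy pullback of `B → D ← C`: triples of a point of `B`, a path in `D` and a point of
`C`. -/
def HomotopyPullbackSpace (h : C(B, D)) (k : C(C, D)) : Type _ :=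
  {p : B × C(I, D) × C // p.2.1 0 = h p.1 ∧ p.2.1 1 = k p.2.2}

namespace HomotopyPullbackSpace

section Basic

variable {h : C(B, D)} {k : C(C, D)}

instance : TopologicalSpace (HomotopyPullbackSpace h k) :=
  inferInstanceAs (TopologicalSpace
    {p : B × C(I, D) × C // p.2.1 0 = h p.1 ∧ p.2.1 1 = k p.2.2})

variable (h k)

/-- The projection to `B`. -/
def fst : C(HomotopyPullbackSpace h k, B) :=
  ⟨fun p => p.1.1, by unfold HomotopyPullbackSpace; fun_prop⟩

/-- The projection to the space of paths in `D`. -/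
def path : C(HomotopyPullbackSpace h k, C(I, D)) :=
  ⟨fun p => p.1.2.1, by unfold HomotopyPullbackSpace; fun_prop⟩

/-- The projection to `C`. -/
def snd : C(HomotopyPullbackSpace h k, C) :=
  ⟨fun p => p.1.2.2, by unfold HomotopyPullbackSpace; fun_prop⟩

variable {h k}

theorem path_zero (p : HomotopyPullbackSpace h k) : path h k p 0 = h (fst h k p) := p.2.1

theorem path_one (p : HomotopyPullbackSpace h k) : path h k p 1 = k (snd h k p) := p.2.2

theorem ext {p q : HomotopyPullbackSpace h k} (h1 : fst h k p = fst h k q)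
    (h2 : ∀ t, path h k p t = path h k q t) (h3 : snd h k p = snd h k q) : p = q :=
  Subtype.ext (Prod.ext h1 (Prod.ext (ContinuousMap.ext h2) h3))

theorem continuous_path_apply :
    Continuous fun z : HomotopyPullbackSpace h k × I => path h k z.1 z.2 :=
  ((path h k).continuous.comp continuous_fst).eval continuous_snd

theorem continuous_path_eval {K : Type*} [TopologicalSpace K]
    {z : K → HomotopyPullbackSpace h k} {s : K → I} (hz : Continuous z) (hs : Continuous s) :
    Continuous fun x => path h k (z x) (s x) :=
  continuous_path_apply.comp (hz.prodMk hs)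

/-- The map to a homotopy pullback given by families of points of `B`, paths in `D` and points of
`C`. -/
def lift {K : Type*} [TopologicalSpace K] (b : C(K, B)) (w : C(K × I, D)) (c : C(K, C))
    (h0 : ∀ x, w (x, 0) = h (b x)) (h1 : ∀ x, w (x, 1) = k (c x)) :
    C(K, HomotopyPullbackSpace h k) :=
  ⟨fun x => ⟨(b x, w.curry x, c x), h0 x, h1 x⟩, Continuous.subtype_mk (by fun_prop) _⟩

end Basic

variable {h : C(B, D)} {k : C(C, D)} {h' : C(B', D')} {k' : C(C', D')}

/-- The map of homotopy pullbacks induced by a map of cospans. -/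
def map (β : C(B, B')) (δ : C(D, D')) (γ : C(C, C')) (h1 : ∀ b, δ (h b) = h' (β b))
    (h2 : ∀ c, δ (k c) = k' (γ c)) :
    C(HomotopyPullbackSpace h k, HomotopyPullbackSpace h' k') :=
  lift (β.comp (fst h k)) ⟨fun z => δ (path h k z.1 z.2), δ.continuous.comp continuous_path_apply⟩
    (γ.comp (snd h k)) (fun x => (congrArg δ (path_zero x)).trans (h1 _))
    (fun x => (congrArg δ (path_one x)).trans (h2 _))

open MappingPathSpace in
/-- Homotopy pullbacks are homotopy invariant. -/
theorem isWeakHomotopyEquiv_map {β : C(B, B')} {δ : C(D, D')} {γ : C(C, C')}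
    (h1 : ∀ b, δ (h b) = h' (β b)) (h2 : ∀ c, δ (k c) = k' (γ c))
    (hβ : IsWeakHomotopyEquiv β) (hδ : IsWeakHomotopyEquiv δ) (hγ : IsWeakHomotopyEquiv γ) :
    IsWeakHomotopyEquiv (map β δ γ h1 h2) := by
  rw [← cubeLifting_target_iff] at hβ hδ hγ ⊢
  let P := HomotopyPullbackSpace h k
  let P' := HomotopyPullbackSpace h' k'
  let m := map β δ γ h1 h2
  -- the images in `N δ` of points of `N β` and of `N γ`
  let βδ : C(MappingPathSpace β, MappingPathSpace δ) := mkMap (h.comp (source β))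
    ⟨fun z => h' (MappingPathSpace.path β z.1 z.2),
      h'.continuous.comp MappingPathSpace.continuous_path_apply⟩
    fun z => by
      change h' (MappingPathSpace.path β z 0) = δ (h (source β z))
      rw [MappingPathSpace.path_zero, h1]
  let γδ : C(MappingPathSpace γ, MappingPathSpace δ) := mkMap (k.comp (source γ))
    ⟨fun z => k' (MappingPathSpace.path γ z.1 z.2),
      k'.continuous.comp MappingPathSpace.continuous_path_apply⟩
    fun z => by
      change k' (MappingPathSpace.path γ z 0) = δ (k (source γ z))
      rw [MappingPathSpace.path_zero, h2]
  -- the components of a point of the mapping path space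
  let pB : C(MappingPathSpace m, MappingPathSpace β) := mkMap ((fst h k).comp (source m))
    ⟨fun z => fst h' k' (MappingPathSpace.path m z.1 z.2),
      (fst h' k').continuous.comp MappingPathSpace.continuous_path_apply⟩
    fun z => congrArg (fst h' k') (MappingPathSpace.path_zero z)
  let pC : C(MappingPathSpace m, MappingPathSpace γ) := mkMap ((snd h k).comp (source m))
    ⟨fun z => snd h' k' (MappingPathSpace.path m z.1 z.2),
      (snd h' k').continuous.comp MappingPathSpace.continuous_path_apply⟩
    fun z => congrArg (snd h' k') (MappingPathSpace.path_zero z)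
  let pD : C(MappingPathSpace m × I, MappingPathSpace δ) := mkMap
    ⟨fun z => path h k (source m z.1) z.2, continuous_path_apply.comp
      (by fun_prop : Continuous fun z : MappingPathSpace m × I => (source m z.1, z.2))⟩
    ⟨fun z => path h' k' (MappingPathSpace.path m z.1.1 z.2) z.1.2,
      continuous_path_apply.comp (Continuous.prodMk
        (MappingPathSpace.continuous_path_apply.comp
          (by fun_prop : Continuous fun z : (MappingPathSpace m × I) × I => (z.1.1, z.2)))
        (by fun_prop : Continuous fun z : (MappingPathSpace m × I) × I => z.1.2))⟩
    fun z => by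
      change path h' k' (MappingPathSpace.path m z.1 0) z.2 = _
      rw [MappingPathSpace.path_zero]
      rfl
  -- a point of the mapping path space is determined by its components
  have key : ∀ (n : ℕ) (Φβ : C(Fin n → I, MappingPathSpace β))
      (Φγ : C(Fin n → I, MappingPathSpace γ)) (Φδ : C((Fin n → I) × I, MappingPathSpace δ)),
      (∀ y, Φδ (y, 0) = βδ (Φβ y)) → (∀ y, Φδ (y, 1) = γδ (Φγ y)) →
      ∃ Φ : C(Fin n → I, MappingPathSpace m), (∀ y, pB (Φ y) = Φβ y) ∧
        (∀ y t, pD (Φ y, t) = Φδ (y, t)) ∧ ∀ y, pC (Φ y) = Φγ y := by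
    intro n Φβ Φγ Φδ e0 e1
    let x : C(Fin n → I, P) := lift ((source β).comp Φβ) ((source δ).comp Φδ) ((source γ).comp Φγ)
      (fun y => congrArg (source δ) (e0 y)) (fun y => congrArg (source δ) (e1 y))
    let w : C((Fin n → I) × I, P') := lift
      ⟨fun z => MappingPathSpace.path β (Φβ z.1) z.2,
        MappingPathSpace.continuous_path_eval (by fun_prop) (by fun_prop)⟩
      ⟨fun z => MappingPathSpace.path δ (Φδ (z.1.1, z.2)) z.1.2,
        MappingPathSpace.continuous_path_eval (by fun_prop) (by fun_prop)⟩
      ⟨fun z => MappingPathSpace.path γ (Φγ z.1) z.2,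
        MappingPathSpace.continuous_path_eval (by fun_prop) (by fun_prop)⟩
      (fun z => by
        change MappingPathSpace.path δ (Φδ (z.1, 0)) z.2 = _
        rw [e0]; rfl)
      (fun z => by
        change MappingPathSpace.path δ (Φδ (z.1, 1)) z.2 = _
        rw [e1]; rfl)
    refine ⟨mkMap x w fun y => HomotopyPullbackSpace.ext (MappingPathSpace.path_zero (Φβ y))
      (fun t => MappingPathSpace.path_zero (Φδ (y, t)))
      (MappingPathSpace.path_zero (Φγ y)), fun y => rfl, fun y t => rfl, fun y => rfl⟩
  have tgt : ∀ (z : MappingPathSpace m) (p : P'), target β (pB z) = fst h' k' p →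
      (∀ t, target δ (pD (z, t)) = path h' k' p t) → target γ (pC z) = snd h' k' p →
      target m z = p := fun z p e1 e2 e3 => HomotopyPullbackSpace.ext e1 e2 e3
  have inj : ∀ z z' : MappingPathSpace m, pB z = pB z' → (∀ t, pD (z, t) = pD (z', t)) →
      pC z = pC z' → z = z' := by
    intro z z' e1 e2 e3
    refine MappingPathSpace.ext ?_ fun s => ?_
    · exact HomotopyPullbackSpace.ext (congrArg (source β) e1)
        (fun t => congrArg (source δ) (e2 t)) (congrArg (source γ) e3)
    · exact HomotopyPullbackSpace.ext
        (congrArg (fun z => MappingPathSpace.path β z s) e1)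
        (fun t => congrArg (fun z => MappingPathSpace.path δ z s) (e2 t))
        (congrArg (fun z => MappingPathSpace.path γ z s) e3)
  -- lifting the path component, once the endpoints are lifted
  have main : ∀ (n : ℕ) (Φβ : C(Fin n → I, MappingPathSpace β))
      (Φγ : C(Fin n → I, MappingPathSpace γ)) (ψ : C(Fin n → I, P'))
      (c : (Fin n → I) × I → MappingPathSpace δ)
      (_ : ContinuousOn c (Cube.boundary (Fin n) ×ˢ univ))
      (_ : ∀ y ∈ Cube.boundary (Fin n), c (y, 0) = βδ (Φβ y))
      (_ : ∀ y ∈ Cube.boundary (Fin n), c (y, 1) = γδ (Φγ y))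
      (_ : ∀ y, target β (Φβ y) = fst h' k' (ψ y)) (_ : ∀ y, target γ (Φγ y) = snd h' k' (ψ y))
      (_ : ∀ y ∈ Cube.boundary (Fin n), ∀ t, target δ (c (y, t)) = path h' k' (ψ y) t),
      ∃ Φ : C(Fin n → I, MappingPathSpace m), (∀ y, pB (Φ y) = Φβ y) ∧
        (∀ y ∈ Cube.boundary (Fin n), ∀ t, pD (Φ y, t) = c (y, t)) ∧ (∀ y, pC (Φ y) = Φγ y) ∧
          ∀ y, target m (Φ y) = ψ y := by
    intro n Φβ Φγ ψ c hc c0 c1 tβ tγ tc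
    obtain ⟨Φδ, d0, d1, db, dt⟩ := hδ.exists_lift_prism (βδ.comp Φβ) (γδ.comp Φγ) c hc
      ⟨fun z => path h' k' (ψ z.1) z.2, continuous_path_eval (by fun_prop) (by fun_prop)⟩ c0 c1
      (fun y => (congrArg h' (tβ y)).trans (path_zero (ψ y)).symm)
      (fun y => (congrArg k' (tγ y)).trans (path_one (ψ y)).symm) tc
    obtain ⟨Φ, k1, k2, k3⟩ := key n Φβ Φγ Φδ d0 d1
    refine ⟨Φ, k1, fun y hy t => (k2 y t).trans (db y hy t), k3, fun y => tgt _ _ ?_ ?_ ?_⟩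
    · rw [k1, tβ]
    · intro t; rw [k2, dt]; rfl
    · rw [k3, tγ]
  constructor
  · intro p
    obtain ⟨b, hb⟩ := hβ.1 (fst h' k' p)
    obtain ⟨c, hc⟩ := hγ.1 (snd h' k' p)
    obtain ⟨Φ, -, -, -, ht⟩ := main 0 (ContinuousMap.const _ b) (ContinuousMap.const _ c)
      (ContinuousMap.const _ p) (fun _ => βδ b) continuousOn_const
      (by simp [Cube.boundary_fin_zero]) (by simp [Cube.boundary_fin_zero]) (fun _ => hb)
      (fun _ => hc) (by simp [Cube.boundary_fin_zero])
    exact ⟨Φ Fin.elim0, ht _⟩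
  · intro n φ ψ hφ hψ
    obtain ⟨Φβ, b1, b2⟩ := hβ.2 n (pB ∘ φ) ((fst h' k').comp ψ)
      (pB.continuous.comp_continuousOn hφ) fun y hy => congrArg (fst h' k') (hψ y hy)
    obtain ⟨Φγ, c1, c2⟩ := hγ.2 n (pC ∘ φ) ((snd h' k').comp ψ)
      (pC.continuous.comp_continuousOn hφ) fun y hy => congrArg (snd h' k') (hψ y hy)
    have pD0 : ∀ z, pD (z, 0) = βδ (pB z) := fun z =>
      MappingPathSpace.ext (path_zero _) fun s => path_zero _
    have pD1 : ∀ z, pD (z, 1) = γδ (pC z) := fun z =>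
      MappingPathSpace.ext (path_one _) fun s => path_one _
    obtain ⟨Φ, k1, k2, k3, k4⟩ := main n Φβ Φγ ψ (fun z => pD (φ z.1, z.2))
      (pD.continuous.comp_continuousOn ((hφ.comp continuousOn_fst fun p hp => hp.1).prodMk
        continuousOn_snd))
      (fun y hy => by rw [b1 y hy]; exact pD0 _) (fun y hy => by rw [c1 y hy]; exact pD1 _) b2 c2
      (fun y hy t => congrArg (fun p => path h' k' p t) (hψ y hy))
    exact ⟨Φ, fun y hy => inj _ _ ((k1 y).trans (b1 y hy)) (k2 y hy) ((k3 y).trans (c1 y hy)), k4⟩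

end HomotopyPullbackSpace

end HomotopyPullback

/-! ### Fixed points of a `𝒲_G`-space as a functor on based `G`-maps -/

/-- The circle as the quotient of the unit interval by its endpoints. -/
theorem exists_intervalCollapse : ∃ c : C(I, Sphere 1), (∀ s, c s = ∞ ↔ s = 0 ∨ s = 1) ∧
    (∀ s t, c s ≠ ∞ → c s = c t → s = t) ∧ Function.Surjective c := by
  obtain ⟨c, h1, h2, h3⟩ := exists_discCollapse 1
  let d : I → Disc 1 := fun s => ⟨fun _ => 2 * (s : ℝ) - 1, by
    rw [mem_closedBall_zero_iff, pi_norm_le_iff_of_nonneg zero_le_one]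
    intro _
    rw [Real.norm_eq_abs, abs_le]
    constructor <;> linarith [s.2.1, s.2.2]⟩
  have hd : Continuous d := by fun_prop
  have hn : ∀ s, ‖(d s : Fin 1 → ℝ)‖ < 1 ↔ ¬ (s = 0 ∨ s = 1) := by
    intro s
    rw [pi_norm_lt_iff zero_lt_one]
    have e : (∀ i, ‖(d s : Fin 1 → ℝ) i‖ < 1) ↔ |2 * (s : ℝ) - 1| < 1 :=
      ⟨fun h => h 0, fun h _ => h⟩
    rw [e, abs_lt, not_or]
    constructor
    · rintro ⟨ha, hb⟩
      constructor
      · rintro rfl; norm_num at ha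
      · rintro rfl; norm_num at hb
    · rintro ⟨ha, hb⟩
      have ha' : (s : ℝ) ≠ 0 := fun h => ha (Subtype.ext h)
      have hb' : (s : ℝ) ≠ 1 := fun h => hb (Subtype.ext h)
      have ha'' := lt_of_le_of_ne s.2.1 ha'.symm
      have hb'' := lt_of_le_of_ne s.2.2 hb'
      constructor <;> linarith
  have h1' : ∀ s, c (d s) = ∞ ↔ s = 0 ∨ s = 1 := fun s => by rw [h1, hn, not_not]
  refine ⟨c.comp ⟨d, hd⟩, h1', fun s t hs hst => ?_, fun x => ?_⟩
  · have hs' : ¬ (s = 0 ∨ s = 1) := fun h => hs ((h1' s).2 h)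
    have ht' : ¬ (t = 0 ∨ t = 1) := fun h => hs (hst.trans ((h1' t).2 h))
    have := congrArg (fun x : Disc 1 => (x : Fin 1 → ℝ) 0)
      (h2 _ _ ((hn s).2 hs') ((hn t).2 ht') hst)
    change 2 * (s : ℝ) - 1 = 2 * (t : ℝ) - 1 at this
    exact Subtype.ext (by linarith)
  · induction x using OnePoint.rec with
    | infty => exact ⟨0, (h1' 0).2 (Or.inl rfl)⟩
    | coe v =>
      obtain ⟨x, hx, hv⟩ := h3 v
      have hx0 : |(x : Fin 1 → ℝ) 0| ≤ 1 := (norm_le_pi_norm _ 0).trans hx.le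
      rw [abs_le] at hx0
      refine ⟨⟨((x : Fin 1 → ℝ) 0 + 1) / 2, by linarith, by linarith⟩, ?_⟩
      rw [← hv]
      refine congrArg c (Subtype.ext (funext fun i => ?_))
      rw [Subsingleton.elim i 0]
      change 2 * (((x : Fin 1 → ℝ) 0 + 1) / 2) - 1 = _
      ring

/-- The quotient map from the unit interval to the circle. -/
noncomputable def intervalCollapse : C(I, Sphere 1) := Classical.choose exists_intervalCollapse

theorem intervalCollapse_eq_infty {s : I} : intervalCollapse s = ∞ ↔ s = 0 ∨ s = 1 :=
  (Classical.choose_spec exists_intervalCollapse).1 s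

theorem intervalCollapse_zero : intervalCollapse 0 = ∞ :=
  intervalCollapse_eq_infty.2 (Or.inl rfl)

theorem intervalCollapse_one : intervalCollapse 1 = ∞ :=
  intervalCollapse_eq_infty.2 (Or.inr rfl)

theorem intervalCollapse_inj {s t : I} (h : intervalCollapse s ≠ ∞)
    (h' : intervalCollapse s = intervalCollapse t) : s = t :=
  (Classical.choose_spec exists_intervalCollapse).2.1 s t h h'

theorem intervalCollapse_surjective : Function.Surjective intervalCollapse :=
  (Classical.choose_spec exists_intervalCollapse).2.2

/-- Continuous based `G`-maps. -/
structure IsBasedGMap (G : Type*) {X Y : Type*} [TopologicalSpace X] [TopologicalSpace Y]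
    [SMul G X] [SMul G Y] (x₀ : X) (y₀ : Y) (φ : X → Y) : Prop where
  continuous : Continuous φ
  map_pt : φ x₀ = y₀
  equivariant : IsEquivariant G φ

theorem IsBasedGMap.comp {X Y W : Type*} [TopologicalSpace X] [TopologicalSpace Y]
    [TopologicalSpace W] [SMul G X] [SMul G Y] [SMul G W] {x₀ : X} {y₀ : Y} {w₀ : W}
    {ψ : Y → W} {φ : X → Y} (hψ : IsBasedGMap G y₀ w₀ ψ) (hφ : IsBasedGMap G x₀ y₀ φ) :
    IsBasedGMap G x₀ w₀ fun x => ψ (φ x) where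
  continuous := hψ.continuous.comp hφ.continuous
  map_pt := (congrArg ψ hφ.map_pt).trans hψ.map_pt
  equivariant g x := (congrArg ψ (hφ.equivariant g x)).trans (hψ.equivariant g _)

section FixedPoints

variable {G : Type u} [Group G] [TopologicalSpace G]

namespace WGSpace

variable (Z : WGSpace G) (H : Subgroup G)

/-- The `H`-fixed points of `Z(A)`. -/
abbrev Fixed (A : WG G) : Type u := MulAction.fixedPoints H (Z.obj A)

/-- The base point of `Z(A)^H`. -/
def fixedPt (A : WG G) : Z.Fixed H A := ⟨(Z.obj A).pt, fun h => (Z.obj A).smul_pt h⟩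

variable {A B C : WG G}

open Classical in
/-- The map `Z(A)^H → Z(B)^H` induced by a based `G`-map `φ`. It is defined for all functions `φ`,
with the constant function as a junk value, so that families of maps need no bundling. -/
noncomputable def fixedMap (φ : A.toBased → B.toBased) (x : Z.Fixed H A) : Z.Fixed H B :=
  if h : IsBasedGMap G A.toBased.pt B.toBased.pt φ then
    fixedPointMap (Z.map ⟨⟨φ, h.continuous⟩, h.map_pt⟩).1
      (Z.map_equivariant ⟨⟨φ, h.continuous⟩, h.map_pt⟩ h.equivariant) H x
  else Z.fixedPt H B

variable {Z H}

theorem fixedMap_coe {φ : A.toBased → B.toBased} (h : IsBasedGMap G A.toBased.pt B.toBased.pt φ)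
    (x : Z.Fixed H A) :
    (Z.fixedMap H φ x : Z.obj B) = (Z.map ⟨⟨φ, h.continuous⟩, h.map_pt⟩).1 x := by
  rw [fixedMap, dif_pos h]
  rfl

theorem fixedMap_comp {φ : A.toBased → B.toBased} {ψ : B.toBased → C.toBased}
    (hψ : IsBasedGMap G B.toBased.pt C.toBased.pt ψ)
    (hφ : IsBasedGMap G A.toBased.pt B.toBased.pt φ) (x : Z.Fixed H A) :
    Z.fixedMap H ψ (Z.fixedMap H φ x) = Z.fixedMap H (fun a => ψ (φ a)) x := by
  refine Subtype.ext ?_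
  rw [fixedMap_coe hψ, fixedMap_coe hφ, fixedMap_coe (hψ.comp hφ)]
  have := Z.map_comp (⟨⟨ψ, hψ.continuous⟩, hψ.map_pt⟩ : BasedGSpace.Hom B.toBased C.toBased)
    (⟨⟨φ, hφ.continuous⟩, hφ.map_pt⟩ : BasedGSpace.Hom A.toBased B.toBased)
  exact (DFunLike.congr_fun (congrArg Subtype.val this) (x : Z.obj A)).symm

theorem fixedMap_id (x : Z.Fixed H A) : Z.fixedMap H (fun a : A.toBased => a) x = x := by
  have h : IsBasedGMap G A.toBased.pt A.toBased.pt fun a : A.toBased => a :=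
    ⟨continuous_id, rfl, fun _ _ => rfl⟩
  refine Subtype.ext ?_
  rw [fixedMap_coe h]
  exact DFunLike.congr_fun (congrArg Subtype.val (Z.map_id A)) (x : Z.obj A)

theorem fixedMap_pt {φ : A.toBased → B.toBased}
    (h : IsBasedGMap G A.toBased.pt B.toBased.pt φ) :
    Z.fixedMap H φ (Z.fixedPt H A) = Z.fixedPt H B :=
  Subtype.ext ((fixedMap_coe h _).trans (Z.map _).2)

theorem isBasedGMap_const : IsBasedGMap G A.toBased.pt B.toBased.pt fun _ => B.toBased.pt :=
  ⟨continuous_const, rfl, fun g _ => (B.toBased.smul_pt g).symm⟩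

theorem fixedMap_const (x : Z.Fixed H A) :
    Z.fixedMap H (fun _ : A.toBased => B.toBased.pt) x = Z.fixedPt H B := by
  refine Subtype.ext ?_
  rw [fixedMap_coe isBasedGMap_const]
  exact Z.map_zero A B x

theorem fixedMap_eq_pt {φ : A.toBased → B.toBased} (h : ∀ a, φ a = B.toBased.pt)
    (x : Z.Fixed H A) : Z.fixedMap H φ x = Z.fixedPt H B := by
  rw [show φ = fun _ => B.toBased.pt from funext h, fixedMap_const]

/-- The functor is continuous on families of based `G`-maps with a compact parameter space. -/
theorem continuous_fixedMap_family {K T : Type*} [TopologicalSpace K] [CompactSpace K] [T2Space K]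
    [TopologicalSpace T] (φ : K → A.toBased → B.toBased)
    (hc : Continuous fun p : K × A.toBased => φ p.1 p.2)
    (hφ : ∀ k, IsBasedGMap G A.toBased.pt B.toBased.pt (φ k)) {κ : T → K} (hκ : Continuous κ)
    {x : T → Z.Fixed H A} (hx : Continuous x) :
    Continuous fun t => Z.fixedMap H (φ (κ t)) (x t) := by
  have h1 := Z.continuous_family
    (fun k => (⟨⟨φ k, (hφ k).continuous⟩, (hφ k).map_pt⟩ : BasedGSpace.Hom A.toBased B.toBased))
    ((ContinuousMap.curry ⟨_, hc⟩).continuous.subtype_mk _)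
  refine continuous_induced_rng.2 ?_
  refine (h1.comp (hκ.prodMk (continuous_subtype_val.comp hx))).congr fun t => ?_
  exact (fixedMap_coe (hφ (κ t)) (x t)).symm

theorem continuous_fixedMap {φ : A.toBased → B.toBased}
    (hφ : IsBasedGMap G A.toBased.pt B.toBased.pt φ) : Continuous (Z.fixedMap H φ) :=
  continuous_fixedMap_family (K := Unit) (fun _ => φ) (hφ.continuous.comp continuous_snd)
    (fun _ => hφ) (κ := fun _ => ()) continuous_const continuous_id

/-- The map `Z(A)^H → Z(B)^H` induced by a based `G`-map, as a continuous map. -/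
noncomputable def fixedHom {φ : A.toBased → B.toBased}
    (hφ : IsBasedGMap G A.toBased.pt B.toBased.pt φ) : C(Z.Fixed H A, Z.Fixed H B) :=
  ⟨Z.fixedMap H φ, continuous_fixedMap hφ⟩

/-- Homotopies through based `G`-maps induce homotopies. -/
theorem homotopic_fixedMap {φ₀ φ₁ : A.toBased → B.toBased}
    (h : BasedGHomotopic G A.toBased.pt B.toBased.pt φ₀ φ₁)
    (h0 : IsBasedGMap G A.toBased.pt B.toBased.pt φ₀)
    (h1 : IsBasedGMap G A.toBased.pt B.toBased.pt φ₁) :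
    (fixedHom (Z := Z) (H := H) h0).Homotopic (fixedHom h1) := by
  obtain ⟨F, f0, f1, fe, fp⟩ := h
  refine ⟨{ toFun := fun p => Z.fixedMap H (fun a => F (p.1, a)) p.2
            continuous_toFun := ?_
            map_zero_left := fun x => ?_
            map_one_left := fun x => ?_ }⟩
  · exact continuous_fixedMap_family (fun t a => F (t, a)) F.continuous
      (fun t => ⟨by fun_prop, fp t, fe t⟩) continuous_fst continuous_snd
  · exact congrArg (fun φ => Z.fixedMap H φ x) (funext f0)
  · exact congrArg (fun φ => Z.fixedMap H φ x) (funext f1)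

end WGSpace

end FixedPoints

/-! ### Suspensions and loops -/

section Suspension

variable {G : Type u} [Group G] [TopologicalSpace G] [CompactSpace G] [T2Space G]

/-- The map `Σφ : ΣA → ΣB` induced by a based map. -/
def WG.suspMap {A B : WG G} (φ : A.toBased → B.toBased) (h : φ A.toBased.pt = B.toBased.pt) :
    A.susp.toBased → B.susp.toBased :=
  Smash.lift (fun t a => Smash.mk t (φ a)) (Smash.pt 1 B.toBased) (fun a => Smash.mk_infty _)
    (fun t => by rw [h]; exact Smash.mk_pt t)

theorem WG.continuous_suspMap_family {A B : WG G} {K : Type*} [TopologicalSpace K]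
    [LocallyCompactSpace K] (φ : K → A.toBased → B.toBased)
    (hφ : Continuous fun p : K × A.toBased => φ p.1 p.2)
    (h : ∀ k, φ k A.toBased.pt = B.toBased.pt) :
    Continuous fun p : K × A.susp.toBased => WG.suspMap (φ p.1) (h p.1) p.2 := by
  refine Smash.continuous_of_prod (Y := A.toBased) _ ?_
  exact Smash.continuous_mk.comp
    ((by fun_prop : Continuous fun p : K × (Sphere 1 × A.toBased) => p.2.1).prodMk
      (hφ.comp (by fun_prop : Continuous fun p : K × (Sphere 1 × A.toBased) => (p.1, p.2.2))))

theorem WG.isBasedGMap_suspMap {A B : WG G} {φ : A.toBased → B.toBased}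
    (h : IsBasedGMap G A.toBased.pt B.toBased.pt φ) :
    IsBasedGMap G A.susp.toBased.pt B.susp.toBased.pt (WG.suspMap φ h.map_pt) where
  continuous := (WG.continuous_suspMap_family (K := Unit) (fun _ => φ)
    (h.continuous.comp continuous_snd) (fun _ => h.map_pt)).comp
    (continuous_const.prodMk continuous_id : Continuous fun x : A.susp.toBased => ((), x))
  map_pt := Smash.mk_infty _
  equivariant g := Smash.ind (Y := A.toBased) fun t a =>
    congrArg (Smash.mk t) (h.equivariant g a)

/-- The map `A → ΣA`, `a ↦ t ∧ a`, for a point `t` of the unit interval. -/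
noncomputable def WG.suspIncl (A : WG G) (t : I) (a : A.toBased) : A.susp.toBased :=
  Smash.mk (Y := A.toBased) (intervalCollapse t) a

theorem WG.continuous_suspIncl (A : WG G) :
    Continuous fun p : I × A.toBased => A.suspIncl p.1 p.2 :=
  Smash.continuous_mk.comp (by fun_prop :
    Continuous fun p : I × A.toBased => (intervalCollapse p.1, p.2))

theorem WG.suspIncl_zero (A : WG G) (a : A.toBased) : A.suspIncl 0 a = A.susp.toBased.pt := by
  rw [WG.suspIncl, intervalCollapse_zero]; exact Smash.mk_infty a

theorem WG.suspIncl_one (A : WG G) (a : A.toBased) : A.suspIncl 1 a = A.susp.toBased.pt := by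
  rw [WG.suspIncl, intervalCollapse_one]; exact Smash.mk_infty a

theorem WG.suspIncl_pt (A : WG G) (t : I) : A.suspIncl t A.toBased.pt = A.susp.toBased.pt :=
  Smash.mk_pt _

theorem WG.isBasedGMap_suspIncl (A : WG G) (t : I) :
    IsBasedGMap G A.toBased.pt A.susp.toBased.pt (A.suspIncl t) where
  continuous := A.continuous_suspIncl.comp (by fun_prop : Continuous fun a => (t, a))
  map_pt := A.suspIncl_pt t
  equivariant _ _ := rfl

theorem WG.suspMap_suspIncl {A B : WG G} (φ : A.toBased → B.toBased)
    (h : φ A.toBased.pt = B.toBased.pt) (t : I) (a : A.toBased) :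
    WG.suspMap φ h (A.suspIncl t a) = B.suspIncl t (φ a) := rfl

namespace WGSpace

variable (Z : WGSpace G) (H : Subgroup G)

/-- The loop space of `Z(A)^H`, with loops parametrized by the unit interval. -/
abbrev FixedLoops (A : WG G) : Type u := Path (Z.fixedPt H A) (Z.fixedPt H A)

variable {A B : WG G}

/-- A continuous family of functions on the interval that take the endpoints to the base point is
a continuous family of loops. -/
def loopFamily {Z : WGSpace G} {H : Subgroup G} {K : Type*} [TopologicalSpace K]
    (w : K → I → Z.Fixed H A)
    (hw : Continuous fun p : K × I => w p.1 p.2) (h0 : ∀ k, w k 0 = Z.fixedPt H A)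
    (h1 : ∀ k, w k 1 = Z.fixedPt H A) : C(K, Z.FixedLoops H A) where
  toFun k := { toFun := w k
               continuous_toFun := hw.comp (by fun_prop : Continuous fun s : I => (k, s))
               source' := h0 k
               target' := h1 k }
  continuous_toFun := Path.continuous_uncurry_iff.1 hw

/-- The map of loop spaces induced by a based `G`-map. -/
noncomputable def loopMap {φ : A.toBased → B.toBased}
    (h : IsBasedGMap G A.toBased.pt B.toBased.pt φ) : C(Z.FixedLoops H A, Z.FixedLoops H B) :=
  loopFamily (fun γ s => Z.fixedMap H φ (γ s))
    ((continuous_fixedMap h).comp (by fun_prop))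
    (fun γ => by rw [γ.source, fixedMap_pt h]) (fun γ => by rw [γ.target, fixedMap_pt h])

/-- The adjoint structure map `Z(A)^H → Ω(Z(ΣA)^H)`. -/
noncomputable def fixedStructureMap (A : WG G) : C(Z.Fixed H A, Z.FixedLoops H A.susp) :=
  loopFamily (fun x s => Z.fixedMap H (A.suspIncl s) x)
    (continuous_fixedMap_family A.suspIncl A.continuous_suspIncl A.isBasedGMap_suspIncl
      continuous_snd continuous_fst)
    (fun x => fixedMap_eq_pt A.suspIncl_zero x) (fun x => fixedMap_eq_pt A.suspIncl_one x)

end WGSpace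

end Suspension

/-- The point of the unit interval nearest to a real number. -/
noncomputable def clampI (r : ℝ) : I := projIcc 0 1 zero_le_one r

@[fun_prop]
theorem continuous_clampI : Continuous clampI := continuous_projIcc (h := zero_le_one)

theorem clampI_of_le {r : ℝ} (h : r ≤ 0) : clampI r = 0 := projIcc_of_le_left _ h

theorem clampI_of_ge {r : ℝ} (h : 1 ≤ r) : clampI r = 1 := projIcc_of_right_le _ h

theorem clampI_coe (s : I) : clampI s = s := projIcc_val _ s

theorem coe_clampI {r : ℝ} (h0 : 0 ≤ r) (h1 : r ≤ 1) : (clampI r : ℝ) = r :=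
  congrArg Subtype.val (projIcc_of_mem zero_le_one ⟨h0, h1⟩)

/-! ### Maps out of the double mapping cylinder -/

namespace GSquare

section Cylinder

variable {G : Type u} [Group G] [TopologicalSpace G] {A B C D : BasedGSpace G}
  (s : GSquare A B C D)

theorem isBasedGMap_f : IsBasedGMap G A.pt B.pt s.f.1 := ⟨s.f.1.continuous, s.f.2, s.f_smul⟩

theorem isBasedGMap_g : IsBasedGMap G A.pt C.pt s.g.1 := ⟨s.g.1.continuous, s.g.2, s.g_smul⟩

theorem isBasedGMap_h : IsBasedGMap G B.pt D.pt s.h.1 := ⟨s.h.1.continuous, s.h.2, s.h_smul⟩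

theorem isBasedGMap_k : IsBasedGMap G C.pt D.pt s.k.1 := ⟨s.k.1.continuous, s.k.2, s.k_smul⟩

theorem isBasedGMap_η (t : I) : IsBasedGMap G A.pt D.pt fun a => s.η (t, a) :=
  ⟨by fun_prop, s.η_pt t, s.η_smul t⟩

/-- The inclusion of `B` in the double mapping cylinder. -/
def inl (b : B) : s.Cylinder := Quot.mk _ (.inl b)

/-- The inclusion of `C` in the double mapping cylinder. -/
def inr (c : C) : s.Cylinder := Quot.mk _ (.inr (.inr c))

/-- The point `[t, a]` of the double mapping cylinder. -/
def mid (t : I) (a : A) : s.Cylinder := Quot.mk _ (.inr (.inl (t, a)))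

theorem mid_zero (a : A) : s.mid 0 a = s.inl (s.f.1 a) := Quot.sound (.left a)

theorem mid_one (a : A) : s.mid 1 a = s.inr (s.g.1 a) := Quot.sound (.right a)

theorem mid_pt (t : I) : s.mid t A.pt = s.cylinderPt := Quot.sound (.base t)

theorem inr_pt : s.inr C.pt = s.cylinderPt := by
  rw [← s.g.2, ← mid_one, mid_pt]

theorem cylinder_ind {p : s.Cylinder → Prop} (hB : ∀ b, p (s.inl b)) (hA : ∀ t a, p (s.mid t a))
    (hC : ∀ c, p (s.inr c)) (x : s.Cylinder) : p x := by
  induction x using Quot.ind with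
  | mk x => rcases x with b | ⟨t, a⟩ | c
            exacts [hB b, hA t a, hC c]

theorem isBasedGMap_inl : IsBasedGMap G B.pt s.cylinderPt s.inl :=
  ⟨continuous_quot_mk.comp continuous_inl, rfl, fun _ _ => rfl⟩

theorem isBasedGMap_inr : IsBasedGMap G C.pt s.cylinderPt s.inr :=
  ⟨continuous_quot_mk.comp (continuous_inr.comp continuous_inr), s.inr_pt, fun _ _ => rfl⟩

theorem continuous_mid : Continuous fun p : I × A => s.mid p.1 p.2 :=
  continuous_quot_mk.comp (continuous_inr.comp continuous_inl)

theorem isBasedGMap_mid (t : I) : IsBasedGMap G A.pt s.cylinderPt (s.mid t) :=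
  ⟨s.continuous_mid.comp (by fun_prop : Continuous fun a => (t, a)), s.mid_pt t, fun _ _ => rfl⟩

/-- A map out of `K × M`, with `K` locally compact and `M` the double mapping cylinder, is
continuous if its restrictions to the three parts are. -/
theorem continuous_of_prod {K W : Type*} [TopologicalSpace K] [LocallyCompactSpace K]
    [TopologicalSpace W] (φ : K × s.Cylinder → W)
    (hB : Continuous fun p : K × B => φ (p.1, s.inl p.2))
    (hA : Continuous fun p : K × (I × A) => φ (p.1, s.mid p.2.1 p.2.2))
    (hC : Continuous fun p : K × C => φ (p.1, s.inr p.2)) : Continuous φ := by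
  have hc : ∀ x : s.Cylinder, Continuous fun k : K => φ (k, x) :=
    s.cylinder_ind (fun b => hB.comp (by fun_prop : Continuous fun k : K => (k, b)))
      (fun t a => hA.comp (by fun_prop : Continuous fun k : K => (k, (t, a))))
      (fun c => hC.comp (by fun_prop : Continuous fun k : K => (k, c)))
  have hF : Continuous fun x : s.Cylinder => (⟨fun k => φ (k, x), hc x⟩ : C(K, W)) := by
    refine (isQuotientMap_quot_mk : IsQuotientMap (Quot.mk s.CylinderRel)).continuous_iff.2 ?_
    rw [continuous_sum_dom, continuous_sum_dom]
    exact ⟨(ContinuousMap.curry ⟨_, hB.comp continuous_swap⟩).continuous,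
      (ContinuousMap.curry ⟨_, hA.comp continuous_swap⟩).continuous,
      (ContinuousMap.curry ⟨_, hC.comp continuous_swap⟩).continuous⟩
  exact (ContinuousMap.continuous_uncurry_of_continuous ⟨_, hF⟩).comp continuous_swap

/-- Compatible maps on the three parts of the double mapping cylinder. -/
structure CylinderCompat {X : Type*} (φB : B → X) (φA : I → A → X) (φC : C → X) : Prop where
  left : ∀ a, φA 0 a = φB (s.f.1 a)
  right : ∀ a, φA 1 a = φC (s.g.1 a)
  base : ∀ t, φA t A.pt = φB B.pt

/-- The map out of the double mapping cylinder given by maps on its three parts. It is defined on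
representatives, and has a meaning if the three maps are compatible. -/
noncomputable def desc {X : Type*} (φB : B → X) (φA : I → A → X) (φC : C → X) (x : s.Cylinder) :
    X :=
  Sum.elim φB (Sum.elim (fun p : I × A => φA p.1 p.2) φC) (Quot.out x)

variable {s}

theorem CylinderCompat.desc_mk {X : Type*} {φB : B → X} {φA : I → A → X} {φC : C → X}
    (h : s.CylinderCompat φB φA φC) (z : B ⊕ (I × A) ⊕ C) :
    s.desc φB φA φC (Quot.mk _ z) =
      Sum.elim φB (Sum.elim (fun p : I × A => φA p.1 p.2) φC) z := by
  let F : s.Cylinder → X := Quot.lift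
    (Sum.elim φB (Sum.elim (fun p : I × A => φA p.1 p.2) φC)) (by
      rintro _ _ (a | a | t)
      exacts [h.left a, h.right a, h.base t])
  have : ∀ x : s.Cylinder, s.desc φB φA φC x = F x := fun x =>
    congrArg F (Quot.out_eq x)
  exact this _

theorem CylinderCompat.desc_inl {X : Type*} {φB : B → X} {φA : I → A → X} {φC : C → X}
    (h : s.CylinderCompat φB φA φC) (b : B) : s.desc φB φA φC (s.inl b) = φB b := h.desc_mk _

theorem CylinderCompat.desc_mid {X : Type*} {φB : B → X} {φA : I → A → X} {φC : C → X}
    (h : s.CylinderCompat φB φA φC) (t : I) (a : A) :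
    s.desc φB φA φC (s.mid t a) = φA t a := h.desc_mk _

theorem CylinderCompat.desc_inr {X : Type*} {φB : B → X} {φA : I → A → X} {φC : C → X}
    (h : s.CylinderCompat φB φA φC) (c : C) : s.desc φB φA φC (s.inr c) = φC c := h.desc_mk _

theorem continuous_desc_family {K X : Type*} [TopologicalSpace K] [LocallyCompactSpace K]
    [TopologicalSpace X] {φB : K → B → X} {φA : K → I → A → X} {φC : K → C → X}
    (h : ∀ k, s.CylinderCompat (φB k) (φA k) (φC k))
    (hB : Continuous fun p : K × B => φB p.1 p.2)
    (hA : Continuous fun p : K × (I × A) => φA p.1 p.2.1 p.2.2)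
    (hC : Continuous fun p : K × C => φC p.1 p.2) :
    Continuous fun p : K × s.Cylinder => s.desc (φB p.1) (φA p.1) (φC p.1) p.2 :=
  s.continuous_of_prod _ (hB.congr fun p => ((h p.1).desc_inl p.2).symm)
    (hA.congr fun p => ((h p.1).desc_mid p.2.1 p.2.2).symm)
    (hC.congr fun p => ((h p.1).desc_inr p.2).symm)

theorem isBasedGMap_desc {X : Type*} [TopologicalSpace X] [SMul G X] {x₀ : X} {φB : B → X}
    {φA : I → A → X} {φC : C → X} (h : s.CylinderCompat φB φA φC)
    (hB : IsBasedGMap G B.pt x₀ φB) (hA : Continuous fun p : I × A => φA p.1 p.2)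
    (hA' : ∀ t, IsEquivariant G (φA t)) (hC : IsBasedGMap G C.pt x₀ φC) :
    IsBasedGMap G s.cylinderPt x₀ (s.desc φB φA φC) where
  continuous := (continuous_desc_family (K := Unit) (fun _ => h)
    (hB.continuous.comp continuous_snd) (hA.comp continuous_snd)
    (hC.continuous.comp continuous_snd)).comp
      (by fun_prop : Continuous fun x : s.Cylinder => ((), x))
  map_pt := (h.desc_inl B.pt).trans hB.map_pt
  equivariant g := s.cylinder_ind
    (fun b => (h.desc_inl (g • b)).trans ((hB.equivariant g b).trans
      (congrArg (g • ·) (h.desc_inl b).symm)))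
    (fun t a => (h.desc_mid t (g • a)).trans ((hA' t g a).trans
      (congrArg (g • ·) (h.desc_mid t a).symm)))
    (fun c => (h.desc_inr (g • c)).trans ((hC.equivariant g c).trans
      (congrArg (g • ·) (h.desc_inr c).symm)))

theorem isBasedGMap_cylinderMap : IsBasedGMap G s.cylinderPt D.pt s.cylinderMap where
  continuous := s.cylinderMap.continuous
  map_pt := s.h.2
  equivariant g := s.cylinder_ind (s.h_smul g) (fun t => s.η_smul t g) (s.k_smul g)

variable (s)

/-- A based `G`-homotopy inverse of the map from the double mapping cylinder `M` to `D`, with the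
homotopy on `M`. No coherence with the homotopy on `D` is asked for. -/
structure CylinderInverse where
  inv : C(D, s.Cylinder)
  isBasedGMap_inv : IsBasedGMap G D.pt s.cylinderPt inv
  homotopy : C(I × s.Cylinder, s.Cylinder)
  homotopy_zero : ∀ x, homotopy (0, x) = inv (s.cylinderMap x)
  homotopy_one : ∀ x, homotopy (1, x) = x
  isBasedGMap_homotopy : ∀ t, IsBasedGMap G s.cylinderPt s.cylinderPt fun x => homotopy (t, x)
  right_inv : BasedGHomotopic G D.pt D.pt (s.cylinderMap ∘ inv) id

variable {s}

theorem IsHomotopyPushout.nonempty_cylinderInverse (h : s.IsHomotopyPushout) :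
    Nonempty s.CylinderInverse := by
  obtain ⟨-, -, e, h1, h2, ⟨F, f0, f1, f2, f3⟩, h4⟩ := h
  exact ⟨{
    inv := e
    isBasedGMap_inv := ⟨e.continuous, h2, h1⟩
    homotopy := F
    homotopy_zero := f0
    homotopy_one := f1
    isBasedGMap_homotopy := fun t => ⟨by fun_prop, f3 t, f2 t⟩
    right_inv := h4 }⟩

end Cylinder

end GSquare

/-! ### The homotopy pullback seen from the double mapping cylinder -/

namespace WGSpace

section CylinderPath

variable {G : Type u} [Group G] [TopologicalSpace G] (Z : WGSpace G) (H : Subgroup G)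
  {A B C D X X' : WG G} (s : GSquare A.toBased B.toBased C.toBased D.toBased)

/-- The homotopy pullback of `Z(B)^H → Z(D)^H ← Z(C)^H`. -/
abbrev FixedPullback : Type u :=
  HomotopyPullbackSpace (fixedHom (Z := Z) (H := H) s.isBasedGMap_h) (fixedHom s.isBasedGMap_k)

variable {Z H s} (c : s.CylinderInverse)

/-- A point `(b, γ, c)` of the homotopy pullback stands for a path in "`Z(M)`", where `M` is the
double mapping cylinder (which is not an object of `𝒲_G`): it goes from `b` to `e(γ(0))`, along
`e ∘ γ`, and from `e(γ(1))` to `c`, where `e : D → M` is the homotopy inverse. A based `G`-map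
`Φ : M → X` takes it to a path in `Z(X)^H`, which is defined here. -/
noncomputable def cylinderPath (Φ : s.Cylinder → X.toBased) (x : Z.FixedPullback H s) (v : I) :
    Z.Fixed H X :=
  if (v : ℝ) ≤ 1 / 3 then
    Z.fixedMap H (fun b => Φ (c.homotopy (clampI (1 - 3 * v), s.inl b)))
      (HomotopyPullbackSpace.fst _ _ x)
  else if (v : ℝ) ≤ 2 / 3 then
    Z.fixedMap H (fun d => Φ (c.inv d)) (HomotopyPullbackSpace.path _ _ x (clampI (3 * v - 1)))
  else
    Z.fixedMap H (fun y => Φ (c.homotopy (clampI (3 * v - 2), s.inr y)))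
      (HomotopyPullbackSpace.snd _ _ x)

section Formulas

variable {Φ : s.Cylinder → X.toBased} (x : Z.FixedPullback H s)

theorem cylinderPath_left {v : I} (hv : (v : ℝ) ≤ 1 / 3) : cylinderPath c Φ x v =
    Z.fixedMap H (fun b => Φ (c.homotopy (clampI (1 - 3 * v), s.inl b)))
      (HomotopyPullbackSpace.fst _ _ x) := if_pos hv

theorem fixedMap_path_zero (hΦ : IsBasedGMap G s.cylinderPt X.toBased.pt Φ) :
    Z.fixedMap H (fun d => Φ (c.inv d)) (HomotopyPullbackSpace.path _ _ x 0) =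
      Z.fixedMap H (fun b => Φ (c.homotopy (0, s.inl b))) (HomotopyPullbackSpace.fst _ _ x) := by
  rw [HomotopyPullbackSpace.path_zero]
  refine (fixedMap_comp (hΦ.comp c.isBasedGMap_inv) s.isBasedGMap_h _).trans ?_
  refine congrArg (fun φ => Z.fixedMap H φ _) (funext fun b => ?_)
  rw [c.homotopy_zero]
  rfl

theorem fixedMap_path_one (hΦ : IsBasedGMap G s.cylinderPt X.toBased.pt Φ) :
    Z.fixedMap H (fun d => Φ (c.inv d)) (HomotopyPullbackSpace.path _ _ x 1) =
      Z.fixedMap H (fun y => Φ (c.homotopy (0, s.inr y))) (HomotopyPullbackSpace.snd _ _ x) := by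
  rw [HomotopyPullbackSpace.path_one]
  refine (fixedMap_comp (hΦ.comp c.isBasedGMap_inv) s.isBasedGMap_k _).trans ?_
  refine congrArg (fun φ => Z.fixedMap H φ _) (funext fun b => ?_)
  rw [c.homotopy_zero]
  rfl

theorem cylinderPath_mid (hΦ : IsBasedGMap G s.cylinderPt X.toBased.pt Φ) {v : I}
    (h1 : 1 / 3 ≤ (v : ℝ)) (h2 : (v : ℝ) ≤ 2 / 3) : cylinderPath c Φ x v =
    Z.fixedMap H (fun d => Φ (c.inv d))
      (HomotopyPullbackSpace.path _ _ x (clampI (3 * v - 1))) := by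
  rcases h1.eq_or_lt with h | h
  · rw [cylinderPath_left c x h.ge, ← h]
    rw [clampI_of_le (r := 1 - 3 * (1 / 3)) (by norm_num),
      clampI_of_le (r := 3 * (1 / 3) - 1) (by norm_num), fixedMap_path_zero c x hΦ]
  · rw [cylinderPath, if_neg h.not_ge, if_pos h2]

theorem cylinderPath_right (hΦ : IsBasedGMap G s.cylinderPt X.toBased.pt Φ) {v : I}
    (hv : 2 / 3 ≤ (v : ℝ)) : cylinderPath c Φ x v =
    Z.fixedMap H (fun y => Φ (c.homotopy (clampI (3 * v - 2), s.inr y)))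
      (HomotopyPullbackSpace.snd _ _ x) := by
  rcases hv.eq_or_lt with h | h
  · rw [cylinderPath_mid c x hΦ (by linarith) h.ge, ← h]
    rw [clampI_of_le (r := 3 * (2 / 3) - 2) (by norm_num),
      clampI_of_ge (r := 3 * (2 / 3) - 1) (by norm_num), fixedMap_path_one c x hΦ]
  · rw [cylinderPath, if_neg (by linarith), if_neg h.not_ge]

theorem cylinderPath_zero : cylinderPath c Φ x 0 =
    Z.fixedMap H (fun b => Φ (s.inl b)) (HomotopyPullbackSpace.fst _ _ x) := by
  rw [cylinderPath_left c x (by norm_num), clampI_of_ge (by norm_num)]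
  simp only [c.homotopy_one]

theorem cylinderPath_one (hΦ : IsBasedGMap G s.cylinderPt X.toBased.pt Φ) :
    cylinderPath c Φ x 1 =
      Z.fixedMap H (fun y => Φ (s.inr y)) (HomotopyPullbackSpace.snd _ _ x) := by
  rw [cylinderPath_right c x hΦ (by norm_num), clampI_of_ge (by norm_num)]
  simp only [c.homotopy_one]

theorem isBasedGMap_comp_homotopy_inl (hΦ : IsBasedGMap G s.cylinderPt X.toBased.pt Φ) (t : I) :
    IsBasedGMap G B.toBased.pt X.toBased.pt fun b => Φ (c.homotopy (t, s.inl b)) :=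
  hΦ.comp ((c.isBasedGMap_homotopy t).comp s.isBasedGMap_inl)

theorem isBasedGMap_comp_homotopy_inr (hΦ : IsBasedGMap G s.cylinderPt X.toBased.pt Φ) (t : I) :
    IsBasedGMap G C.toBased.pt X.toBased.pt fun b => Φ (c.homotopy (t, s.inr b)) :=
  hΦ.comp ((c.isBasedGMap_homotopy t).comp s.isBasedGMap_inr)

theorem fixedMap_cylinderPath {ψ : X.toBased → X'.toBased}
    (hψ : IsBasedGMap G X.toBased.pt X'.toBased.pt ψ)
    (hΦ : IsBasedGMap G s.cylinderPt X.toBased.pt Φ) (v : I) :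
    Z.fixedMap H ψ (cylinderPath c Φ x v) = cylinderPath c (fun y => ψ (Φ y)) x v := by
  unfold cylinderPath
  split_ifs
  · exact fixedMap_comp hψ (isBasedGMap_comp_homotopy_inl c hΦ _) _
  · exact fixedMap_comp hψ (hΦ.comp c.isBasedGMap_inv) _
  · exact fixedMap_comp hψ (isBasedGMap_comp_homotopy_inr c hΦ _) _

theorem cylinderPath_eq_pt (h : ∀ y, Φ y = X.toBased.pt) (v : I) :
    cylinderPath c Φ x v = Z.fixedPt H X := by
  unfold cylinderPath
  split_ifs <;> exact fixedMap_eq_pt (fun _ => h _) _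

end Formulas

theorem continuous_cylinderPath_family {K T : Type*} [TopologicalSpace K] [CompactSpace K]
    [T2Space K] [TopologicalSpace T] (Φ : K → s.Cylinder → X.toBased)
    (hc : Continuous fun p : K × s.Cylinder => Φ p.1 p.2)
    (hΦ : ∀ k, IsBasedGMap G s.cylinderPt X.toBased.pt (Φ k)) {κ : T → K} (hκ : Continuous κ)
    {x : T → Z.FixedPullback H s} (hx : Continuous x) {v : T → I} (hv : Continuous v) :
    Continuous fun t => cylinderPath c (Φ (κ t)) (x t) (v t) := by
  have h1 : Continuous fun t => Z.fixedMap H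
      (fun b => Φ (κ t) (c.homotopy (clampI (1 - 3 * v t), s.inl b)))
      (HomotopyPullbackSpace.fst _ _ (x t)) :=
    continuous_fixedMap_family (K := K × I) (fun k b => Φ k.1 (c.homotopy (k.2, s.inl b)))
      (hc.comp (Continuous.prodMk (by fun_prop) (c.homotopy.continuous.comp
        (Continuous.prodMk (by fun_prop) (s.isBasedGMap_inl.continuous.comp continuous_snd)))))
      (fun k => isBasedGMap_comp_homotopy_inl c (hΦ k.1) k.2)
      (κ := fun t => (κ t, clampI (1 - 3 * v t))) (by fun_prop) (by fun_prop)
  have h2 : Continuous fun t => Z.fixedMap H (fun d => Φ (κ t) (c.inv d))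
      (HomotopyPullbackSpace.path _ _ (x t) (clampI (3 * v t - 1))) :=
    continuous_fixedMap_family (fun k d => Φ k (c.inv d))
      (hc.comp (by fun_prop : Continuous fun p : K × D.toBased => (p.1, c.inv p.2)))
      (fun k => (hΦ k).comp c.isBasedGMap_inv) hκ
      (HomotopyPullbackSpace.continuous_path_eval hx (by fun_prop))
  have h3 : Continuous fun t => Z.fixedMap H
      (fun y => Φ (κ t) (c.homotopy (clampI (3 * v t - 2), s.inr y)))
      (HomotopyPullbackSpace.snd _ _ (x t)) :=
    continuous_fixedMap_family (K := K × I) (fun k b => Φ k.1 (c.homotopy (k.2, s.inr b)))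
      (hc.comp (Continuous.prodMk (by fun_prop) (c.homotopy.continuous.comp
        (Continuous.prodMk (by fun_prop) (s.isBasedGMap_inr.continuous.comp continuous_snd)))))
      (fun k => isBasedGMap_comp_homotopy_inr c (hΦ k.1) k.2)
      (κ := fun t => (κ t, clampI (3 * v t - 2))) (by fun_prop) (by fun_prop)
  refine Continuous.if_le h1 (Continuous.if_le h2 h3 (by fun_prop) continuous_const ?_)
    (by fun_prop) continuous_const ?_
  · intro t ht
    rw [ht, clampI_of_le (r := 3 * (2 / 3) - 2) (by norm_num),
      clampI_of_ge (r := 3 * (2 / 3) - 1) (by norm_num), fixedMap_path_one c _ (hΦ _)]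
  · intro t ht
    rw [ht, if_pos (by norm_num), clampI_of_le (r := 1 - 3 * (1 / 3)) (by norm_num),
      clampI_of_le (r := 3 * (1 / 3) - 1) (by norm_num), fixedMap_path_zero c _ (hΦ _)]

theorem continuous_cylinderPath {T : Type*} [TopologicalSpace T] {Φ : s.Cylinder → X.toBased}
    (hΦ : IsBasedGMap G s.cylinderPt X.toBased.pt Φ)
    {x : T → Z.FixedPullback H s} (hx : Continuous x) {v : T → I} (hv : Continuous v) :
    Continuous fun t => cylinderPath c Φ (x t) (v t) :=
  continuous_cylinderPath_family c (K := Unit) (fun _ => Φ) (hΦ.continuous.comp continuous_snd)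
    (fun _ => hΦ) (κ := fun _ => ()) continuous_const hx hv

end CylinderPath

end WGSpace

namespace WGSpace

section Comparison

variable {G : Type u} [Group G] [TopologicalSpace G] {Z : WGSpace G} {H : Subgroup G}
  {A B C D X : WG G} {s : GSquare A.toBased B.toBased C.toBased D.toBased}
  (c : s.CylinderInverse)

/-! ### The self-map of the homotopy pullback given by the homotopy inverse -/

/-- The self-map of the homotopy pullback that takes the path of a point to its image under
`M → D`, regarded as a path in "`Z(M)`". The constant pieces at both ends are there to match the
homotopy below. -/
noncomputable def stretch : C(Z.FixedPullback H s, Z.FixedPullback H s) :=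
  HomotopyPullbackSpace.lift (HomotopyPullbackSpace.fst _ _)
    ⟨fun z => cylinderPath c s.cylinderMap z.1 (clampI (3 * z.2 - 1)),
      continuous_cylinderPath c GSquare.isBasedGMap_cylinderMap continuous_fst (by fun_prop)⟩
    (HomotopyPullbackSpace.snd _ _)
    (fun x => by
      change cylinderPath c s.cylinderMap x (clampI (3 * ((0 : I) : ℝ) - 1)) = _
      rw [clampI_of_le (by norm_num), cylinderPath_zero]
      rfl)
    (fun x => by
      change cylinderPath c s.cylinderMap x (clampI (3 * ((1 : I) : ℝ) - 1)) = _
      rw [clampI_of_ge (by norm_num), cylinderPath_one c x GSquare.isBasedGMap_cylinderMap]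
      rfl)

theorem isWeakHomotopyEquiv_prodMk {Y : Type*} [TopologicalSpace Y] (t : I) :
    IsWeakHomotopyEquiv (⟨fun y => (t, y), by fun_prop⟩ : C(Y, I × Y)) := by
  refine isWeakHomotopyEquiv_of_homotopyInverse (e := ⟨Prod.snd, continuous_snd⟩)
    (ContinuousMap.Homotopic.refl _) ⟨?_⟩
  exact
    { toFun := fun p => (MappingPathSpace.slide t p.2.1 p.1, p.2.2)
      continuous_toFun := (MappingPathSpace.continuous_slide (by fun_prop) (by fun_prop)
        (by fun_prop)).prodMk (by fun_prop)
      map_zero_left := fun p => Prod.ext (MappingPathSpace.slide_zero _ _) rfl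
      map_one_left := fun p => Prod.ext (MappingPathSpace.slide_of_le (by
        rw [abs_le]
        constructor <;> simp only [Icc.coe_one] <;>
          linarith [t.2.1, t.2.2, p.1.2.1, p.1.2.2])) rfl }

/-- The homotopy `B → D` from `b ↦ h(b)` to `b ↦ (M → D)(e(h(b)))`, on fixed points. -/
noncomputable def leftHomotopy : C(I × Z.Fixed H B, Z.Fixed H D) :=
  ⟨fun p => Z.fixedMap H (fun b => s.cylinderMap (c.homotopy (σ p.1, s.inl b))) p.2,
    continuous_fixedMap_family (fun r b => s.cylinderMap (c.homotopy (σ r, s.inl b)))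
      (s.cylinderMap.continuous.comp (c.homotopy.continuous.comp (Continuous.prodMk (by fun_prop)
        (s.isBasedGMap_inl.continuous.comp continuous_snd))))
      (fun r => isBasedGMap_comp_homotopy_inl c GSquare.isBasedGMap_cylinderMap (σ r))
      continuous_fst continuous_snd⟩

/-- The homotopy `C → D` from `y ↦ k(y)` to `y ↦ (M → D)(e(k(y)))`, on fixed points. -/
noncomputable def rightHomotopy : C(I × Z.Fixed H C, Z.Fixed H D) :=
  ⟨fun p => Z.fixedMap H (fun b => s.cylinderMap (c.homotopy (σ p.1, s.inr b))) p.2,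
    continuous_fixedMap_family (fun r b => s.cylinderMap (c.homotopy (σ r, s.inr b)))
      (s.cylinderMap.continuous.comp (c.homotopy.continuous.comp (Continuous.prodMk (by fun_prop)
        (s.isBasedGMap_inr.continuous.comp continuous_snd))))
      (fun r => isBasedGMap_comp_homotopy_inr c GSquare.isBasedGMap_cylinderMap (σ r))
      continuous_fst continuous_snd⟩

theorem leftHomotopy_zero (b : Z.Fixed H B) :
    leftHomotopy c (0, b) = Z.fixedMap H s.h.1 b := by
  change Z.fixedMap H (fun b => s.cylinderMap (c.homotopy (σ 0, s.inl b))) b = _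
  simp only [symm_zero, c.homotopy_one]
  rfl

theorem rightHomotopy_zero (y : Z.Fixed H C) :
    rightHomotopy c (0, y) = Z.fixedMap H s.k.1 y := by
  change Z.fixedMap H (fun b => s.cylinderMap (c.homotopy (σ 0, s.inr b))) y = _
  simp only [symm_zero, c.homotopy_one]
  rfl

theorem isBasedGMap_cylinderMap_inv :
    IsBasedGMap G D.toBased.pt D.toBased.pt fun d => s.cylinderMap (c.inv d) :=
  GSquare.isBasedGMap_cylinderMap.comp c.isBasedGMap_inv

theorem isWeakHomotopyEquiv_fixedHom_inv :
    IsWeakHomotopyEquiv (fixedHom (Z := Z) (H := H) (isBasedGMap_cylinderMap_inv c)) := by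
  have hid : IsBasedGMap G D.toBased.pt D.toBased.pt id := ⟨continuous_id, rfl, fun _ _ => rfl⟩
  have e : fixedHom (Z := Z) (H := H) hid = ContinuousMap.id _ := ContinuousMap.ext fixedMap_id
  have h : IsWeakHomotopyEquiv (fixedHom (Z := Z) (H := H) hid) := by
    rw [e]; exact isWeakHomotopyEquiv_id
  exact h.of_homotopic (homotopic_fixedMap c.right_inv (isBasedGMap_cylinderMap_inv c) hid).symm

theorem leftHomotopy_one (b : Z.Fixed H B) : leftHomotopy c (1, b) =
    Z.fixedMap H (fun d => s.cylinderMap (c.inv d)) (Z.fixedMap H s.h.1 b) := by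
  refine Eq.trans ?_ (fixedMap_comp (isBasedGMap_cylinderMap_inv c) s.isBasedGMap_h b).symm
  change Z.fixedMap H (fun b => s.cylinderMap (c.homotopy (σ 1, s.inl b))) b = _
  simp only [symm_one, c.homotopy_zero]
  rfl

theorem rightHomotopy_one (y : Z.Fixed H C) : rightHomotopy c (1, y) =
    Z.fixedMap H (fun d => s.cylinderMap (c.inv d)) (Z.fixedMap H s.k.1 y) := by
  refine Eq.trans ?_ (fixedMap_comp (isBasedGMap_cylinderMap_inv c) s.isBasedGMap_k y).symm
  change Z.fixedMap H (fun b => s.cylinderMap (c.homotopy (σ 1, s.inr b))) y = _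
  simp only [symm_one, c.homotopy_zero]
  rfl

/-- In the homotopy pullback of the homotopies `I × Z(B)^H → Z(D)^H ← I × Z(C)^H`, the self-map
is homotopic to the map induced by the self-map `(M → D) ∘ e` of `D`: cut off the first and the
last part of the path. -/
theorem isWeakHomotopyEquiv_stretch :
    IsWeakHomotopyEquiv (stretch (Z := Z) (H := H) c) := by
  let Q := HomotopyPullbackSpace (leftHomotopy (Z := Z) (H := H) c) (rightHomotopy c)
  let i₀ : C(Z.FixedPullback H s, Q) := HomotopyPullbackSpace.map
    ⟨fun b => ((0 : I), b), by fun_prop⟩ (ContinuousMap.id _) ⟨fun y => ((0 : I), y), by fun_prop⟩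
    (fun b => (leftHomotopy_zero c b).symm) (fun y => (rightHomotopy_zero c y).symm)
  let i₁ : C(Z.FixedPullback H s, Q) := HomotopyPullbackSpace.map
    ⟨fun b => ((1 : I), b), by fun_prop⟩ (fixedHom (isBasedGMap_cylinderMap_inv c))
    ⟨fun y => ((1 : I), y), by fun_prop⟩
    (fun b => (leftHomotopy_one c b).symm) (fun y => (rightHomotopy_one c y).symm)
  have h0 : IsWeakHomotopyEquiv i₀ := HomotopyPullbackSpace.isWeakHomotopyEquiv_map _ _
    (isWeakHomotopyEquiv_prodMk 0) isWeakHomotopyEquiv_id (isWeakHomotopyEquiv_prodMk 0)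
  have h1 : IsWeakHomotopyEquiv i₁ := HomotopyPullbackSpace.isWeakHomotopyEquiv_map _ _
    (isWeakHomotopyEquiv_prodMk 1) (isWeakHomotopyEquiv_fixedHom_inv c)
    (isWeakHomotopyEquiv_prodMk 1)
  refine h0.of_comp_left (h1.of_homotopic ?_)
  -- the time at which the path is taken at stage `ρ`
  let v : I → I → I := fun ρ t =>
    clampI ((1 - ρ) * (clampI (3 * t - 1) : ℝ) + ρ * ((1 + (t : ℝ)) / 3))
  have hv : Continuous fun p : I × I => v p.1 p.2 := by fun_prop
  let w : C((I × Z.FixedPullback H s) × I, Z.Fixed H D) :=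
    ⟨fun p => cylinderPath c s.cylinderMap p.1.2 (v p.1.1 p.2),
      continuous_cylinderPath c GSquare.isBasedGMap_cylinderMap (by fun_prop)
        (hv.comp (by fun_prop : Continuous fun p : (I × Z.FixedPullback H s) × I =>
          (p.1.1, p.2)))⟩
  have hw0 : ∀ p : I × Z.FixedPullback H s,
      w (p, 0) = leftHomotopy c (p.1, HomotopyPullbackSpace.fst _ _ p.2) := by
    rintro ⟨ρ, x⟩
    have e : (v ρ 0 : ℝ) = ρ / 3 := by
      have e1 : clampI (3 * ((0 : I) : ℝ) - 1) = 0 := clampI_of_le (by norm_num)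
      simp only [v, e1]
      rw [coe_clampI] <;> simp only [Icc.coe_zero] <;> linarith [ρ.2.1, ρ.2.2]
    change cylinderPath c s.cylinderMap x (v ρ 0) = _
    rw [cylinderPath_left c x (by rw [e]; linarith [ρ.2.2])]
    have e2 : clampI (1 - 3 * (v ρ 0 : ℝ)) = σ ρ := by
      rw [e, show 1 - 3 * ((ρ : ℝ) / 3) = (σ ρ : I) by rw [coe_symm_eq]; ring, clampI_coe]
    rw [e2]
    rfl
  have hw1 : ∀ p : I × Z.FixedPullback H s,
      w (p, 1) = rightHomotopy c (p.1, HomotopyPullbackSpace.snd _ _ p.2) := by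
    rintro ⟨ρ, x⟩
    have e : (v ρ 1 : ℝ) = 1 - ρ / 3 := by
      have e1 : clampI (3 * ((1 : I) : ℝ) - 1) = 1 := clampI_of_ge (by norm_num)
      simp only [v, e1]
      rw [coe_clampI] <;> simp only [Icc.coe_one] <;> linarith [ρ.2.1, ρ.2.2]
    change cylinderPath c s.cylinderMap x (v ρ 1) = _
    rw [cylinderPath_right c x GSquare.isBasedGMap_cylinderMap (by rw [e]; linarith [ρ.2.2])]
    have e2 : clampI (3 * (v ρ 1 : ℝ) - 2) = σ ρ := by
      rw [e, show 3 * (1 - (ρ : ℝ) / 3) - 2 = (σ ρ : I) by rw [coe_symm_eq]; ring, clampI_coe]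
    rw [e2]
    rfl
  refine ContinuousMap.Homotopic.symm ⟨?_⟩
  exact
    { toContinuousMap := HomotopyPullbackSpace.lift
        ⟨fun p => (p.1, HomotopyPullbackSpace.fst _ _ p.2), by fun_prop⟩ w
        ⟨fun p => (p.1, HomotopyPullbackSpace.snd _ _ p.2), by fun_prop⟩ hw0 hw1
      map_zero_left := fun x => by
        refine HomotopyPullbackSpace.ext rfl (fun t => ?_) rfl
        have e : v 0 t = clampI (3 * t - 1) := by
          simp only [v, Icc.coe_zero, sub_zero, one_mul, zero_mul, add_zero, clampI_coe]
        change cylinderPath c s.cylinderMap x (v 0 t) =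
          cylinderPath c s.cylinderMap x (clampI (3 * t - 1))
        rw [e]
      map_one_left := fun x => by
        refine HomotopyPullbackSpace.ext rfl (fun t => ?_) rfl
        have e : (v 1 t : ℝ) = (1 + (t : ℝ)) / 3 := by
          simp only [v, Icc.coe_one, sub_self, one_mul, zero_mul, zero_add]
          rw [coe_clampI] <;> linarith [t.2.1, t.2.2]
        change cylinderPath c s.cylinderMap x (v 1 t) = Z.fixedMap H
          (fun d => s.cylinderMap (c.inv d)) (HomotopyPullbackSpace.path _ _ x t)
        rw [cylinderPath_mid c x GSquare.isBasedGMap_cylinderMap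
          (by rw [e]; linarith [t.2.1]) (by rw [e]; linarith [t.2.2]), e,
          show 3 * ((1 + (t : ℝ)) / 3) - 1 = t by ring, clampI_coe] }

/-! ### The square and the loops on the suspension of its initial corner -/

/-- The comparison map from `Z(A)^H` to the homotopy pullback. -/
noncomputable def fixedPullbackMap (s : GSquare A.toBased B.toBased C.toBased D.toBased) :
    C(Z.Fixed H A, Z.FixedPullback H s) :=
  HomotopyPullbackSpace.lift (fixedHom s.isBasedGMap_f)
    ⟨fun p => Z.fixedMap H (fun a => s.η (p.2, a)) p.1,
      continuous_fixedMap_family (fun t a => s.η (t, a)) s.η.continuous s.isBasedGMap_η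
        continuous_snd continuous_fst⟩
    (fixedHom s.isBasedGMap_g)
    (fun x => by
      refine Eq.trans ?_ (fixedMap_comp s.isBasedGMap_h s.isBasedGMap_f x).symm
      exact congrArg (fun φ => Z.fixedMap H φ x) (funext s.η_zero))
    (fun x => by
      refine Eq.trans ?_ (fixedMap_comp s.isBasedGMap_k s.isBasedGMap_g x).symm
      exact congrArg (fun φ => Z.fixedMap H φ x) (funext s.η_one))

/-- The path in "`Z(M)`" given by a point of `Z(A)^H` leads through the homotopy on `M` from the
points `[0, a]` to `e(h(f(a)))`, along the homotopy `e ∘ η`, and back to `[1, a]`. -/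
theorem cylinderPath_fixedPullbackMap {Φ : s.Cylinder → X.toBased}
    (hΦ : IsBasedGMap G s.cylinderPt X.toBased.pt Φ) (x : Z.Fixed H A) (v : I) :
    cylinderPath c Φ (fixedPullbackMap s x) v = Z.fixedMap H (fun a => Φ (c.homotopy
      (max (clampI (1 - 3 * v)) (clampI (3 * v - 2)), s.mid (clampI (3 * v - 1)) a))) x := by
  rcases le_total (v : ℝ) (1 / 3) with h1 | h1
  · rw [cylinderPath_left c _ h1, clampI_of_le (r := 3 * (v : ℝ) - 2) (by linarith),
      clampI_of_le (r := 3 * (v : ℝ) - 1) (by linarith), max_eq_left (by exact nonneg')]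
    simp only [GSquare.mid_zero]
    exact fixedMap_comp (isBasedGMap_comp_homotopy_inl c hΦ _) s.isBasedGMap_f x
  · rcases le_total (v : ℝ) (2 / 3) with h2 | h2
    · rw [cylinderPath_mid c _ hΦ h1 h2, clampI_of_le (r := 3 * (v : ℝ) - 2) (by linarith),
        clampI_of_le (r := 1 - 3 * (v : ℝ)) (by linarith), max_self]
      simp only [c.homotopy_zero]
      exact fixedMap_comp (hΦ.comp c.isBasedGMap_inv) (s.isBasedGMap_η _) x
    · rw [cylinderPath_right c _ hΦ h2, clampI_of_le (r := 1 - 3 * (v : ℝ)) (by linarith),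
        clampI_of_ge (r := 3 * (v : ℝ) - 1) (by linarith), max_eq_right (by exact nonneg')]
      simp only [GSquare.mid_one]
      exact fixedMap_comp (isBasedGMap_comp_homotopy_inr c hΦ _) s.isBasedGMap_g x

variable [CompactSpace G] [T2Space G]

/-- The map `M → ΣA` that collapses `B` and `C`. -/
noncomputable def collapse (s : GSquare A.toBased B.toBased C.toBased D.toBased) :
    s.Cylinder → A.susp.toBased :=
  s.desc (fun _ => A.susp.toBased.pt) A.suspIncl (fun _ => A.susp.toBased.pt)

theorem cylinderCompat_collapse (s : GSquare A.toBased B.toBased C.toBased D.toBased) :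
    s.CylinderCompat (fun _ => A.susp.toBased.pt) A.suspIncl (fun _ => A.susp.toBased.pt) :=
  ⟨A.suspIncl_zero, A.suspIncl_one, A.suspIncl_pt⟩

theorem isBasedGMap_collapse (s : GSquare A.toBased B.toBased C.toBased D.toBased) :
    IsBasedGMap G s.cylinderPt A.susp.toBased.pt (collapse s) :=
  GSquare.isBasedGMap_desc (cylinderCompat_collapse s) isBasedGMap_const A.continuous_suspIncl
    (fun t => (A.isBasedGMap_suspIncl t).equivariant) isBasedGMap_const

theorem collapse_mid (t : I) (a : A.toBased) : collapse s (s.mid t a) = A.suspIncl t a :=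
  (cylinderCompat_collapse s).desc_mid t a

/-- The map from the homotopy pullback to `Ω(Z(ΣA)^H)`: the path of a point is collapsed to a
loop by `M → ΣA`. -/
noncomputable def toLoops : C(Z.FixedPullback H s, Z.FixedLoops H A.susp) :=
  loopFamily (fun x v => cylinderPath c (collapse s) x v)
    (continuous_cylinderPath c (isBasedGMap_collapse s) continuous_fst continuous_snd)
    (fun x => by
      rw [cylinderPath_zero]
      exact fixedMap_eq_pt (cylinderCompat_collapse s).desc_inl _)
    (fun x => by
      rw [cylinderPath_one c x (isBasedGMap_collapse s)]
      exact fixedMap_eq_pt (cylinderCompat_collapse s).desc_inr _)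

theorem homotopic_toLoops_comp :
    ((toLoops (Z := Z) (H := H) c).comp (fixedPullbackMap s)).Homotopic
      (Z.fixedStructureMap H A) := by
  -- the homotopy runs through the homotopy on `M` back to the identity
  let r : I → I → I := fun l v => max l (max (clampI (1 - 3 * v)) (clampI (3 * v - 2)))
  let t : I → I → I := fun l v => clampI ((1 - l) * (clampI (3 * v - 1) : ℝ) + l * v)
  have hr : Continuous fun p : I × I => r p.1 p.2 := by fun_prop
  have ht : Continuous fun p : I × I => t p.1 p.2 := by fun_prop
  have r0 : ∀ l, r l 0 = 1 := fun l => by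
    have e : clampI (1 - 3 * ((0 : I) : ℝ)) = 1 := clampI_of_ge (by norm_num)
    simp only [r, e]
    rw [max_eq_left (le_one' : _ ≤ (1 : I)), max_eq_right (le_one' : _ ≤ (1 : I))]
  have r1 : ∀ l, r l 1 = 1 := fun l => by
    have e : clampI (3 * ((1 : I) : ℝ) - 2) = 1 := clampI_of_ge (by norm_num)
    simp only [r, e]
    rw [max_eq_right (le_one' : _ ≤ (1 : I)), max_eq_right (le_one' : _ ≤ (1 : I))]
  have t0 : ∀ l, t l 0 = 0 := fun l => by
    have e : clampI (3 * ((0 : I) : ℝ) - 1) = 0 := clampI_of_le (by norm_num)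
    simp only [t, e]
    simp only [Icc.coe_zero, mul_zero, add_zero]
    exact clampI_of_le le_rfl
  have t1 : ∀ l, t l 1 = 1 := fun l => by
    have e : clampI (3 * ((1 : I) : ℝ) - 1) = 1 := clampI_of_ge (by norm_num)
    simp only [t, e]
    simp only [Icc.coe_one, mul_one, sub_add_cancel]
    exact clampI_of_ge le_rfl
  let φ : I × I → A.toBased → A.susp.toBased := fun p a =>
    collapse s (c.homotopy (r p.1 p.2, s.mid (t p.1 p.2) a))
  have hφc : Continuous fun p : (I × I) × A.toBased => φ p.1 p.2 := by
    refine (isBasedGMap_collapse s).continuous.comp (c.homotopy.continuous.comp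
      ((hr.comp continuous_fst).prodMk (s.continuous_mid.comp
        ((ht.comp continuous_fst).prodMk continuous_snd))))
  have hφ : ∀ p, IsBasedGMap G A.toBased.pt A.susp.toBased.pt (φ p) := fun p =>
    (isBasedGMap_collapse s).comp ((c.isBasedGMap_homotopy _).comp (s.isBasedGMap_mid _))
  refine ⟨{
    toContinuousMap := loopFamily
      (fun (p : I × Z.Fixed H A) v => Z.fixedMap H (φ (p.1, v)) p.2)
      (continuous_fixedMap_family φ hφc hφ (by fun_prop) (by fun_prop))
      (fun p => fixedMap_eq_pt (fun a => ?_) _) (fun p => fixedMap_eq_pt (fun a => ?_) _)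
    map_zero_left := fun x => ?_
    map_one_left := fun x => ?_ }⟩
  · simp only [φ, r0, t0, c.homotopy_one, collapse_mid, WG.suspIncl_zero]
  · simp only [φ, r1, t1, c.homotopy_one, collapse_mid, WG.suspIncl_one]
  · refine Path.ext (funext fun v => ?_)
    refine Eq.trans ?_ (cylinderPath_fixedPullbackMap c (isBasedGMap_collapse s) x v).symm
    change Z.fixedMap H (φ (0, v)) x = _
    have e1 : r 0 v = max (clampI (1 - 3 * v)) (clampI (3 * v - 2)) :=
      max_eq_right (by exact nonneg')
    have e2 : t 0 v = clampI (3 * v - 1) := by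
      simp only [t, Icc.coe_zero, sub_zero, one_mul, zero_mul, add_zero, clampI_coe]
    simp only [φ, e1, e2]
  · refine Path.ext (funext fun v => ?_)
    change Z.fixedMap H (φ (1, v)) x = Z.fixedMap H (A.suspIncl v) x
    have e1 : r 1 v = 1 := max_eq_left le_one'
    have e2 : t 1 v = v := by
      simp only [t, Icc.coe_one, sub_self, one_mul, zero_mul, zero_add, clampI_coe]
    simp only [φ, e1, e2, c.homotopy_one, collapse_mid]

end Comparison

end WGSpace

namespace WGSpace

section Sweep

variable {G : Type u} [Group G] [TopologicalSpace G] [CompactSpace G] [T2Space G]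
  {Z : WGSpace G} {H : Subgroup G} {A B C D X : WG G}

section Maps

variable (s : GSquare A.toBased B.toBased C.toBased D.toBased)

/-! ### From loops to the homotopy pullback of loop spaces -/

/-- The homotopy pullback of the loop spaces of the suspended square. -/
abbrev LoopPullback (Z : WGSpace G) (H : Subgroup G)
    (s : GSquare A.toBased B.toBased C.toBased D.toBased) : Type u :=
  HomotopyPullbackSpace (Z.loopMap H (WG.isBasedGMap_suspMap s.isBasedGMap_h))
    (Z.loopMap H (WG.isBasedGMap_suspMap s.isBasedGMap_k))

/-- The loops on the comparison map from `Z(ΣA)^H` to the homotopy pullback of the suspended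
square. -/
noncomputable def fromLoops : C(Z.FixedLoops H A.susp, LoopPullback Z H s) :=
  HomotopyPullbackSpace.lift (Z.loopMap H (WG.isBasedGMap_suspMap s.isBasedGMap_f))
    (loopFamily (fun p v => Z.fixedMap H
        (WG.suspMap (fun a => s.η (p.2, a)) (s.η_pt p.2)) (p.1 v))
      (continuous_fixedMap_family (fun t => WG.suspMap (fun a => s.η (t, a)) (s.η_pt t))
        (WG.continuous_suspMap_family (fun t a => s.η (t, a)) s.η.continuous s.η_pt)
        (fun t => WG.isBasedGMap_suspMap (s.isBasedGMap_η t)) (by fun_prop) (by fun_prop))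
      (fun p => by rw [p.1.source, fixedMap_pt (WG.isBasedGMap_suspMap (s.isBasedGMap_η p.2))])
      (fun p => by rw [p.1.target, fixedMap_pt (WG.isBasedGMap_suspMap (s.isBasedGMap_η p.2))]))
    (Z.loopMap H (WG.isBasedGMap_suspMap s.isBasedGMap_g))
    (fun γ => Path.ext (funext fun v => by
      refine Eq.trans ?_ (fixedMap_comp (WG.isBasedGMap_suspMap s.isBasedGMap_h)
        (WG.isBasedGMap_suspMap s.isBasedGMap_f) (γ v)).symm
      refine congrArg (fun φ => Z.fixedMap H φ (γ v)) (funext ?_)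
      exact Smash.ind (Y := A.toBased) fun t a => congrArg (Smash.mk t) (s.η_zero a)))
    (fun γ => Path.ext (funext fun v => by
      refine Eq.trans ?_ (fixedMap_comp (WG.isBasedGMap_suspMap s.isBasedGMap_k)
        (WG.isBasedGMap_suspMap s.isBasedGMap_g) (γ v)).symm
      refine congrArg (fun φ => Z.fixedMap H φ (γ v)) (funext ?_)
      exact Smash.ind (Y := A.toBased) fun t a => congrArg (Smash.mk t) (s.η_one a)))

theorem fixedStructureMap_natural {φ : A.toBased → B.toBased}
    (hφ : IsBasedGMap G A.toBased.pt B.toBased.pt φ) (x : Z.Fixed H A) :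
    Z.fixedStructureMap H B (fixedHom hφ x) =
      Z.loopMap H (WG.isBasedGMap_suspMap hφ) (Z.fixedStructureMap H A x) :=
  Path.ext (funext fun v => (fixedMap_comp (B.isBasedGMap_suspIncl v) hφ x).trans
    (fixedMap_comp (WG.isBasedGMap_suspMap hφ) (A.isBasedGMap_suspIncl v) x).symm)

/-- The map of homotopy pullbacks induced by the adjoint structure maps of the three corners. -/
noncomputable def pullbackStructureMap : C(Z.FixedPullback H s, LoopPullback Z H s) :=
  HomotopyPullbackSpace.map (Z.fixedStructureMap H B) (Z.fixedStructureMap H D)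
    (Z.fixedStructureMap H C) (fun b => fixedStructureMap_natural s.isBasedGMap_h b)
    (fun b => fixedStructureMap_natural s.isBasedGMap_k b)

/-! ### Sweeping the double mapping cylinder through the suspension -/

/-- The first coordinate of the segment from the point `a` of the left and lower edges of the unit
square to the point `b` of the right and upper edges; `a ≤ 0` stands for `(-a, 0)`, `a ≥ 0` for
`(0, a)`, `b ≤ 1` for `(1, b)` and `b ≥ 1` for `(2 - b, 1)`. -/
noncomputable def segFst (a b : ℝ) (r : I) : I :=
  clampI ((1 - r) * (clampI (-a) : ℝ) + r * (clampI (2 - b) : ℝ))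

/-- The second coordinate of the segment from the point `a` of the left and lower edges of the unit
square to the point `b` of the right and upper edges. -/
noncomputable def segSnd (a b : ℝ) (r : I) : I :=
  clampI ((1 - r) * (clampI a : ℝ) + r * (clampI b : ℝ))

theorem segFst_zero (a b : ℝ) : segFst a b 0 = clampI (-a) := by
  simp only [segFst, Icc.coe_zero, sub_zero, one_mul, zero_mul, add_zero, clampI_coe]

theorem segFst_one (a b : ℝ) : segFst a b 1 = clampI (2 - b) := by
  simp only [segFst, Icc.coe_one, sub_self, one_mul, zero_mul, zero_add, clampI_coe]

theorem segSnd_zero (a b : ℝ) : segSnd a b 0 = clampI a := by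
  simp only [segSnd, Icc.coe_zero, sub_zero, one_mul, zero_mul, add_zero, clampI_coe]

theorem segSnd_one (a b : ℝ) : segSnd a b 1 = clampI b := by
  simp only [segSnd, Icc.coe_one, sub_self, one_mul, zero_mul, zero_add, clampI_coe]

@[fun_prop]
theorem continuous_segFst : Continuous fun p : ℝ × ℝ × I => segFst p.1 p.2.1 p.2.2 := by
  unfold segFst; fun_prop

@[fun_prop]
theorem continuous_segSnd : Continuous fun p : ℝ × ℝ × I => segSnd p.1 p.2.1 p.2.2 := by
  unfold segSnd; fun_prop

/-- The map `M → ΣD`, `[r, x] ↦ u(r) ∧ η(w(r), x)`, where `r ↦ (u(r), w(r))` is the segment from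
`a` to `b` in the unit square. For `a = b = t` it is the composite of `M → ΣA` and `Σηₜ`, and for
`a = -v`, `b = 2 - v` it is the composite of `M → D` and `y ↦ v ∧ y`. -/
noncomputable def sweep (a b : ℝ) : s.Cylinder → D.susp.toBased :=
  s.desc (fun y => D.suspIncl (clampI (-a)) (s.h.1 y))
    (fun r x => D.suspIncl (segFst a b r) (s.η (segSnd a b r, x)))
    (fun y => D.suspIncl (clampI (2 - b)) (s.k.1 y))

theorem cylinderCompat_sweep (a b : ℝ) : s.CylinderCompat
    (fun y => D.suspIncl (clampI (-a)) (s.h.1 y))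
    (fun r x => D.suspIncl (segFst a b r) (s.η (segSnd a b r, x)))
    (fun y => D.suspIncl (clampI (2 - b)) (s.k.1 y)) where
  left x := by
    rw [segFst_zero, segSnd_zero]
    rcases le_total a 0 with h | h
    · rw [clampI_of_le h, s.η_zero]
    · rw [clampI_of_le (r := -a) (by linarith), WG.suspIncl_zero, WG.suspIncl_zero]
  right x := by
    rw [segFst_one, segSnd_one]
    rcases le_total b 1 with h | h
    · rw [clampI_of_ge (r := 2 - b) (by linarith), WG.suspIncl_one, WG.suspIncl_one]
    · rw [clampI_of_ge h, s.η_one]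
  base t := by rw [s.η_pt, s.h.2, WG.suspIncl_pt, WG.suspIncl_pt]

theorem continuous_sweep_family {K : Type*} [TopologicalSpace K] [LocallyCompactSpace K]
    {a b : K → ℝ} (ha : Continuous a) (hb : Continuous b) :
    Continuous fun p : K × s.Cylinder => sweep s (a p.1) (b p.1) p.2 :=
  GSquare.continuous_desc_family (fun k => cylinderCompat_sweep s (a k) (b k))
    (D.continuous_suspIncl.comp (by fun_prop :
      Continuous fun p : K × B.toBased => (clampI (-a p.1), s.h.1 p.2)))
    (D.continuous_suspIncl.comp (by fun_prop : Continuous fun p : K × (I × A.toBased) =>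
      (segFst (a p.1) (b p.1) p.2.1, s.η (segSnd (a p.1) (b p.1) p.2.1, p.2.2))))
    (D.continuous_suspIncl.comp (by fun_prop :
      Continuous fun p : K × C.toBased => (clampI (2 - b p.1), s.k.1 p.2)))

theorem isBasedGMap_sweep (a b : ℝ) :
    IsBasedGMap G s.cylinderPt D.susp.toBased.pt (sweep s a b) :=
  GSquare.isBasedGMap_desc (cylinderCompat_sweep s a b)
    ((D.isBasedGMap_suspIncl _).comp s.isBasedGMap_h)
    (D.continuous_suspIncl.comp (by fun_prop : Continuous fun p : I × A.toBased =>
      (segFst a b p.1, s.η (segSnd a b p.1, p.2))))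
    (fun r => ((D.isBasedGMap_suspIncl _).comp (s.isBasedGMap_η _)).equivariant)
    ((D.isBasedGMap_suspIncl _).comp s.isBasedGMap_k)

/-- The lift of the sweep to `ΣB`, for segments along the lower edge. -/
noncomputable def sweepLeft (a : ℝ) : s.Cylinder → B.susp.toBased :=
  s.desc (B.suspIncl (clampI (-a))) (fun r x => B.suspIncl (segFst a 0 r) (s.f.1 x))
    (fun _ => B.susp.toBased.pt)

theorem cylinderCompat_sweepLeft (a : ℝ) : s.CylinderCompat
    (B.suspIncl (clampI (-a))) (fun r x => B.suspIncl (segFst a 0 r) (s.f.1 x))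
    (fun _ => B.susp.toBased.pt) where
  left x := by rw [segFst_zero]
  right x := by rw [segFst_one, clampI_of_ge (by norm_num), WG.suspIncl_one]
  base t := by rw [s.f.2, WG.suspIncl_pt, WG.suspIncl_pt]

theorem continuous_sweepLeft_family {K : Type*} [TopologicalSpace K] [LocallyCompactSpace K]
    {a : K → ℝ} (ha : Continuous a) :
    Continuous fun p : K × s.Cylinder => sweepLeft s (a p.1) p.2 :=
  GSquare.continuous_desc_family (fun k => cylinderCompat_sweepLeft s (a k))
    (B.continuous_suspIncl.comp (by fun_prop :
      Continuous fun p : K × B.toBased => (clampI (-a p.1), p.2)))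
    (B.continuous_suspIncl.comp (by fun_prop : Continuous fun p : K × (I × A.toBased) =>
      (segFst (a p.1) 0 p.2.1, s.f.1 p.2.2)))
    continuous_const

theorem isBasedGMap_sweepLeft (a : ℝ) :
    IsBasedGMap G s.cylinderPt B.susp.toBased.pt (sweepLeft s a) :=
  GSquare.isBasedGMap_desc (cylinderCompat_sweepLeft s a) (B.isBasedGMap_suspIncl _)
    (B.continuous_suspIncl.comp (by fun_prop : Continuous fun p : I × A.toBased =>
      (segFst a 0 p.1, s.f.1 p.2)))
    (fun r => ((B.isBasedGMap_suspIncl _).comp s.isBasedGMap_f).equivariant) isBasedGMap_const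

/-- The lift of the sweep to `ΣC`, for segments along the upper edge. -/
noncomputable def sweepRight (b : ℝ) : s.Cylinder → C.susp.toBased :=
  s.desc (fun _ => C.susp.toBased.pt) (fun r x => C.suspIncl (segFst 1 b r) (s.g.1 x))
    (C.suspIncl (clampI (2 - b)))

theorem cylinderCompat_sweepRight (b : ℝ) : s.CylinderCompat
    (fun _ => C.susp.toBased.pt) (fun r x => C.suspIncl (segFst 1 b r) (s.g.1 x))
    (C.suspIncl (clampI (2 - b))) where
  left x := by rw [segFst_zero, clampI_of_le (by norm_num), WG.suspIncl_zero]
  right x := by rw [segFst_one]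
  base t := by rw [s.g.2, WG.suspIncl_pt]

theorem continuous_sweepRight_family {K : Type*} [TopologicalSpace K] [LocallyCompactSpace K]
    {b : K → ℝ} (hb : Continuous b) :
    Continuous fun p : K × s.Cylinder => sweepRight s (b p.1) p.2 :=
  GSquare.continuous_desc_family (fun k => cylinderCompat_sweepRight s (b k))
    continuous_const
    (C.continuous_suspIncl.comp (by fun_prop : Continuous fun p : K × (I × A.toBased) =>
      (segFst 1 (b p.1) p.2.1, s.g.1 p.2.2)))
    (C.continuous_suspIncl.comp (by fun_prop :
      Continuous fun p : K × C.toBased => (clampI (2 - b p.1), p.2)))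

theorem isBasedGMap_sweepRight (b : ℝ) :
    IsBasedGMap G s.cylinderPt C.susp.toBased.pt (sweepRight s b) :=
  GSquare.isBasedGMap_desc (cylinderCompat_sweepRight s b) isBasedGMap_const
    (C.continuous_suspIncl.comp (by fun_prop : Continuous fun p : I × A.toBased =>
      (segFst 1 b p.1, s.g.1 p.2)))
    (fun r => ((C.isBasedGMap_suspIncl _).comp s.isBasedGMap_g).equivariant)
    (C.isBasedGMap_suspIncl _)

theorem suspMap_sweepLeft {a : ℝ} (ha : a ≤ 0) (x : s.Cylinder) :
    WG.suspMap s.h.1 s.h.2 (sweepLeft s a x) = sweep s a 0 x := by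
  revert x
  refine s.cylinder_ind (fun y => ?_) (fun r y => ?_) fun y => ?_
  · rw [sweepLeft, sweep, (cylinderCompat_sweepLeft s a).desc_inl,
      (cylinderCompat_sweep s a 0).desc_inl, WG.suspMap_suspIncl]
  · have e : segSnd a 0 r = 0 := by
      simp only [segSnd, clampI_of_le ha, clampI_of_le le_rfl, Icc.coe_zero, mul_zero, add_zero]
    rw [sweepLeft, sweep, (cylinderCompat_sweepLeft s a).desc_mid,
      (cylinderCompat_sweep s a 0).desc_mid, WG.suspMap_suspIncl, e, s.η_zero]
  · rw [sweepLeft, sweep, (cylinderCompat_sweepLeft s a).desc_inr,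
      (cylinderCompat_sweep s a 0).desc_inr, clampI_of_ge (by norm_num), WG.suspIncl_one]
    exact (WG.isBasedGMap_suspMap s.isBasedGMap_h).map_pt

theorem suspMap_sweepRight {b : ℝ} (hb : 1 ≤ b) (x : s.Cylinder) :
    WG.suspMap s.k.1 s.k.2 (sweepRight s b x) = sweep s 1 b x := by
  revert x
  refine s.cylinder_ind (fun y => ?_) (fun r y => ?_) fun y => ?_
  · rw [sweepRight, sweep, (cylinderCompat_sweepRight s b).desc_inl,
      (cylinderCompat_sweep s 1 b).desc_inl, clampI_of_le (by norm_num), WG.suspIncl_zero]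
    exact (WG.isBasedGMap_suspMap s.isBasedGMap_k).map_pt
  · have e : segSnd 1 b r = 1 := by
      simp only [segSnd, clampI_of_ge hb, clampI_of_ge le_rfl, Icc.coe_one, mul_one,
        sub_add_cancel]
    rw [sweepRight, sweep, (cylinderCompat_sweepRight s b).desc_mid,
      (cylinderCompat_sweep s 1 b).desc_mid, WG.suspMap_suspIncl, e, s.η_one]
  · rw [sweepRight, sweep, (cylinderCompat_sweepRight s b).desc_inr,
      (cylinderCompat_sweep s 1 b).desc_inr, WG.suspMap_suspIncl]

theorem sweep_self (t : I) (x : s.Cylinder) : sweep s t t x =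
    WG.suspMap (fun a => s.η (t, a)) (s.η_pt t) (collapse s x) := by
  have e1 : clampI (-(t : ℝ)) = 0 := clampI_of_le (by linarith [t.2.1])
  have e2 : clampI (2 - (t : ℝ)) = 1 := clampI_of_ge (by linarith [t.2.2])
  have e0 : WG.suspMap (fun a => s.η (t, a)) (s.η_pt t) A.susp.toBased.pt = D.susp.toBased.pt :=
    (WG.isBasedGMap_suspMap (s.isBasedGMap_η t)).map_pt
  revert x
  refine s.cylinder_ind (fun y => ?_) (fun r y => ?_) fun y => ?_
  · rw [sweep, (cylinderCompat_sweep s t t).desc_inl, e1, WG.suspIncl_zero, collapse,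
      (cylinderCompat_collapse s).desc_inl, e0]
  · rw [sweep, (cylinderCompat_sweep s t t).desc_mid, collapse_mid, WG.suspMap_suspIncl]
    have e3 : segFst t t r = r := by
      simp only [segFst, e1, e2, Icc.coe_zero, Icc.coe_one, mul_zero, mul_one, zero_add,
        clampI_coe]
    have e4 : segSnd t t r = t := by
      simp only [segSnd, clampI_coe]
      rw [← add_mul, sub_add_cancel, one_mul, clampI_coe]
    rw [e3, e4]
  · rw [sweep, (cylinderCompat_sweep s t t).desc_inr, e2, WG.suspIncl_one, collapse,
      (cylinderCompat_collapse s).desc_inr, e0]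

theorem sweepLeft_zero (x : s.Cylinder) :
    sweepLeft s 0 x = WG.suspMap s.f.1 s.f.2 (collapse s x) := by
  revert x
  refine s.cylinder_ind (fun y => ?_) (fun r y => ?_) fun y => ?_
  · rw [sweepLeft, (cylinderCompat_sweepLeft s 0).desc_inl, clampI_of_le (by norm_num),
      WG.suspIncl_zero, collapse, (cylinderCompat_collapse s).desc_inl]
    exact (WG.isBasedGMap_suspMap s.isBasedGMap_f).map_pt.symm
  · rw [sweepLeft, (cylinderCompat_sweepLeft s 0).desc_mid, collapse_mid, WG.suspMap_suspIncl]
    have e3 : segFst 0 0 r = r := by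
      simp only [segFst, clampI_of_le (neg_zero (G := ℝ)).le,
        clampI_of_ge (r := 2 - 0) (by norm_num), Icc.coe_zero, Icc.coe_one, mul_zero, mul_one,
        zero_add, clampI_coe]
    rw [e3]
  · rw [sweepLeft, (cylinderCompat_sweepLeft s 0).desc_inr, collapse,
      (cylinderCompat_collapse s).desc_inr]
    exact (WG.isBasedGMap_suspMap s.isBasedGMap_f).map_pt.symm

theorem sweepRight_one (x : s.Cylinder) :
    sweepRight s 1 x = WG.suspMap s.g.1 s.g.2 (collapse s x) := by
  revert x
  refine s.cylinder_ind (fun y => ?_) (fun r y => ?_) fun y => ?_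
  · rw [sweepRight, (cylinderCompat_sweepRight s 1).desc_inl, collapse,
      (cylinderCompat_collapse s).desc_inl]
    exact (WG.isBasedGMap_suspMap s.isBasedGMap_g).map_pt.symm
  · rw [sweepRight, (cylinderCompat_sweepRight s 1).desc_mid, collapse_mid, WG.suspMap_suspIncl]
    have e3 : segFst 1 1 r = r := by
      simp only [segFst, clampI_of_le (r := -1) (by norm_num),
        clampI_of_ge (r := 2 - 1) (by norm_num), Icc.coe_zero, Icc.coe_one, mul_zero, mul_one,
        zero_add, clampI_coe]
    rw [e3]
  · rw [sweepRight, (cylinderCompat_sweepRight s 1).desc_inr, clampI_of_ge (by norm_num),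
      WG.suspIncl_one, collapse, (cylinderCompat_collapse s).desc_inr]
    exact (WG.isBasedGMap_suspMap s.isBasedGMap_g).map_pt.symm

theorem sweep_vertical (v : I) (x : s.Cylinder) :
    sweep s (-v) (2 - v) x = D.suspIncl v (s.cylinderMap x) := by
  have e1 : clampI (- -(v : ℝ)) = v := by rw [neg_neg, clampI_coe]
  have e2 : clampI (2 - (2 - (v : ℝ))) = v := by rw [sub_sub_cancel, clampI_coe]
  revert x
  refine s.cylinder_ind (fun y => ?_) (fun r y => ?_) fun y => ?_
  · rw [sweep, (cylinderCompat_sweep s _ _).desc_inl, e1]; rfl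
  · rw [sweep, (cylinderCompat_sweep s _ _).desc_mid]
    have e3 : segFst (-v) (2 - v) r = v := by
      simp only [segFst, e1, e2]
      rw [← add_mul, sub_add_cancel, one_mul, clampI_coe]
    have e4 : segSnd (-v) (2 - v) r = r := by
      simp only [segSnd, clampI_of_le (neg_nonpos.2 v.2.1),
        clampI_of_ge (r := 2 - (v : ℝ)) (by linarith [v.2.2]), Icc.coe_zero, Icc.coe_one, mul_zero,
        mul_one, zero_add, clampI_coe]
    rw [e3, e4]; rfl
  · rw [sweep, (cylinderCompat_sweep s _ _).desc_inr, e2]; rfl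

theorem sweep_inl (a b : ℝ) (y : B.toBased) :
    sweep s a b (s.inl y) = D.suspIncl (clampI (-a)) (s.h.1 y) :=
  (cylinderCompat_sweep s a b).desc_inl y

theorem sweep_inr (a b : ℝ) (y : C.toBased) :
    sweep s a b (s.inr y) = D.suspIncl (clampI (2 - b)) (s.k.1 y) :=
  (cylinderCompat_sweep s a b).desc_inr y

/-- A segment in the left or in the right edge gives the constant map. -/
theorem sweep_eq_pt {a b : ℝ} (h : (0 ≤ a ∧ 2 ≤ b) ∨ (a ≤ -1 ∧ b ≤ 1)) (x : s.Cylinder) :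
    sweep s a b x = D.susp.toBased.pt := by
  have key : ∀ u : I, (u = 0 ∨ u = 1) → clampI (-a) = u → clampI (2 - b) = u →
      ∀ x, sweep s a b x = D.susp.toBased.pt := by
    intro u hu ha hb
    have hu' : ∀ y, D.suspIncl u y = D.susp.toBased.pt := by
      rcases hu with rfl | rfl
      exacts [D.suspIncl_zero, D.suspIncl_one]
    refine s.cylinder_ind (fun y => ?_) (fun r y => ?_) fun y => ?_
    · rw [sweep_inl, ha, hu']
    · rw [sweep, (cylinderCompat_sweep s a b).desc_mid]
      have e : segFst a b r = u := by
        simp only [segFst, ha, hb]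
        rw [← add_mul, sub_add_cancel, one_mul, clampI_coe]
      rw [e, hu']
    · rw [sweep_inr, hb, hu']
  rcases h with ⟨h1, h2⟩ | ⟨h1, h2⟩
  · exact key 0 (Or.inl rfl) (clampI_of_le (by linarith)) (clampI_of_le (by linarith)) x
  · exact key 1 (Or.inr rfl) (clampI_of_ge (by linarith)) (clampI_of_ge (by linarith)) x

theorem sweepLeft_eq_pt {a : ℝ} (h : a ≤ -1) (x : s.Cylinder) :
    sweepLeft s a x = B.susp.toBased.pt := by
  have ha : clampI (-a) = 1 := clampI_of_ge (by linarith)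
  revert x
  refine s.cylinder_ind (fun y => ?_) (fun r y => ?_) fun y => ?_
  · rw [sweepLeft, (cylinderCompat_sweepLeft s a).desc_inl, ha, WG.suspIncl_one]
  · rw [sweepLeft, (cylinderCompat_sweepLeft s a).desc_mid]
    have e : segFst a 0 r = 1 := by
      simp only [segFst, ha, clampI_of_ge (r := 2 - 0) (by norm_num), Icc.coe_one, mul_one,
        sub_add_cancel]
      exact clampI_of_ge le_rfl
    rw [e, WG.suspIncl_one]
  · rw [sweepLeft, (cylinderCompat_sweepLeft s a).desc_inr]

theorem sweepRight_eq_pt {b : ℝ} (h : 2 ≤ b) (x : s.Cylinder) :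
    sweepRight s b x = C.susp.toBased.pt := by
  have hb : clampI (2 - b) = 0 := clampI_of_le (by linarith)
  revert x
  refine s.cylinder_ind (fun y => ?_) (fun r y => ?_) fun y => ?_
  · rw [sweepRight, (cylinderCompat_sweepRight s b).desc_inl]
  · rw [sweepRight, (cylinderCompat_sweepRight s b).desc_mid]
    have e : segFst 1 b r = 0 := by
      simp only [segFst, hb, clampI_of_le (r := -1) (by norm_num), Icc.coe_zero, mul_zero,
        add_zero]
      exact clampI_of_le le_rfl
    rw [e, WG.suspIncl_zero]
  · rw [sweepRight, (cylinderCompat_sweepRight s b).desc_inr, hb, WG.suspIncl_zero]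

end Maps

end Sweep

end WGSpace

namespace WGSpace

section Homotopy

variable {G : Type u} [Group G] [TopologicalSpace G] [CompactSpace G] [T2Space G]
  {Z : WGSpace G} {H : Subgroup G} {A B C D : WG G}
  {s : GSquare A.toBased B.toBased C.toBased D.toBased} (c : s.CylinderInverse)

/-! ### Sweeps along the paths of a point -/

theorem cylinderPath_sweepLeft_eq_pt {a v : ℝ} (h : (v ≤ 0 ∧ 0 ≤ a) ∨ 1 ≤ v ∨ a ≤ -1)
    (x : Z.FixedPullback H s) :
    cylinderPath c (sweepLeft s a) x (clampI v) = Z.fixedPt H B.susp := by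
  rcases h with ⟨hv, ha⟩ | hv | ha
  · rw [clampI_of_le hv, cylinderPath_zero]
    refine fixedMap_eq_pt (fun y => ?_) _
    rw [sweepLeft, (cylinderCompat_sweepLeft s a).desc_inl, clampI_of_le (by linarith),
      WG.suspIncl_zero]
  · rw [clampI_of_ge hv, cylinderPath_one c x (isBasedGMap_sweepLeft s a)]
    exact fixedMap_eq_pt (cylinderCompat_sweepLeft s a).desc_inr _
  · exact cylinderPath_eq_pt c x (sweepLeft_eq_pt s ha) _

theorem cylinderPath_sweepRight_eq_pt {b v : ℝ} (h : v ≤ 0 ∨ (1 ≤ v ∧ b ≤ 1) ∨ 2 ≤ b)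
    (x : Z.FixedPullback H s) :
    cylinderPath c (sweepRight s b) x (clampI v) = Z.fixedPt H C.susp := by
  rcases h with hv | ⟨hv, hb⟩ | hb
  · rw [clampI_of_le hv, cylinderPath_zero]
    exact fixedMap_eq_pt (cylinderCompat_sweepRight s b).desc_inl _
  · rw [clampI_of_ge hv, cylinderPath_one c x (isBasedGMap_sweepRight s b)]
    refine fixedMap_eq_pt (fun y => ?_) _
    rw [sweepRight, (cylinderCompat_sweepRight s b).desc_inr, clampI_of_ge (by linarith),
      WG.suspIncl_one]
  · exact cylinderPath_eq_pt c x (sweepRight_eq_pt s hb) _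

theorem cylinderPath_sweep_eq_pt {a b v : ℝ} (h : (v ≤ 0 ∧ 0 ≤ a) ∨ (1 ≤ v ∧ b ≤ 1) ∨
    (0 ≤ a ∧ 2 ≤ b) ∨ (a ≤ -1 ∧ b ≤ 1)) (x : Z.FixedPullback H s) :
    cylinderPath c (sweep s a b) x (clampI v) = Z.fixedPt H D.susp := by
  rcases h with ⟨hv, ha⟩ | ⟨hv, hb⟩ | h
  · rw [clampI_of_le hv, cylinderPath_zero]
    refine fixedMap_eq_pt (fun y => ?_) _
    rw [sweep_inl, clampI_of_le (by linarith), WG.suspIncl_zero]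
  · rw [clampI_of_ge hv, cylinderPath_one c x (isBasedGMap_sweep s a b)]
    refine fixedMap_eq_pt (fun y => ?_) _
    rw [sweep_inr, clampI_of_ge (by linarith), WG.suspIncl_one]
  · exact cylinderPath_eq_pt c x (sweep_eq_pt s h) _

/-- The left end of a path only sees the left end of the sweeping segment. -/
theorem cylinderPath_sweep_zero (a b b' : ℝ) (x : Z.FixedPullback H s) :
    cylinderPath c (sweep s a b) x 0 = cylinderPath c (sweep s a b') x 0 := by
  simp only [cylinderPath_zero, sweep_inl]

/-- The right end of a path only sees the right end of the sweeping segment. -/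
theorem cylinderPath_sweep_one (a a' b : ℝ) (x : Z.FixedPullback H s) :
    cylinderPath c (sweep s a b) x 1 = cylinderPath c (sweep s a' b) x 1 := by
  rw [cylinderPath_one c x (isBasedGMap_sweep s a b),
    cylinderPath_one c x (isBasedGMap_sweep s a' b)]
  simp only [sweep_inr]

/-! ### The parameters of the homotopy -/

/-- The progress of the first half of the homotopy, in which the segments of the sweep are turned
from horizontal to vertical. -/
noncomputable def turn (θ : I) : ℝ := min 1 (2 * (θ : ℝ))

/-- The speed on the paths, which is reduced to zero in the second half of the homotopy. -/
noncomputable def speed (θ : I) : ℝ := min 1 (2 - 2 * (θ : ℝ))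

/-- The path coordinate `t`, turning into the part of it over the `i`-th third of the interval. -/
noncomputable def stagger (i : ℝ) (θ t : I) : ℝ :=
  (1 - turn θ) * t + turn θ * (clampI (3 * t - i) : ℝ)

/-- The left end of the segment for the path coordinate `t` and the loop coordinate `r`. -/
noncomputable def sweepStart (θ t r : I) : ℝ :=
  (1 - stagger 2 θ t) * (-(r * turn θ)) + stagger 2 θ t

/-- The right end of the segment for the path coordinate `t` and the loop coordinate `r`. -/
noncomputable def sweepEnd (θ t r : I) : ℝ := stagger 0 θ t * (1 + (1 - r) * turn θ)

/-- The time on the path for the path coordinate `t` and the loop coordinate `r`. -/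
noncomputable def sweepTime (θ t r : I) : ℝ :=
  (1 - stagger 1 θ t) * (r * speed θ) + stagger 1 θ t * (1 - (1 - r) * speed θ)

@[fun_prop]
theorem continuous_turn : Continuous turn := by unfold turn; fun_prop

@[fun_prop]
theorem continuous_speed : Continuous speed := by unfold speed; fun_prop

theorem continuous_sweepStart :
    Continuous fun p : I × I × I => sweepStart p.1 p.2.1 p.2.2 := by
  unfold sweepStart stagger; fun_prop

theorem continuous_sweepEnd : Continuous fun p : I × I × I => sweepEnd p.1 p.2.1 p.2.2 := by
  unfold sweepEnd stagger; fun_prop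

theorem continuous_sweepTime : Continuous fun p : I × I × I => sweepTime p.1 p.2.1 p.2.2 := by
  unfold sweepTime stagger; fun_prop

theorem turn_nonneg (θ : I) : 0 ≤ turn θ := le_min zero_le_one (by linarith [θ.2.1])

theorem turn_le_one (θ : I) : turn θ ≤ 1 := min_le_left _ _

theorem speed_eq_one_or (θ : I) : speed θ = 1 ∨ turn θ = 1 := by
  rcases le_total (θ : ℝ) (1 / 2) with h | h
  · exact Or.inl (min_eq_left (by linarith))
  · exact Or.inr (min_eq_left (by linarith))

theorem turn_zero : turn 0 = 0 := by simp [turn]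

theorem turn_one : turn 1 = 1 := by simp [turn]

theorem speed_zero : speed 0 = 1 := by simp [speed]

theorem speed_one : speed 1 = 0 := by simp [speed]

theorem stagger_nonneg (i : ℝ) (θ t : I) : 0 ≤ stagger i θ t :=
  add_nonneg (mul_nonneg (sub_nonneg.2 (turn_le_one θ)) t.2.1)
    (mul_nonneg (turn_nonneg θ) (clampI _).2.1)

theorem stagger_le_one (i : ℝ) (θ t : I) : stagger i θ t ≤ 1 := by
  have e1 := mul_le_mul_of_nonneg_left t.2.2 (sub_nonneg.2 (turn_le_one θ))
  have e2 := mul_le_mul_of_nonneg_left (clampI (3 * (t : ℝ) - i)).2.2 (turn_nonneg θ)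
  rw [stagger]
  linarith

theorem stagger_zero {i : ℝ} (hi : 0 ≤ i) (θ : I) : stagger i θ 0 = 0 := by
  rw [stagger, clampI_of_le (by rw [Icc.coe_zero]; linarith), Icc.coe_zero, mul_zero, mul_zero,
    add_zero]

theorem stagger_one {i : ℝ} (hi : i ≤ 2) (θ : I) : stagger i θ 1 = 1 := by
  rw [stagger, clampI_of_ge (by rw [Icc.coe_one]; linarith), Icc.coe_one, mul_one, mul_one,
    sub_add_cancel]

theorem stagger_of_le {i : ℝ} {θ t : I} (h : turn θ = 1) (ht : 3 * (t : ℝ) ≤ i) :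
    stagger i θ t = 0 := by
  rw [stagger, clampI_of_le (by linarith), h, Icc.coe_zero, sub_self, zero_mul, mul_zero,
    add_zero]

theorem stagger_of_ge {i : ℝ} {θ t : I} (h : turn θ = 1) (ht : i + 1 ≤ 3 * (t : ℝ)) :
    stagger i θ t = 1 := by
  rw [stagger, clampI_of_ge (by linarith), h, Icc.coe_one, sub_self, zero_mul, mul_one, zero_add]

theorem stagger_start (i : ℝ) (t : I) : stagger i 0 t = t := by
  rw [stagger, turn_zero, sub_zero, one_mul, zero_mul, add_zero]

/-! ### The composite through the loops is the map of adjoint structure maps -/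

theorem continuous_homotopyLeft : Continuous fun p : (I × Z.FixedPullback H s) × I =>
    cylinderPath c (sweepLeft s (-(p.2 * turn p.1.1))) p.1.2 (clampI (p.2 * speed p.1.1)) :=
  continuous_cylinderPath_family c (K := I × I) (fun k => sweepLeft s (-(k.2 * turn k.1)))
    (continuous_sweepLeft_family s (K := I × I) (a := fun k => -(k.2 * turn k.1)) (by fun_prop))
    (fun k => isBasedGMap_sweepLeft s _)
    (κ := fun p : (I × Z.FixedPullback H s) × I => (p.1.1, p.2)) (by fun_prop)
    (x := fun p => p.1.2) (by fun_prop) (v := fun p => clampI (p.2 * speed p.1.1)) (by fun_prop)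

theorem continuous_homotopyRight : Continuous fun p : (I × Z.FixedPullback H s) × I =>
    cylinderPath c (sweepRight s (1 + (1 - p.2) * turn p.1.1)) p.1.2
      (clampI (1 - (1 - p.2) * speed p.1.1)) :=
  continuous_cylinderPath_family c (K := I × I)
    (fun k => sweepRight s (1 + (1 - k.2) * turn k.1))
    (continuous_sweepRight_family s (K := I × I) (b := fun k => 1 + (1 - k.2) * turn k.1)
      (by fun_prop))
    (fun k => isBasedGMap_sweepRight s _)
    (κ := fun p : (I × Z.FixedPullback H s) × I => (p.1.1, p.2)) (by fun_prop)
    (x := fun p => p.1.2) (by fun_prop)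
    (v := fun p => clampI (1 - (1 - p.2) * speed p.1.1)) (by fun_prop)

theorem continuous_homotopyPath {T : Type*} [TopologicalSpace T] {κ : T → I × I × I}
    (hκ : Continuous κ) {x : T → Z.FixedPullback H s} (hx : Continuous x) : Continuous fun p =>
    cylinderPath c (sweep s (sweepStart (κ p).1 (κ p).2.1 (κ p).2.2)
      (sweepEnd (κ p).1 (κ p).2.1 (κ p).2.2)) (x p)
      (clampI (sweepTime (κ p).1 (κ p).2.1 (κ p).2.2)) :=
  continuous_cylinderPath_family c (K := I × I × I)
    (fun k => sweep s (sweepStart k.1 k.2.1 k.2.2) (sweepEnd k.1 k.2.1 k.2.2))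
    (continuous_sweep_family s (K := I × I × I) (a := fun k => sweepStart k.1 k.2.1 k.2.2)
      (b := fun k => sweepEnd k.1 k.2.1 k.2.2) continuous_sweepStart continuous_sweepEnd)
    (fun _ => isBasedGMap_sweep s _ _) hκ hx (continuous_clampI.comp (continuous_sweepTime.comp hκ))

theorem homotopyPath_start (θ t : I) (x : Z.FixedPullback H s) :
    cylinderPath c (sweep s (sweepStart θ t 0) (sweepEnd θ t 0)) x (clampI (sweepTime θ t 0)) =
      Z.fixedPt H D.susp := by
  refine cylinderPath_sweep_eq_pt c ?_ x
  simp only [sweepStart, sweepEnd, sweepTime, Icc.coe_zero, sub_zero, one_mul, zero_mul,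
    neg_zero, mul_zero, zero_add]
  rcases speed_eq_one_or θ with h | h
  · exact Or.inl ⟨by rw [h, sub_self, mul_zero], stagger_nonneg 2 θ t⟩
  · rcases le_total (3 * (t : ℝ)) 1 with ht | ht
    · exact Or.inl ⟨by rw [stagger_of_le h ht, zero_mul], stagger_nonneg 2 θ t⟩
    · refine Or.inr (Or.inr (Or.inl ⟨stagger_nonneg 2 θ t, ?_⟩))
      rw [stagger_of_ge h (by linarith), h]; norm_num

theorem homotopyPath_end (θ t : I) (x : Z.FixedPullback H s) :
    cylinderPath c (sweep s (sweepStart θ t 1) (sweepEnd θ t 1)) x (clampI (sweepTime θ t 1)) =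
      Z.fixedPt H D.susp := by
  refine cylinderPath_sweep_eq_pt c ?_ x
  simp only [sweepStart, sweepEnd, sweepTime, Icc.coe_one, sub_self, one_mul, zero_mul,
    sub_zero, add_zero, mul_one]
  rcases speed_eq_one_or θ with h | h
  · exact Or.inr (Or.inl ⟨by rw [h]; linarith, stagger_le_one 0 θ t⟩)
  · rcases le_total (3 * (t : ℝ)) 2 with ht | ht
    · refine Or.inr (Or.inr (Or.inr ⟨?_, stagger_le_one 0 θ t⟩))
      rw [stagger_of_le h ht, h]; norm_num
    · refine Or.inr (Or.inl ⟨?_, stagger_le_one 0 θ t⟩)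
      rw [stagger_of_ge h (by linarith)]; norm_num

/-- The left corner of the homotopy. -/
noncomputable def homotopyLeft : C(I × Z.FixedPullback H s, Z.FixedLoops H B.susp) := loopFamily
  (fun p r => cylinderPath c (sweepLeft s (-(r * turn p.1))) p.2 (clampI (r * speed p.1)))
  (continuous_homotopyLeft c)
  (fun p => cylinderPath_sweepLeft_eq_pt c (Or.inl (by simp)) p.2)
  (fun p => cylinderPath_sweepLeft_eq_pt c (by
    rw [Icc.coe_one, one_mul, one_mul]
    rcases speed_eq_one_or p.1 with h | h
    · exact Or.inr (Or.inl h.ge)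
    · exact Or.inr (Or.inr (by rw [h]))) p.2)

/-- The right corner of the homotopy. -/
noncomputable def homotopyRight : C(I × Z.FixedPullback H s, Z.FixedLoops H C.susp) := loopFamily
  (fun p r => cylinderPath c (sweepRight s (1 + (1 - r) * turn p.1)) p.2
    (clampI (1 - (1 - r) * speed p.1)))
  (continuous_homotopyRight c)
  (fun p => cylinderPath_sweepRight_eq_pt c (by
    rw [Icc.coe_zero, sub_zero, one_mul, one_mul]
    rcases speed_eq_one_or p.1 with h | h
    · exact Or.inl (by rw [h, sub_self])
    · exact Or.inr (Or.inr (by rw [h]; norm_num))) p.2)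
  (fun p => cylinderPath_sweepRight_eq_pt c (Or.inr (Or.inl (by simp))) p.2)

/-- The path coordinate of the homotopy. -/
noncomputable def homotopyPath : C((I × Z.FixedPullback H s) × I, Z.FixedLoops H D.susp) :=
  loopFamily
    (fun p r => cylinderPath c (sweep s (sweepStart p.1.1 p.2 r) (sweepEnd p.1.1 p.2 r)) p.1.2
      (clampI (sweepTime p.1.1 p.2 r)))
    (continuous_homotopyPath c (T := ((I × Z.FixedPullback H s) × I) × I)
      (κ := fun p => (p.1.1.1, p.1.2, p.2)) (x := fun p => p.1.1.2)
      ((continuous_fst.comp (continuous_fst.comp continuous_fst)).prodMk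
        ((continuous_snd.comp continuous_fst).prodMk continuous_snd))
      (continuous_snd.comp (continuous_fst.comp continuous_fst)))
    (fun p => homotopyPath_start c p.1.1 p.2 p.1.2) (fun p => homotopyPath_end c p.1.1 p.2 p.1.2)

theorem homotopyPath_zero (p : I × Z.FixedPullback H s) : homotopyPath c (p, 0) =
    Z.loopMap H (WG.isBasedGMap_suspMap s.isBasedGMap_h) (homotopyLeft c p) := by
  obtain ⟨θ, x⟩ := p
  refine Path.ext (funext fun r => ?_)
  change cylinderPath c (sweep s (sweepStart θ 0 r) (sweepEnd θ 0 r)) x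
    (clampI (sweepTime θ 0 r)) =
    Z.fixedMap H _ (cylinderPath c (sweepLeft s (-(r * turn θ))) x (clampI (r * speed θ)))
  have hr : -((r : ℝ) * turn θ) ≤ 0 := neg_nonpos.2 (mul_nonneg r.2.1 (turn_nonneg θ))
  rw [fixedMap_cylinderPath c x (WG.isBasedGMap_suspMap s.isBasedGMap_h)
    (isBasedGMap_sweepLeft s _), funext (suspMap_sweepLeft s hr)]
  simp only [sweepStart, sweepEnd, sweepTime, stagger_zero le_rfl, stagger_zero zero_le_one,
    stagger_zero zero_le_two, sub_zero, one_mul, zero_mul, add_zero]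

theorem homotopyPath_one (p : I × Z.FixedPullback H s) : homotopyPath c (p, 1) =
    Z.loopMap H (WG.isBasedGMap_suspMap s.isBasedGMap_k) (homotopyRight c p) := by
  obtain ⟨θ, x⟩ := p
  refine Path.ext (funext fun r => ?_)
  change cylinderPath c (sweep s (sweepStart θ 1 r) (sweepEnd θ 1 r)) x
    (clampI (sweepTime θ 1 r)) =
    Z.fixedMap H _ (cylinderPath c (sweepRight s (1 + (1 - r) * turn θ)) x
      (clampI (1 - (1 - r) * speed θ)))
  have hr : 1 ≤ 1 + (1 - (r : ℝ)) * turn θ := le_add_of_nonneg_right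
    (mul_nonneg (sub_nonneg.2 r.2.2) (turn_nonneg θ))
  rw [fixedMap_cylinderPath c x (WG.isBasedGMap_suspMap s.isBasedGMap_k)
    (isBasedGMap_sweepRight s _), funext (suspMap_sweepRight s hr)]
  simp only [sweepStart, sweepEnd, sweepTime, stagger_one zero_le_two, stagger_one one_le_two,
    stagger_one le_rfl, sub_self, one_mul, zero_mul, zero_add]

/-- The homotopy on the homotopy pullback of loop spaces. In the first half the segments of the
sweep are turned from horizontal to vertical; in the second half the time on the paths changes from
the loop coordinate to the path coordinate. -/
noncomputable def loopHomotopy : C(I × Z.FixedPullback H s, LoopPullback Z H s) :=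
  HomotopyPullbackSpace.lift (homotopyLeft c) (homotopyPath c) (homotopyRight c)
    (homotopyPath_zero c) (homotopyPath_one c)

theorem loopHomotopy_zero (x : Z.FixedPullback H s) :
    loopHomotopy c (0, x) = fromLoops s (toLoops c x) := by
  refine HomotopyPullbackSpace.ext (Path.ext (funext fun r => ?_))
    (fun t => Path.ext (funext fun r => ?_)) (Path.ext (funext fun r => ?_))
  · change cylinderPath c (sweepLeft s (-(r * turn 0))) x (clampI (r * speed 0)) =
      Z.fixedMap H _ (cylinderPath c (collapse s) x r)
    rw [fixedMap_cylinderPath c x (WG.isBasedGMap_suspMap s.isBasedGMap_f)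
      (isBasedGMap_collapse s), turn_zero, speed_zero, mul_zero, neg_zero, mul_one, clampI_coe,
      funext (sweepLeft_zero s)]
  · change cylinderPath c (sweep s (sweepStart 0 t r) (sweepEnd 0 t r)) x
      (clampI (sweepTime 0 t r)) =
      Z.fixedMap H (WG.suspMap (fun a => s.η (t, a)) (s.η_pt t))
        (cylinderPath c (collapse s) x r)
    have ea : sweepStart 0 t r = t := by
      rw [sweepStart, stagger_start, turn_zero, mul_zero, neg_zero, mul_zero, zero_add]
    have eb : sweepEnd 0 t r = t := by
      rw [sweepEnd, stagger_start, turn_zero, mul_zero, add_zero, mul_one]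
    have ev : sweepTime 0 t r = r := by
      rw [sweepTime, stagger_start, speed_zero]; ring
    rw [fixedMap_cylinderPath c x (WG.isBasedGMap_suspMap (s.isBasedGMap_η t))
      (isBasedGMap_collapse s), ea, eb, ev, clampI_coe, funext (sweep_self s t)]
  · change cylinderPath c (sweepRight s (1 + (1 - r) * turn 0)) x
      (clampI (1 - (1 - r) * speed 0)) = Z.fixedMap H _ (cylinderPath c (collapse s) x r)
    rw [fixedMap_cylinderPath c x (WG.isBasedGMap_suspMap s.isBasedGMap_g)
      (isBasedGMap_collapse s), turn_zero, speed_zero, mul_zero, add_zero, mul_one,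
      sub_sub_cancel, clampI_coe, funext (sweepRight_one s)]

theorem loopHomotopy_one (x : Z.FixedPullback H s) :
    loopHomotopy c (1, x) = pullbackStructureMap s (stretch c x) := by
  refine HomotopyPullbackSpace.ext (Path.ext (funext fun r => ?_))
    (fun t => Path.ext (funext fun r => ?_)) (Path.ext (funext fun r => ?_))
  · change cylinderPath c (sweepLeft s (-(r * turn 1))) x (clampI (r * speed 1)) =
      Z.fixedMap H (B.suspIncl r) (HomotopyPullbackSpace.fst _ _ x)
    rw [turn_one, speed_one, mul_zero, mul_one, clampI_of_le le_rfl, cylinderPath_zero]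
    refine congrArg (fun φ => Z.fixedMap H φ _) (funext fun y => ?_)
    rw [sweepLeft, (cylinderCompat_sweepLeft s _).desc_inl, neg_neg, clampI_coe]
  · change cylinderPath c (sweep s (sweepStart 1 t r) (sweepEnd 1 t r)) x
      (clampI (sweepTime 1 t r)) =
      Z.fixedMap H (D.suspIncl r) (cylinderPath c s.cylinderMap x (clampI (3 * t - 1)))
    rw [fixedMap_cylinderPath c x (D.isBasedGMap_suspIncl r)
      GSquare.isBasedGMap_cylinderMap, ← funext (sweep_vertical s r)]
    have ev : clampI (sweepTime 1 t r) = clampI (3 * t - 1) := by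
      simp only [sweepTime, stagger, turn_one, speed_one, sub_self, zero_mul, mul_zero, zero_add,
        one_mul, sub_zero, mul_one, clampI_coe]
    rw [ev]
    have ea : 3 * (t : ℝ) ≤ 2 → sweepStart 1 t r = -r := fun ht => by
      rw [sweepStart, stagger_of_le turn_one ht, turn_one, sub_zero, one_mul, mul_one, add_zero]
    have eb : 1 ≤ 3 * (t : ℝ) → sweepEnd 1 t r = 2 - r := fun ht => by
      rw [sweepEnd, stagger_of_ge turn_one (by linarith), turn_one]; ring
    rcases le_total (3 * (t : ℝ)) 1 with h1 | h1
    · rw [clampI_of_le (by linarith), ea (by linarith)]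
      exact cylinderPath_sweep_zero c _ _ _ x
    · rcases le_total (3 * (t : ℝ)) 2 with h2 | h2
      · rw [ea h2, eb h1]
      · rw [clampI_of_ge (by linarith), eb h1]
        exact cylinderPath_sweep_one c _ _ _ x
  · change cylinderPath c (sweepRight s (1 + (1 - r) * turn 1)) x
      (clampI (1 - (1 - r) * speed 1)) =
      Z.fixedMap H (C.suspIncl r) (HomotopyPullbackSpace.snd _ _ x)
    rw [turn_one, speed_one, mul_zero, mul_one, sub_zero, clampI_of_ge le_rfl,
      cylinderPath_one c x (isBasedGMap_sweepRight s _)]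
    refine congrArg (fun φ => Z.fixedMap H φ _) (funext fun y => ?_)
    rw [sweepRight, (cylinderCompat_sweepRight s _).desc_inr,
      show 2 - (1 + (1 - (r : ℝ))) = r by ring, clampI_coe]

theorem homotopic_fromLoops_comp :
    ((fromLoops (Z := Z) (H := H) s).comp (toLoops c)).Homotopic
      ((pullbackStructureMap s).comp (stretch c)) :=
  ⟨{ toContinuousMap := loopHomotopy c
     map_zero_left := loopHomotopy_zero c
     map_one_left := loopHomotopy_one c }⟩

/-- If the adjoint structure maps are weak equivalences on `H`-fixed points, then homotopy pushouts
are taken to homotopy pullbacks on `H`-fixed points. -/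
theorem isWeakHomotopyEquiv_fixedPullbackMap
    (hZ : ∀ X : WG G, IsWeakHomotopyEquiv (Z.fixedStructureMap H X)) (hs : s.IsHomotopyPushout) :
    IsWeakHomotopyEquiv (fixedPullbackMap (Z := Z) (H := H) s) := by
  obtain ⟨c⟩ := hs.nonempty_cylinderInverse
  have h1 := (hZ A).of_homotopic (homotopic_toLoops_comp c).symm
  have h2 : IsWeakHomotopyEquiv ((pullbackStructureMap (Z := Z) (H := H) s).comp (stretch c)) :=
    IsWeakHomotopyEquiv.comp (HomotopyPullbackSpace.isWeakHomotopyEquiv_map _ _ (hZ B) (hZ D)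
      (hZ C)) (isWeakHomotopyEquiv_stretch c)
  exact IsWeakHomotopyEquiv.of_two_out_of_six h1
    (h2.of_homotopic (homotopic_fromLoops_comp c).symm)

end Homotopy

end WGSpace

/-! ### Fixed points of loop spaces and of homotopy pullbacks -/

/-- A loop on the circle is a path on the interval, also in families: the product of a space with
the collapse `I → S¹` is a quotient map. -/
theorem continuous_of_intervalCollapse {K W : Type*} [TopologicalSpace K] [TopologicalSpace W]
    {φ : K × Sphere 1 → W} (h : Continuous fun p : K × I => φ (p.1, intervalCollapse p.2)) :
    Continuous φ := by
  have hp : IsProperMap (Prod.map id intervalCollapse : K × I → K × Sphere 1) :=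
    isProperMap_id.prodMap intervalCollapse.continuous.isProperMap
  exact (hp.isClosedMap.isQuotientMap hp.continuous
    (Function.surjective_id.prodMap intervalCollapse_surjective)).continuous_iff.2 h

section FixedLoops

variable {G : Type u} [Group G] [TopologicalSpace G] {X Y : BasedGSpace G} {H : Subgroup G}

/-- The base point as a fixed point. -/
def BasedGSpace.fixedPt (H : Subgroup G) (X : BasedGSpace G) : MulAction.fixedPoints H X :=
  ⟨X.pt, fun h => X.smul_pt h⟩

theorem continuous_fixedPoints_loops : Continuous fun γ : MulAction.fixedPoints H (Loops X) =>
    (γ : Loops X).1 := by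
  have h : Continuous fun γ : Loops X => γ.1 := continuous_subtype_val
  have h' : Continuous fun γ : MulAction.fixedPoints H (Loops X) => (γ : Loops X) :=
    continuous_subtype_val
  exact h.comp h'

/-- Fixed points of the loop space are loops of fixed points, parametrized by the interval. -/
noncomputable def loopsToPath (H : Subgroup G) (X : BasedGSpace G) :
    C(MulAction.fixedPoints H (Loops X), Path (X.fixedPt H) (X.fixedPt H)) where
  toFun γ :=
    { toFun := fun s => ⟨γ.1.1 (intervalCollapse s), fun h =>
        DFunLike.congr_fun (congrArg Subtype.val (γ.2 h)) (intervalCollapse s)⟩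
      continuous_toFun := (γ.1.1.continuous.comp intervalCollapse.continuous).subtype_mk _
      source' := Subtype.ext ((congrArg γ.1.1 intervalCollapse_zero).trans γ.1.2)
      target' := Subtype.ext ((congrArg γ.1.1 intervalCollapse_one).trans γ.1.2) }
  continuous_toFun := by
    refine Path.continuous_uncurry_iff.1 (Continuous.subtype_mk ?_ _)
    exact Continuous.eval (continuous_fixedPoints_loops.comp continuous_fst)
      (intervalCollapse.continuous.comp continuous_snd)

theorem path_surjInv (γ : Path (X.fixedPt H) (X.fixedPt H)) (s : I) :
    γ (Function.surjInv intervalCollapse_surjective (intervalCollapse s)) = γ s := by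
  set t := Function.surjInv intervalCollapse_surjective (intervalCollapse s)
  have ht : intervalCollapse t = intervalCollapse s := Function.surjInv_eq _ _
  have key : ∀ r, intervalCollapse r = ∞ → γ r = X.fixedPt H := fun r hr => by
    rcases intervalCollapse_eq_infty.1 hr with rfl | rfl
    exacts [γ.source, γ.target]
  by_cases h : intervalCollapse s = ∞
  · rw [key s h, key t (ht.trans h)]
  · rw [intervalCollapse_inj h ht.symm]

/-- The inverse of `loopsToPath`. -/
noncomputable def pathToLoops (H : Subgroup G) (X : BasedGSpace G) :
    C(Path (X.fixedPt H) (X.fixedPt H), MulAction.fixedPoints H (Loops X)) :=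
  have hc : Continuous fun p : Path (X.fixedPt H) (X.fixedPt H) × Sphere 1 =>
      (p.1 (Function.surjInv intervalCollapse_surjective p.2) : X) :=
    continuous_of_intervalCollapse (by simp only [path_surjInv]; fun_prop)
  { toFun := fun γ => ⟨⟨ContinuousMap.curry ⟨_, hc⟩ γ, by
        change (γ (Function.surjInv intervalCollapse_surjective ∞) : X) = X.pt
        rw [← intervalCollapse_zero, path_surjInv, γ.source]
        rfl⟩, fun h => Subtype.ext (ContinuousMap.ext fun t =>
          (γ (Function.surjInv intervalCollapse_surjective t)).2 h)⟩
    continuous_toFun := by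
      refine Continuous.subtype_mk ?_ _
      exact Continuous.subtype_mk (ContinuousMap.curry ⟨_, hc⟩).continuous _ }

theorem isWeakHomotopyEquiv_loopsToPath (H : Subgroup G) (X : BasedGSpace G) :
    IsWeakHomotopyEquiv (loopsToPath H X) := by
  refine isWeakHomotopyEquiv_of_inverse (e := pathToLoops H X) (fun γ => ?_) fun γ => ?_
  · refine Subtype.ext (Subtype.ext (ContinuousMap.ext fun t => ?_))
    exact congrArg γ.1.1 (Function.surjInv_eq intervalCollapse_surjective t)
  · exact Path.ext (funext fun s => Subtype.ext (congrArg Subtype.val (path_surjInv γ s)))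

theorem isEquivariant_adjointMap {m : C(Smash 1 X, Y)} (hm : m (Smash.pt 1 X) = Y.pt)
    (he : IsEquivariant G m) : IsEquivariant G (adjointMap m hm) := fun g x =>
  Subtype.ext (ContinuousMap.ext fun t => he g (Smash.mk t x))

theorem isGEquivalence_adjointMap_iff {m : C(Smash 1 X, Y)} (hm : m (Smash.pt 1 X) = Y.pt)
    (he : IsEquivariant G m) : IsGEquivalence G (adjointMap m hm) ↔
      ∀ H : Subgroup G, IsClosed (H : Set G) → IsWeakHomotopyEquiv ((loopsToPath H Y).comp
        (fixedPointMap (adjointMap m hm) (isEquivariant_adjointMap hm he) H)) := by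
  simp only [(isWeakHomotopyEquiv_loopsToPath _ Y).comp_iff]
  exact ⟨fun h => h.2, fun h => ⟨isEquivariant_adjointMap hm he, h⟩⟩

end FixedLoops

namespace WGSpace

section Transfer

variable {G : Type u} [Group G] [TopologicalSpace G] {Z : WGSpace G} {H : Subgroup G}
  {A B C D : WG G} (s : GSquare A.toBased B.toBased C.toBased D.toBased)

theorem continuous_fixedPoints_homotopyPullback : Continuous
    fun p : MulAction.fixedPoints H (Z.mapSquare s).HomotopyPullback =>
      (p : (Z.mapSquare s).HomotopyPullback).1 := by
  have h : Continuous fun p : (Z.mapSquare s).HomotopyPullback => p.1 := continuous_subtype_val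
  have h' : Continuous fun p : MulAction.fixedPoints H (Z.mapSquare s).HomotopyPullback =>
    (p : (Z.mapSquare s).HomotopyPullback) := continuous_subtype_val
  exact h.comp h'

/-- Fixed points of the homotopy pullback are points of the homotopy pullback of the fixed
points. -/
noncomputable def toFixedPullback (Z : WGSpace G) (H : Subgroup G) :
    C(MulAction.fixedPoints H (Z.mapSquare s).HomotopyPullback, Z.FixedPullback H s) :=
  HomotopyPullbackSpace.lift
    ⟨fun p => ⟨p.1.1.1, fun h => congrArg (fun q => q.1.1) (p.2 h)⟩,
      (continuous_fst.comp (continuous_fixedPoints_homotopyPullback s)).subtype_mk _⟩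
    ⟨fun p => ⟨p.1.1.1.2.1 p.2, fun h =>
        congrArg (fun q : (Z.mapSquare s).HomotopyPullback => q.1.2.1 p.2) (p.1.2 h)⟩,
      Continuous.subtype_mk (Continuous.eval (continuous_fst.comp (continuous_snd.comp
        ((continuous_fixedPoints_homotopyPullback s).comp continuous_fst)))
        continuous_snd) _⟩
    ⟨fun p => ⟨p.1.1.2.2, fun h => congrArg (fun q => q.1.2.2) (p.2 h)⟩,
      (continuous_snd.comp (continuous_snd.comp
        (continuous_fixedPoints_homotopyPullback s))).subtype_mk _⟩
    (fun p => Subtype.ext (p.1.2.1.trans (fixedMap_coe (Z := Z) s.isBasedGMap_h (H := H)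
      ⟨p.1.1.1, fun h => congrArg (fun q => q.1.1) (p.2 h)⟩).symm))
    (fun p => Subtype.ext (p.1.2.2.trans (fixedMap_coe (Z := Z) s.isBasedGMap_k (H := H)
      ⟨p.1.1.2.2, fun h => congrArg (fun q => q.1.2.2) (p.2 h)⟩).symm))

/-- The inverse of `toFixedPullback`. -/
noncomputable def ofFixedPullback (Z : WGSpace G) (H : Subgroup G) :
    C(Z.FixedPullback H s, MulAction.fixedPoints H (Z.mapSquare s).HomotopyPullback) where
  toFun p := ⟨⟨((HomotopyPullbackSpace.fst _ _ p).1,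
      ⟨fun t => (HomotopyPullbackSpace.path _ _ p t).1, by fun_prop⟩,
      (HomotopyPullbackSpace.snd _ _ p).1),
      (congrArg Subtype.val (HomotopyPullbackSpace.path_zero p)).trans
        (fixedMap_coe s.isBasedGMap_h _),
      (congrArg Subtype.val (HomotopyPullbackSpace.path_one p)).trans
        (fixedMap_coe s.isBasedGMap_k _)⟩, fun h => Subtype.ext (Prod.ext
      ((HomotopyPullbackSpace.fst _ _ p).2 h) (Prod.ext (ContinuousMap.ext fun t =>
        (HomotopyPullbackSpace.path _ _ p t).2 h) ((HomotopyPullbackSpace.snd _ _ p).2 h)))⟩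
  continuous_toFun := by
    refine Continuous.subtype_mk (Continuous.subtype_mk (Continuous.prodMk (by fun_prop)
      (Continuous.prodMk ?_ (by fun_prop))) _) _
    exact (ContinuousMap.curry ⟨fun p : Z.FixedPullback H s × I =>
      (HomotopyPullbackSpace.path _ _ p.1 p.2 : Z.obj D),
      continuous_subtype_val.comp HomotopyPullbackSpace.continuous_path_apply⟩).continuous

theorem isWeakHomotopyEquiv_toFixedPullback (Z : WGSpace G) (H : Subgroup G) :
    IsWeakHomotopyEquiv (toFixedPullback s Z H) :=
  isWeakHomotopyEquiv_of_inverse (e := ofFixedPullback s Z H) (fun _ => rfl) fun _ => rfl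

theorem isHomotopyPullback_mapSquare_iff : (Z.mapSquare s).IsHomotopyPullback ↔
    ∀ H : Subgroup G, IsClosed (H : Set G) →
      IsWeakHomotopyEquiv (fixedPullbackMap (Z := Z) (H := H) s) := by
  have he : IsEquivariant G (Z.mapSquare s).pullbackMap := fun g x =>
    Subtype.ext (Prod.ext ((Z.mapSquare s).f_smul g x) (Prod.ext
      (ContinuousMap.ext fun t => (Z.mapSquare s).η_smul t g x) ((Z.mapSquare s).g_smul g x)))
  have e : ∀ H : Subgroup G, fixedPullbackMap (Z := Z) (H := H) s =
      (toFixedPullback s Z H).comp (fixedPointMap (Z.mapSquare s).pullbackMap he H) := fun H =>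
    ContinuousMap.ext fun x => HomotopyPullbackSpace.ext
      (Subtype.ext (fixedMap_coe s.isBasedGMap_f x))
      (fun t => Subtype.ext (fixedMap_coe (s.isBasedGMap_η t) x))
      (Subtype.ext (fixedMap_coe s.isBasedGMap_g x))
  simp only [e, (isWeakHomotopyEquiv_toFixedPullback s Z _).comp_iff]
  exact ⟨fun h => h.2, fun h => ⟨he, h⟩⟩

variable [CompactSpace G] [T2Space G]

theorem isGEquivalence_adjointMap_structureMap_iff (Z : WGSpace G) (A : WG G) :
    IsGEquivalence G (adjointMap (Z.structureMap A) (Z.structureMap_pt A)) ↔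
      ∀ H : Subgroup G, IsClosed (H : Set G) → IsWeakHomotopyEquiv (Z.fixedStructureMap H A) := by
  rw [isGEquivalence_adjointMap_iff _ (Z.structureMap_smul A)]
  refine forall₂_congr fun H _ => ?_
  rw [show Z.fixedStructureMap H A = (loopsToPath H (Z.obj A.susp)).comp
    (fixedPointMap (adjointMap (Z.structureMap A) (Z.structureMap_pt A))
      (isEquivariant_adjointMap _ (Z.structureMap_smul A)) H) from
    ContinuousMap.ext fun x => Path.ext (funext fun t =>
      Subtype.ext (fixedMap_coe (A.isBasedGMap_suspIncl t) x))]
  rfl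

theorem isBasedGMap_smashAssoc (n : ℕ) (A : WG G) :
    IsBasedGMap G (A.smash n).susp.toBased.pt (A.smash (n + 1)).toBased.pt (A.smashAssoc n).1 where
  continuous := (A.smashAssoc n).1.continuous
  map_pt := (A.smashAssoc n).2
  equivariant _ :=
    Smash.ind (Y := (A.smash n).toBased) fun _ => Smash.ind (Y := A.toBased) fun _ _ => rfl

theorem isOmega_prespectrum_iff (Z : WGSpace G) (A : WG G) : (Z.prespectrum A).IsOmega ↔
    ∀ (n : ℕ) (H : Subgroup G), IsClosed (H : Set G) → IsWeakHomotopyEquiv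
      ((Z.loopMap H (isBasedGMap_smashAssoc n A)).comp (Z.fixedStructureMap H (A.smash n))) := by
  refine forall_congr' fun n => ?_
  rw [isGEquivalence_adjointMap_iff _ ((Z.prespectrum A).structureMap_smul n)]
  refine forall₂_congr fun H _ => ?_
  rw [show (Z.loopMap H (isBasedGMap_smashAssoc n A)).comp (Z.fixedStructureMap H (A.smash n)) =
    (loopsToPath H (Z.obj (A.smash (n + 1)))).comp (fixedPointMap (adjointMap
      ((Z.prespectrum A).structureMap n) ((Z.prespectrum A).structureMap_pt n))
      (isEquivariant_adjointMap _ ((Z.prespectrum A).structureMap_smul n)) H) from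
    ContinuousMap.ext fun x => Path.ext (funext fun t => Subtype.ext
      ((fixedMap_coe (isBasedGMap_smashAssoc n A) _).trans
        (congrArg (Z.map (A.smashAssoc n)).1
          (fixedMap_coe ((A.smash n).isBasedGMap_suspIncl t) x))))]
  rfl

end Transfer

end WGSpace

/-! ### Isomorphisms of based `G`-spaces -/

/-- A bijective based `G`-map from a compact space to a Hausdorff space is an isomorphism. -/
theorem IsBasedGMap.exists_inverse {G X Y : Type*} [TopologicalSpace X] [TopologicalSpace Y]
    [CompactSpace X] [T2Space Y] [SMul G X] [SMul G Y] {x₀ : X} {y₀ : Y} {φ : X → Y}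
    (h : IsBasedGMap G x₀ y₀ φ) (hb : Function.Bijective φ) :
    ∃ ψ : Y → X, IsBasedGMap G y₀ x₀ ψ ∧ (∀ x, ψ (φ x) = x) ∧ ∀ y, φ (ψ y) = y := by
  let e : X ≃ₜ Y := h.continuous.homeoOfEquivCompactToT2 (f := Equiv.ofBijective φ hb)
  have h1 : ∀ x, e.symm (φ x) = x := e.symm_apply_apply
  have h2 : ∀ y, φ (e.symm y) = y := e.apply_symm_apply
  refine ⟨e.symm, ⟨e.symm.continuous, ?_, fun g y => ?_⟩, h1, h2⟩
  · rw [← h.map_pt, h1]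
  · rw [← h1 (g • e.symm y), h.equivariant, h2]

/-- An isomorphism of based `G`-spaces is a based `G`-homotopy equivalence. -/
theorem IsBasedGMap.isBasedGHomotopyEquiv {G X Y : Type*} [TopologicalSpace X]
    [TopologicalSpace Y] [SMul G X] [SMul G Y] {x₀ : X} {y₀ : Y} {f : C(X, Y)} {ψ : Y → X}
    (h : IsBasedGMap G x₀ y₀ f) (h' : IsBasedGMap G y₀ x₀ ψ) (h1 : ∀ x, ψ (f x) = x)
    (h2 : ∀ y, f (ψ y) = y) : IsBasedGHomotopyEquiv G x₀ y₀ f :=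
  ⟨h.equivariant, h.map_pt, ⟨ψ, h'.continuous⟩, h'.equivariant, h'.map_pt,
    ⟨⟨Prod.snd, continuous_snd⟩, fun x => (h1 x).symm, fun _ => rfl, fun _ _ _ => rfl,
      fun _ => rfl⟩,
    ⟨⟨Prod.snd, continuous_snd⟩, fun y => (h2 y).symm, fun _ => rfl, fun _ _ _ => rfl,
      fun _ => rfl⟩⟩

namespace WGSpace

section Isomorphisms

variable {G : Type u} [Group G] [TopologicalSpace G] {Z : WGSpace G} {H : Subgroup G} {A B : WG G}
  {φ : A.toBased → B.toBased} {ψ : B.toBased → A.toBased}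

theorem fixedMap_inverse (hφ : IsBasedGMap G A.toBased.pt B.toBased.pt φ)
    (hψ : IsBasedGMap G B.toBased.pt A.toBased.pt ψ) (h : ∀ x, ψ (φ x) = x) (x : Z.Fixed H A) :
    Z.fixedMap H ψ (Z.fixedMap H φ x) = x := by
  rw [fixedMap_comp hψ hφ]
  simp only [h, fixedMap_id]

theorem isWeakHomotopyEquiv_fixedHom (hφ : IsBasedGMap G A.toBased.pt B.toBased.pt φ)
    (hψ : IsBasedGMap G B.toBased.pt A.toBased.pt ψ) (h1 : ∀ x, ψ (φ x) = x)
    (h2 : ∀ y, φ (ψ y) = y) : IsWeakHomotopyEquiv (fixedHom (Z := Z) (H := H) hφ) :=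
  isWeakHomotopyEquiv_of_inverse (e := fixedHom hψ) (fixedMap_inverse hφ hψ h1)
    (fixedMap_inverse hψ hφ h2)

theorem isWeakHomotopyEquiv_loopMap (hφ : IsBasedGMap G A.toBased.pt B.toBased.pt φ)
    (hψ : IsBasedGMap G B.toBased.pt A.toBased.pt ψ) (h1 : ∀ x, ψ (φ x) = x)
    (h2 : ∀ y, φ (ψ y) = y) : IsWeakHomotopyEquiv (Z.loopMap H hφ) :=
  isWeakHomotopyEquiv_of_inverse (e := Z.loopMap H hψ)
    (fun γ => Path.ext (funext fun s => fixedMap_inverse hφ hψ h1 (γ s)))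
    (fun γ => Path.ext (funext fun s => fixedMap_inverse hψ hφ h2 (γ s)))

variable [CompactSpace G] [T2Space G]

/-- The adjoint structure map is natural, so that it is a weak equivalence for `B` if it is one for
an isomorphic object `A`, and conversely. -/
theorem isWeakHomotopyEquiv_fixedStructureMap_iff
    (hφ : IsBasedGMap G A.toBased.pt B.toBased.pt φ)
    (hψ : IsBasedGMap G B.toBased.pt A.toBased.pt ψ) (h1 : ∀ x, ψ (φ x) = x)
    (h2 : ∀ y, φ (ψ y) = y) : IsWeakHomotopyEquiv (Z.fixedStructureMap H B) ↔
      IsWeakHomotopyEquiv (Z.fixedStructureMap H A) := by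
  have hl : IsWeakHomotopyEquiv (Z.loopMap H (WG.isBasedGMap_suspMap hφ)) :=
    isWeakHomotopyEquiv_loopMap _ (WG.isBasedGMap_suspMap hψ)
      (Smash.ind (Y := A.toBased) fun t a => congrArg (Smash.mk t) (h1 a))
      (Smash.ind (Y := B.toBased) fun t a => congrArg (Smash.mk t) (h2 a))
  have hf := isWeakHomotopyEquiv_fixedHom (Z := Z) (H := H) hφ hψ h1 h2
  have e : (Z.fixedStructureMap H B).comp (fixedHom hφ) =
      (Z.loopMap H (WG.isBasedGMap_suspMap hφ)).comp (Z.fixedStructureMap H A) :=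
    ContinuousMap.ext (fixedStructureMap_natural hφ)
  rw [← hl.comp_iff, ← e]
  exact ⟨fun h => h.comp hf, hf.of_comp_right⟩

end Isomorphisms

end WGSpace

/-! ### The spheres `Sⁿ ∧ A` -/

section Spheres

variable {G : Type u} [Group G] [TopologicalSpace G]

theorem WG.t2Space (A : WG G) : T2Space A.toBased := A.isFiniteGCW.1

theorem WG.compactSpace [CompactSpace G] (A : WG G) : CompactSpace A.toBased :=
  compactSpace_of_isFiniteGCW A.isFiniteGCW

variable [CompactSpace G] [T2Space G]

theorem sphereMul_eq_infty {n : ℕ} {t : Sphere 1} {s : Sphere n} :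
    sphereMul t s = ∞ ↔ t = ∞ ∨ s = ∞ := by
  induction t using OnePoint.rec with
  | infty => simp [sphereMul]
  | coe t =>
    induction s using OnePoint.rec with
    | infty => simp [sphereMul]
    | coe s => simp [sphereMul]

theorem sphereMul_inj {n : ℕ} {t t' : Sphere 1} {s s' : Sphere n} (h : sphereMul t s ≠ ∞)
    (h' : sphereMul t s = sphereMul t' s') : t = t' ∧ s = s' := by
  have h1 := mt sphereMul_eq_infty.2 h
  have h2 := mt sphereMul_eq_infty.2 (h' ▸ h)
  rw [not_or] at h1 h2
  obtain ⟨t, rfl⟩ := OnePoint.ne_infty_iff_exists.1 h1.1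
  obtain ⟨s, rfl⟩ := OnePoint.ne_infty_iff_exists.1 h1.2
  obtain ⟨t', rfl⟩ := OnePoint.ne_infty_iff_exists.1 h2.1
  obtain ⟨s', rfl⟩ := OnePoint.ne_infty_iff_exists.1 h2.2
  have h3 : (Fin.cons (t 0) s : Fin (n + 1) → ℝ) = Fin.cons (t' 0) s' :=
    OnePoint.coe_injective h'
  obtain ⟨h4, h5⟩ := Fin.cons_injective2 h3
  refine ⟨congrArg _ (funext fun i => ?_), congrArg _ h5⟩
  rw [Subsingleton.elim i 0, h4]

theorem sphereMul_surjective {n : ℕ} (u : Sphere (n + 1)) :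
    ∃ (t : Sphere 1) (s : Sphere n), sphereMul t s = u := by
  induction u using OnePoint.rec with
  | infty => exact ⟨∞, ∞, sphereMul_infty _⟩
  | coe v => exact ⟨((fun _ => v 0 : Fin 1 → ℝ) : Sphere 1), ((Fin.tail v : Fin n → ℝ) : Sphere n),
      congrArg _ (Fin.cons_self_tail v)⟩

namespace WG

theorem bijective_smashAssoc (n : ℕ) (A : WG G) : Function.Bijective (A.smashAssoc n).1 := by
  have hmk : ∀ t s a, (A.smashAssoc n).1 (Smash.mk (Y := (A.smash n).toBased) t
      (Smash.mk (Y := A.toBased) s a)) = Smash.mk (Y := A.toBased) (sphereMul t s) a :=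
    fun _ _ _ => rfl
  constructor
  · refine Smash.ind (Y := (A.smash n).toBased) fun t => Smash.ind (Y := A.toBased) fun s a => ?_
    refine Smash.ind (Y := (A.smash n).toBased) fun t' =>
      Smash.ind (Y := A.toBased) fun s' a' => fun h => ?_
    rw [hmk, hmk] at h
    have key : ∀ t s (a : A.toBased), (sphereMul t s, a) ∈ wedge (n + 1) A.toBased →
        Smash.mk (Y := (A.smash n).toBased) t (Smash.mk (Y := A.toBased) s a) =
          Smash.pt 1 (A.smash n).toBased := fun t s a h => by
      rcases h with h | h
      · rcases sphereMul_eq_infty.1 h with rfl | rfl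
        · exact Smash.mk_infty _
        · exact (congrArg (Smash.mk (Y := (A.smash n).toBased) t) (Smash.mk_infty a)).trans
            (Smash.mk_pt t)
      · change a = A.toBased.pt at h
        subst h
        exact (congrArg (Smash.mk (Y := (A.smash n).toBased) t) (Smash.mk_pt s)).trans
            (Smash.mk_pt t)
    by_cases hw : (sphereMul t s, a) ∈ wedge (n + 1) A.toBased
    · have hw' : (sphereMul t' s', a') ∈ wedge (n + 1) A.toBased := by
        rcases Smash.mk_eq_mk.1 h with h | h
        · exact h ▸ hw
        · exact h.2
      rw [key t s a hw, key t' s' a' hw']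
    · rcases Smash.mk_eq_mk.1 h with h | h
      · obtain ⟨h1, h2⟩ := sphereMul_inj (fun h => hw (Or.inl h)) (congrArg Prod.fst h)
        have h3 : a = a' := congrArg Prod.snd h
        rw [h1, h2, h3]
      · exact absurd h.1 hw
  · refine Smash.ind (Y := A.toBased) fun u a => ?_
    obtain ⟨t, s, rfl⟩ := sphereMul_surjective u
    exact ⟨_, hmk t s a⟩

/-- The map `A → S⁰ ∧ A`. -/
def zeroSphereIncl (A : WG G) (a : A.toBased) : (A.smash 0).toBased :=
  Smash.mk (Y := A.toBased) ((0 : Fin 0 → ℝ) : Sphere 0) a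

theorem isBasedGMap_zeroSphereIncl (A : WG G) :
    IsBasedGMap G A.toBased.pt (A.smash 0).toBased.pt A.zeroSphereIncl where
  continuous := Smash.continuous_mk.comp (by fun_prop : Continuous fun a : A.toBased =>
    (((0 : Fin 0 → ℝ) : Sphere 0), a))
  map_pt := Smash.mk_pt _
  equivariant _ _ := rfl

theorem bijective_zeroSphereIncl (A : WG G) : Function.Bijective A.zeroSphereIncl := by
  constructor
  · intro a a' h
    rcases Smash.mk_eq_mk.1 h with h | ⟨h | h, h' | h'⟩
    · exact congrArg Prod.snd h
    · exact absurd h (OnePoint.coe_ne_infty _)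
    · exact absurd h (OnePoint.coe_ne_infty _)
    · exact absurd h' (OnePoint.coe_ne_infty _)
    · exact h.trans h'.symm
  · refine Smash.ind (Y := A.toBased) fun s a => ?_
    induction s using OnePoint.rec with
    | infty => exact ⟨A.toBased.pt, (Smash.mk_pt _).trans (Smash.mk_infty a).symm⟩
    | coe v =>
      exact ⟨a, congrArg (fun v : Fin 0 → ℝ => Smash.mk (Y := A.toBased) (v : Sphere 0) a)
        (Subsingleton.elim 0 v)⟩

end WG

end Spheres

namespace WGSpace

section Suspension

variable {G : Type u} [Group G] [TopologicalSpace G] [CompactSpace G] [T2Space G]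

/-- All prespectra `Z[A]` are `Ω`-prespectra if and only if all adjoint structure maps of `Z` are
weak equivalences on fixed points. -/
theorem forall_isOmega_iff (Z : WGSpace G) : (∀ A : WG G, (Z.prespectrum A).IsOmega) ↔
    ∀ (A : WG G) (H : Subgroup G), IsClosed (H : Set G) →
      IsWeakHomotopyEquiv (Z.fixedStructureMap H A) := by
  have hl : ∀ (n : ℕ) (A : WG G) (H : Subgroup G),
      IsWeakHomotopyEquiv (Z.loopMap H (isBasedGMap_smashAssoc n A)) := fun n A H => by
    have := (A.smash n).susp.compactSpace
    have := (A.smash (n + 1)).t2Space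
    obtain ⟨ψ, hψ, h1, h2⟩ := (isBasedGMap_smashAssoc n A).exists_inverse
      (A.bijective_smashAssoc n)
    exact isWeakHomotopyEquiv_loopMap _ hψ h1 h2
  simp only [isOmega_prespectrum_iff, (hl _ _ _).comp_iff]
  refine ⟨fun h A H hH => ?_, fun h A n => h (A.smash n)⟩
  have := A.compactSpace
  have := (A.smash 0).t2Space
  obtain ⟨ψ, hψ, h1, h2⟩ := A.isBasedGMap_zeroSphereIncl.exists_inverse A.bijective_zeroSphereIncl
  exact (isWeakHomotopyEquiv_fixedStructureMap_iff A.isBasedGMap_zeroSphereIncl hψ h1 h2).1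
    (h A 0 H hH)

/-! ### The suspension as a homotopy pushout -/

/-- The square `* ← A → *` with terminal corner `ΣA` and the tautological homotopy. -/
noncomputable def suspSquare (A : WG G) :
    GSquare A.toBased (WG.point G).toBased (WG.point G).toBased A.susp.toBased where
  f := BasedGSpace.Hom.zero _ _
  g := BasedGSpace.Hom.zero _ _
  h := BasedGSpace.Hom.zero _ _
  k := BasedGSpace.Hom.zero _ _
  η := ⟨fun p => A.suspIncl p.1 p.2, A.continuous_suspIncl⟩
  f_smul _ _ := rfl
  g_smul _ _ := rfl
  h_smul g _ := (A.susp.toBased.smul_pt g).symm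
  k_smul g _ := (A.susp.toBased.smul_pt g).symm
  η_smul _ _ _ := rfl
  η_pt := A.suspIncl_pt
  η_zero := A.suspIncl_zero
  η_one := A.suspIncl_one

theorem suspSquare_cases (A : WG G) (x : (suspSquare A).Cylinder) :
    x = (suspSquare A).cylinderPt ∨
      ∃ t a, x = (suspSquare A).mid t a ∧ intervalCollapse t ≠ ∞ ∧ a ≠ A.toBased.pt := by
  have hr : ∀ y, (suspSquare A).inr y = (suspSquare A).cylinderPt := fun _ =>
    (suspSquare A).inr_pt
  revert x
  refine (suspSquare A).cylinder_ind (fun _ => Or.inl rfl) (fun t a => ?_) fun y => Or.inl (hr y)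
  by_cases ha : a = A.toBased.pt
  · subst ha
    exact Or.inl ((suspSquare A).mid_pt t)
  · by_cases ht : intervalCollapse t = ∞
    · left
      rcases intervalCollapse_eq_infty.1 ht with rfl | rfl
      · exact (suspSquare A).mid_zero a
      · exact ((suspSquare A).mid_one a).trans (hr _)
    · exact Or.inr ⟨t, a, rfl, ht, ha⟩

theorem bijective_cylinderMap_suspSquare (A : WG G) :
    Function.Bijective (suspSquare A).cylinderMap := by
  have hmid : ∀ t a, (suspSquare A).cylinderMap ((suspSquare A).mid t a) =
    Smash.mk (Y := A.toBased) (intervalCollapse t) a := fun _ _ => rfl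
  have hpt : (suspSquare A).cylinderMap (suspSquare A).cylinderPt = Smash.pt 1 A.toBased := rfl
  constructor
  · intro x y h
    rcases suspSquare_cases A x with rfl | ⟨t, a, rfl, ht, ha⟩ <;>
      rcases suspSquare_cases A y with rfl | ⟨t', a', rfl, ht', ha'⟩
    · rfl
    · rw [hpt, hmid] at h
      rcases Smash.mk_eq_pt.1 h.symm with h | h
      exacts [absurd h ht', absurd h ha']
    · rw [hpt, hmid] at h
      rcases Smash.mk_eq_pt.1 h with h | h
      exacts [absurd h ht, absurd h ha]
    · rw [hmid, hmid] at h
      rcases Smash.mk_eq_mk.1 h with h | ⟨h | h, -⟩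
      · rw [intervalCollapse_inj ht (congrArg Prod.fst h), show a = a' from congrArg Prod.snd h]
      exacts [absurd h ht, absurd h ha]
  · refine Smash.ind (Y := A.toBased) fun s a => ?_
    obtain ⟨t, rfl⟩ := intervalCollapse_surjective s
    exact ⟨_, hmid t a⟩

theorem isHomotopyPushout_suspSquare (A : WG G) : (suspSquare A).IsHomotopyPushout := by
  have := A.compactSpace
  have := A.susp.t2Space
  have := (WG.point G).compactSpace
  have : CompactSpace (suspSquare A).Cylinder := Quot.compactSpace
  obtain ⟨ψ, hψ, h1, h2⟩ := (GSquare.isBasedGMap_cylinderMap (s := suspSquare A)).exists_inverse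
    (bijective_cylinderMap_suspSquare A)
  exact GSquare.isBasedGMap_cylinderMap.isBasedGHomotopyEquiv hψ h1 h2

variable (Z : WGSpace G) (H : Subgroup G) (A : WG G)

/-- The homotopy pullback for the suspension square is the loop space. -/
noncomputable def suspPullbackToLoops :
    C(Z.FixedPullback H (suspSquare A), Z.FixedLoops H A.susp) :=
  loopFamily (fun p t => HomotopyPullbackSpace.path _ _ p t)
    HomotopyPullbackSpace.continuous_path_apply
    (fun p => (HomotopyPullbackSpace.path_zero p).trans (fixedMap_const _))
    (fun p => (HomotopyPullbackSpace.path_one p).trans (fixedMap_const _))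

theorem isWeakHomotopyEquiv_suspPullbackToLoops :
    IsWeakHomotopyEquiv (suspPullbackToLoops Z H A) := by
  have := Z.subsingleton_point
  refine isWeakHomotopyEquiv_of_inverse (e := HomotopyPullbackSpace.lift
    (ContinuousMap.const _ (Z.fixedPt H (WG.point G))) ⟨fun p => p.1 p.2, by fun_prop⟩
    (ContinuousMap.const _ (Z.fixedPt H (WG.point G)))
    (fun γ => γ.source.trans (fixedMap_const _).symm)
    (fun γ => γ.target.trans (fixedMap_const _).symm)) (fun p => ?_) fun γ => rfl
  exact HomotopyPullbackSpace.ext (Subsingleton.elim _ _) (fun _ => rfl) (Subsingleton.elim _ _)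

variable {Z H A}

theorem isWeakHomotopyEquiv_fixedPullbackMap_suspSquare_iff :
    IsWeakHomotopyEquiv (fixedPullbackMap (Z := Z) (H := H) (suspSquare A)) ↔
      IsWeakHomotopyEquiv (Z.fixedStructureMap H A) := by
  rw [← (isWeakHomotopyEquiv_suspPullbackToLoops Z H A).comp_iff]
  rfl

end Suspension

end WGSpace

theorem propositionP {d : ℕ} (G : Type u) [Group G] [TopologicalSpace G]
    [ChartedSpace (EuclideanSpace ℝ (Fin d)) G] [LieGroup (𝓡 d) ((⊤ : ℕ∞) : WithTop ℕ∞) G]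
    [CompactSpace G] [T2Space G] (Z : WGSpace G) :
    [Z.TakesPushoutsToPullbacks,
      ∀ A : WG G, (Z.prespectrum A).IsOmega,
      ∀ A : WG G, IsGEquivalence G
        (adjointMap (Z.structureMap A) (Z.structureMap_pt A))].TFAE := by
  simp only [Z.forall_isOmega_iff, WGSpace.isGEquivalence_adjointMap_structureMap_iff]
  tfae_have 2 ↔ 3 := Iff.rfl
  tfae_have 1 → 3 := fun h A H hH =>
    WGSpace.isWeakHomotopyEquiv_fixedPullbackMap_suspSquare_iff.1
      ((WGSpace.isHomotopyPullback_mapSquare_iff (WGSpace.suspSquare A)).1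
        (h _ _ _ _ _ (WGSpace.isHomotopyPushout_suspSquare A)) H hH)
  tfae_have 3 → 1 := fun h A B C D s hs =>
    (WGSpace.isHomotopyPullback_mapSquare_iff s).2 fun H hH =>
      WGSpace.isWeakHomotopyEquiv_fixedPullbackMap (fun X => h X H hH) hs
  tfae_finish
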